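/- Let $n$ be a positive integer and let $q$ be a real number with $1\le q<n$. Energies and capacities. For compact $K\subset\mathbb R^n$ and $p>0$ let $$V_p(K)=\min_\mu\int_K\!\int_K\frac{d\mu(x)\,d\mu(y)}{|x-y|^p},\qquad V_{\log}(K)=\min_\mu\int_K\!\int_K\log\frac1{|x-y|}\,d\mu(x)\,d\mu(y),$$ over Borel probability measures $\mu$ on $K$ (both are $+\infty$ if $K=\emptyset$). Let $\mathrm{Cap}_p(K)=V_p(K)^{-1/p}$ for $p>0$ and $\mathrm{Cap}_0(K)=\exp(-V_{\log}(K))$. The set $K$ is called interior $p$-capacitable in $\mathbb R^n$ if $\mathrm{Cap}_p(K)=\sup\{\mathrm{Cap}_p(Q): Q\subset \mathrm{int}\,K \text{ compact}\}$. Strip energy. For $t>0$, $x,y\in\mathbb R^n$, $z,w\in[-t,t]$ write $\hat x=(x,z)$, $\hat y=(y,w)$, $\rho_j(\hat y)=(y,2tj+(-1)^jw)$ for $j\in\mathbb Z$, and let $$G_t(\hat x,\hat y)=\sum_{j\in\mathbb Z}\frac1{|\hat x-\rho_j(\hat y)|^q}\quad(q>1),$$ $$G_t(\hat x,\hat y)=\frac1{|\hat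 x-\hat y|}+\sum_{j\ne0}\Big(\frac1{|\hat x-\rho_j(\hat y)|}-\frac1{|2tj|}\Big)+\frac1t\big(\gamma-\log(4t)\big)\quad(q=1),$$ where $\gamma$ is the Euler--Mascheroni constant. Identifying $\mathbb R^n$ with $\mathbb R^n\times\{0\}$, the Neumann strip energy of a compact set $K\subset\mathbb R^n$ is $E_K(t)=\min_\mu\int_K\int_K G_t\,d\mu\,d\mu$, over Borel probability measures $\mu$ on $K$. Theorem. Let $K\subset\mathbb R^n$ be compact with $V_q(K)<\infty$. Then $E_K(t)$ is finite for every $t>0$ and is a $C^1$ function of $t\in(0,\infty)$, $$\lim_{t\to\infty}E_K(t)=V_q(K),\qquad \liminf_{t\to0^+}tE_K(t)\ \ge\ L(K):=\begin{cases}c_{q-1}V_{q-1}(K)&\text{if }q>1,\\ V_{\log}(K)&\text{if }q=1,\end{cases}$$ where $c_{q-1}=\frac12\int_{-\infty}^\infty(1+s^2)^{-q/2}\,ds$. If moreover $K$ is interior $(q-1)$-capacitable in $\mathbb R^n$, then $\lim_{t\to0^+}tE_K(t)=L(K)$. In particular, every convex body $K\subset\mathbb R^n$ (compact, convex, with non-empty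 interior) has $V_q(K)<\infty$ and is interior $(q-1)$-capacitable, and hence $\lim_{t\to0^+}tE_K(t)=L(K)$. -/

import Mathlib

open Set Filter Topology MeasureTheory
open scoped ENNReal

noncomputable section

namespace RieszStrip

/-- Integral of an extended-real function, as integral of the positive part minus integral of the
negative part. It is the usual integral, with values in `(-∞, ∞]`, as soon as the negative part has
finite integral; this is the case for all kernels below, which are bounded below on bounded sets. -/
def eintegral {X : Type*} [MeasurableSpace X] (μ : Measure X) (f : X → EReal) : EReal :=
  ((∫⁻ x, (f x).toENNReal ∂μ : ℝ≥0∞) : EReal) - ((∫⁻ x, (-f x).toENNReal ∂μ : ℝ≥0∞) : EReal)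

/-- The minimal energy of a set `K` for an interaction kernel `k`: the infimum of
`∫∫ k(x,y) dμ(x) dμ(y)` over all Borel probability measures `μ` on `K`.
It is `+∞` for the empty set. -/
def energy {X : Type*} [MeasurableSpace X] (k : X → X → EReal) (K : Set X) : EReal :=
  ⨅ (μ : Measure X) (_ : IsProbabilityMeasure μ) (_ : μ Kᶜ = 0),
    eintegral (μ.prod μ) (fun p => k p.1 p.2)

/-- `|x - y|^{-q}`, equal to `+∞` on the diagonal (for `q > 0`). -/
def rieszKernel {X : Type*} [PseudoEMetricSpace X] (q : ℝ) (x y : X) : ℝ≥0∞ :=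
  edist x y ^ (-q)

/-- The Riesz energy `V_q(K)`, for `q > 0`. -/
def rieszEnergy {n : ℕ} (q : ℝ) (K : Set (EuclideanSpace ℝ (Fin n))) : EReal :=
  energy (fun x y => ((rieszKernel q x y : ℝ≥0∞) : EReal)) K

/-- The logarithmic energy `V_log(K)`, with kernel `log (1 / |x - y|)`, equal to `+∞` on the
diagonal. -/
def logEnergy {n : ℕ} (K : Set (EuclideanSpace ℝ (Fin n))) : EReal :=
  energy (fun x y => -ENNReal.log (edist x y)) K

/-- The Riesz capacity: `V_q(K)^{-1/q}` for `q > 0`, and `exp(-V_log(K))` for `q = 0`. -/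
def capacity {n : ℕ} (q : ℝ) (K : Set (EuclideanSpace ℝ (Fin n))) : ℝ≥0∞ :=
  if 0 < q then (rieszEnergy q K).toENNReal ^ (-(1 / q)) else EReal.exp (-logEnergy K)

/-- The capacity of `K` is the supremum of the capacities of the compact subsets of its
interior. -/
def InteriorCapacitable {n : ℕ} (q : ℝ) (K : Set (EuclideanSpace ℝ (Fin n))) : Prop :=
  capacity q K =
    ⨆ (Q : Set (EuclideanSpace ℝ (Fin n))) (_ : IsCompact Q) (_ : Q ⊆ interior K), capacity q Q

/-- `ℝⁿ × ℝ = ℝⁿ⁺¹` with its Euclidean metric; points are written `(x, z)`. -/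
abbrev Space (n : ℕ) : Type := WithLp 2 (EuclideanSpace ℝ (Fin n) × ℝ)

/-- The point `(x, z)`. -/
def pt {n : ℕ} (x : EuclideanSpace ℝ (Fin n)) (z : ℝ) : Space n := WithLp.toLp 2 (x, z)

/-- The repeated reflections `ρ_j(y, w) = (y, 2tj + (-1)^j w)`, for `j ∈ ℤ`. -/
def reflect {n : ℕ} (t : ℝ) (j : ℤ) (y : Space n) : Space n :=
  pt y.fst (2 * t * j + (-1 : ℝ) ^ j * y.snd)

open Classical in
/-- The Neumann kernel `G_t` on the closed strip `ℝⁿ × [-t, t]`, for exponents `q ≥ 1`.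
For `q > 1` it is `∑_j |x - ρ_j(y)|^{-q}`, a series in `[0, ∞]`. For `q = 1` it is
`1/|x - y| + ∑_{j ≠ 0} (1/|x - ρ_j(y)| - 1/|2tj|) + (γ - log(4t))/t`, which is `+∞` where one
of the denominators `|x - ρ_j(y)|` vanishes and is an absolutely convergent real series
elsewhere. -/
def stripKernel {n : ℕ} (q t : ℝ) (x y : Space n) : EReal :=
  if 1 < q then ((∑' j : ℤ, rieszKernel q x (reflect t j y) : ℝ≥0∞) : EReal)
  else if ∃ j : ℤ, x = reflect t j y then ⊤
  else ((1 / dist x y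
      + ∑' j : {j : ℤ // j ≠ 0}, (1 / dist x (reflect t j y) - 1 / |2 * t * (j : ℤ)|)
      + 1 / t * (Real.eulerMascheroniConstant - Real.log (4 * t)) : ℝ) : EReal)

/-- The strip energy `E_K(t)` of `K ⊆ ℝⁿ`, where `ℝⁿ` is identified with the hyperplane
`ℝⁿ × {0}` at the middle of the strip. -/
def stripEnergy {n : ℕ} (q : ℝ) (K : Set (EuclideanSpace ℝ (Fin n))) (t : ℝ) : EReal :=
  energy (fun x y => stripKernel q t (pt x 0) (pt y 0)) K

/-- `c_p = (1/2) ∫_ℝ (1 + s²)^{-(p+1)/2} ds`, for `p > 0`. -/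
def thinConst (p : ℝ) : ℝ :=
  1 / 2 * ∫ s : ℝ, 1 / (1 + s ^ 2) ^ ((p + 1) / 2)

/-- The thin strip endpoint: `c_{q-1} V_{q-1}(K)` for `q > 1`, and `V_log(K)` for `q = 1`. -/
def thinEndpoint {n : ℕ} (q : ℝ) (K : Set (EuclideanSpace ℝ (Fin n))) : EReal :=
  if 1 < q then (thinConst (q - 1) : EReal) * rieszEnergy (q - 1) K else logEnergy K

end RieszStrip

end

/-! On the middle hyperplane the strip kernel is $|x-y|^{-q}$ plus a regular part, a smooth function
of $t$ and of $r=|x-y|$ (`stripKernel_eq`). Three facts about this splitting carry the theorem.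

Convexity. The kernels $(r^2+a)^{-p}$ are positive superpositions of Gaussians, and a Gaussian is a
convolution square up to a factor. Hence the Riesz kernel is strictly positive definite on
differences of probability measures of finite energy, and the regular part is positive semidefinite
there: additive constants, in particular the renormalization for $q=1$, do not count on signed
measures of mass zero. So the minimizer is unique for each $t$ (`eq_of_isMin_totalEnergy`), and weak
compactness with Danskin's theorem (`exists_contDiff_iInf`) gives the $C^1$ dependence.

Large $t$. The regular part tends to $0$ uniformly on bounded distances, so the minima converge.

Small $t$. Let $\varphi$ be the endpoint kernel. For every $t>0$, off the diagonal,
$t\cdot(\text{regular part})\le\varphi\le t\,G_t$ (`mul_stripRegular_le`, `thinProfile_le`). After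
scaling to $t=1$ this compares a lattice sum with an integral. The left inequality is the integral
test. The right one admits no loss, and comes for $q>1$ from Poisson summation for Gaussians; for
$q=1$ it is obtained by integrating the case $q=3$. The right inequality gives $L(K)\le tE_K(t)$ for
all $t$. The left one gives $tE_K(t)\le tI_q(\mu)+I_\varphi(\mu)$ for each $\mu$ on $K$, so the
limit follows once some $\mu$ has finite $q$-energy and $I_\varphi(\mu)$ close to $L(K)$. Interior
capacitability supplies a nearly optimal measure on a compact subset of the interior; convolving it
with a small uniform ball stays in $K$, makes the $q$-energy finite, and does not raise $I_\varphi$,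
by positive definiteness. For a convex body, contraction towards an interior point proves
capacitability. -/

set_option linter.unusedSectionVars false

noncomputable section

namespace RieszStrip

/-! ### Integrals and minimal energies with extended-real values. -/

section ExtendedIntegral

variable {X : Type*} [MeasurableSpace X] {μ : Measure X}

theorem eintegral_mono_ae {f g : X → EReal} (h : ∀ᵐ x ∂μ, f x ≤ g x) :
    eintegral μ f ≤ eintegral μ g := by
  refine EReal.sub_le_sub ?_ ?_
  · exact_mod_cast lintegral_mono_ae (h.mono fun x hx => EReal.toENNReal_le_toENNReal hx)
  · exact_mod_cast lintegral_mono_ae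
      (h.mono fun x hx => EReal.toENNReal_le_toENNReal (EReal.neg_le_neg_iff.2 hx))

theorem eintegral_congr_ae {f g : X → EReal} (h : ∀ᵐ x ∂μ, f x = g x) :
    eintegral μ f = eintegral μ g :=
  le_antisymm (eintegral_mono_ae (h.mono fun _ hx => hx.le))
    (eintegral_mono_ae (h.mono fun _ hx => hx.ge))

theorem eintegral_coe (f : X → ℝ≥0∞) :
    eintegral μ (fun x => (f x : EReal)) = ((∫⁻ x, f x ∂μ : ℝ≥0∞) : EReal) := by
  have h : ∀ x, (-(f x : EReal)).toENNReal = 0 := fun x =>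
    EReal.toENNReal_of_nonpos (by simpa using EReal.neg_le_neg_iff.2 (EReal.coe_ennreal_nonneg (f x)))
  simp only [eintegral, h, EReal.toENNReal_coe, lintegral_zero, EReal.coe_ennreal_zero, sub_zero]

/-- For $h=a+b$ this is $h^+-h^-=a+b^+-b^-$ with the subtractions moved across, so that it can be
integrated in $[0,\infty]$ before anything is known to be finite. -/
theorem toENNReal_coe_add_coe (a : ℝ≥0∞) (b : ℝ) :
    ((a : EReal) + (b : EReal)).toENNReal + ENNReal.ofReal (-b)
      = (-((a : EReal) + (b : EReal))).toENNReal + (a + ENNReal.ofReal b) := by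
  induction a with
  | top => simp
  | coe a =>
    have h1 : (((a : ℝ≥0∞) : EReal) + (b : EReal)) = ((a + b : ℝ) : EReal) := by
      push_cast; rfl
    rw [h1, ← EReal.coe_neg, EReal.real_coe_toENNReal, EReal.real_coe_toENNReal]
    have ha : (0 : ℝ) ≤ a := a.2
    have h2 : (a : ℝ≥0∞) = ENNReal.ofReal a := by simp
    rw [h2]
    rcases le_total 0 b with hb | hb
    · rw [ENNReal.ofReal_of_nonpos (p := -b) (by linarith),
        ENNReal.ofReal_of_nonpos (p := -((a : ℝ) + b)) (by linarith),
        ENNReal.ofReal_add ha hb, zero_add, add_zero]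
    · rw [ENNReal.ofReal_of_nonpos (p := b) hb, add_zero]
      rcases le_total 0 ((a : ℝ) + b) with hab | hab
      · rw [ENNReal.ofReal_of_nonpos (p := -((a : ℝ) + b)) (by linarith),
          ← ENNReal.ofReal_add hab (by linarith), zero_add]
        congr 1; ring
      · rw [ENNReal.ofReal_of_nonpos (p := ((a : ℝ) + b)) (by linarith),
          ← ENNReal.ofReal_add (by linarith) ha, zero_add]
        congr 1; ring

/-- The negative part of $f+g$ is at most that of $g$, hence has finite integral, and the difference
defining `eintegral` never takes the form $\infty-\infty$. -/
theorem eintegral_coe_add {f : X → ℝ≥0∞} (hf : Measurable f) {g : X → ℝ} (hgm : Measurable g)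
    (hg : Integrable g μ) :
    eintegral μ (fun x => (f x : EReal) + (g x : EReal))
      = ((∫⁻ x, f x ∂μ : ℝ≥0∞) : EReal) + ((∫ x, g x ∂μ : ℝ) : EReal) := by
  set P : ℝ≥0∞ := ∫⁻ x, ((f x : EReal) + (g x : EReal)).toENNReal ∂μ with hP
  set N : ℝ≥0∞ := ∫⁻ x, (-((f x : EReal) + (g x : EReal))).toENNReal ∂μ with hN
  set gp : ℝ≥0∞ := ∫⁻ x, ENNReal.ofReal (g x) ∂μ with hgp
  set gn : ℝ≥0∞ := ∫⁻ x, ENNReal.ofReal (-g x) ∂μ with hgn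
  have key : P + gn = N + (∫⁻ x, f x ∂μ + gp) := by
    rw [hP, hgn, ← lintegral_add_right _ (by fun_prop), hgp, ← lintegral_add_left hf,
      hN, ← lintegral_add_right _ (by fun_prop)]
    exact lintegral_congr fun x => toENNReal_coe_add_coe _ _
  have hgp_fin : gp ≠ ⊤ := hg.lintegral_lt_top.ne
  have hgn_fin : gn ≠ ⊤ := hg.neg.lintegral_lt_top.ne
  have hN_le : N ≤ gn := by
    refine lintegral_mono fun x => ?_
    rw [← EReal.real_coe_toENNReal]
    refine EReal.toENNReal_le_toENNReal ?_
    rw [EReal.coe_neg, EReal.neg_le_neg_iff]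
    exact le_add_of_nonneg_left (EReal.coe_ennreal_nonneg _)
  have hN_fin : N ≠ ⊤ := ne_top_of_le_ne_top hgn_fin hN_le
  rw [integral_eq_lintegral_pos_part_sub_lintegral_neg_part hg, ← hgp, ← hgn]
  change (P : EReal) - (N : EReal) = _
  generalize (∫⁻ x, f x ∂μ) = F at *
  clear_value P N gp gn
  induction F with
  | top =>
    have : P = ⊤ := by
      have h : P + gn = ⊤ := by rw [key]; simp
      exact (ENNReal.add_eq_top.1 h).resolve_right hgn_fin
    subst this
    lift N to NNReal using hN_fin
    rw [EReal.coe_ennreal_top, EReal.top_add_coe]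
    exact EReal.top_sub_coe _
  | coe F =>
    have hPfin : P ≠ ⊤ := by
      intro h
      rw [h, top_add] at key
      exact ENNReal.add_ne_top.2 ⟨hN_fin, ENNReal.add_ne_top.2 ⟨ENNReal.coe_ne_top, hgp_fin⟩⟩
        key.symm
    lift P to NNReal using hPfin
    lift N to NNReal using hN_fin
    lift gp to NNReal using hgp_fin
    lift gn to NNReal using hgn_fin
    have h2 : (P : ℝ) + gn = N + (F + gp) := by exact_mod_cast key
    have h3 : (P : ℝ) - N = F + (gp - gn) := by linarith
    simp only [ENNReal.coe_toReal, EReal.coe_nnreal_eq_coe_real]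
    exact_mod_cast congrArg (fun r : ℝ => (r : EReal)) h3

theorem coe_mul_eq_left_distrib {t : ℝ} (ht : 0 < t) (a b : EReal) :
    (t : EReal) * (a - b) = t * a - t * b :=
  EReal.mul_sub_of_nonneg_of_ne_top (by exact_mod_cast ht.le) (EReal.coe_ne_top t)

theorem eintegral_const_mul {t : ℝ} (ht : 0 < t) (f : X → EReal) :
    eintegral μ (fun x => (t : EReal) * f x) = t * eintegral μ f := by
  have h0 : (0 : EReal) ≤ t := by exact_mod_cast ht.le
  have h1 : ∀ x, ((t : EReal) * f x).toENNReal = ENNReal.ofReal t * (f x).toENNReal := fun x => by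
    rw [EReal.toENNReal_mul h0, EReal.real_coe_toENNReal]
  have h2 : ∀ x, (-((t : EReal) * f x)).toENNReal = ENNReal.ofReal t * (-f x).toENNReal :=
    fun x => by rw [← mul_neg, EReal.toENNReal_mul h0, EReal.real_coe_toENNReal]
  have h3 : ((ENNReal.ofReal t : ℝ≥0∞) : EReal) = t := by
    rw [EReal.coe_ennreal_ofReal, max_eq_left ht.le]
  unfold eintegral
  simp only [h1, h2, lintegral_const_mul' _ _ ENNReal.ofReal_ne_top, EReal.coe_ennreal_mul, h3]
  rw [coe_mul_eq_left_distrib ht]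

theorem energy_le {k : X → X → EReal} {K : Set X} (μ : Measure X) [IsProbabilityMeasure μ]
    (hμ : μ Kᶜ = 0) : energy k K ≤ eintegral (μ.prod μ) (fun p => k p.1 p.2) :=
  iInf_le_of_le μ (iInf_le_of_le ‹_› (iInf_le_of_le hμ le_rfl))

theorem le_energy {k : X → X → EReal} {K : Set X} {a : EReal}
    (h : ∀ μ : Measure X, IsProbabilityMeasure μ → μ Kᶜ = 0 →
      a ≤ eintegral (μ.prod μ) (fun p => k p.1 p.2)) : a ≤ energy k K :=
  le_iInf fun μ => le_iInf fun h1 => le_iInf fun h2 => h μ h1 h2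

theorem exists_lt_of_energy_lt {k : X → X → EReal} {K : Set X} {a : EReal} (h : energy k K < a) :
    ∃ μ : Measure X, IsProbabilityMeasure μ ∧ μ Kᶜ = 0 ∧
      eintegral (μ.prod μ) (fun p => k p.1 p.2) < a := by
  simpa only [energy, iInf_lt_iff, exists_prop] using h

theorem energy_anti {k : X → X → EReal} {K L : Set X} (h : K ⊆ L) : energy k L ≤ energy k K :=
  le_energy fun μ _ hμ => energy_le μ (measure_mono_null (compl_subset_compl.2 h) hμ)

theorem ae_prod_mem {Y : Type*} [MeasurableSpace Y] {μ : Measure X} {ν : Measure Y}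
    [SFinite μ] [SFinite ν] {K : Set X} {L : Set Y} (hμ : μ Kᶜ = 0) (hν : ν Lᶜ = 0) :
    ∀ᵐ p ∂(μ.prod ν), p.1 ∈ K ∧ p.2 ∈ L := by
  have h1 : ∀ᵐ x ∂μ, x ∈ K := hμ
  have h2 : ∀ᵐ y ∂ν, y ∈ L := hν
  exact (Measure.quasiMeasurePreserving_fst.ae h1).and (Measure.quasiMeasurePreserving_snd.ae h2)

end ExtendedIntegral

/-! ### Mutual energies, positive definite kernels and their mixtures. -/

section CrossEnergy

variable {X : Type*} [MeasurableSpace X]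

/-- The mutual energy `∫∫ k(x,y) dν(y) dμ(x)` of two measures. -/
def crossEnergy (k : X → X → ℝ≥0∞) (μ ν : Measure X) : ℝ≥0∞ := ∫⁻ x, ∫⁻ y, k x y ∂ν ∂μ

/-- The kernel `k` is positive definite, tested against differences of probability measures. -/
def PosDefKernel (k : X → X → ℝ≥0∞) : Prop :=
  ∀ μ ν : Measure X, IsProbabilityMeasure μ → IsProbabilityMeasure ν →
    2 * crossEnergy k μ ν ≤ crossEnergy k μ μ + crossEnergy k ν ν

/-- Vanishing of the energy of the difference of two probability measures of finite energy forces
them to be equal. -/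
def StrictKernel (k : X → X → ℝ≥0∞) : Prop :=
  ∀ μ ν : Measure X, IsProbabilityMeasure μ → IsProbabilityMeasure ν →
    crossEnergy k μ μ ≠ ⊤ → crossEnergy k ν ν ≠ ⊤ →
    crossEnergy k μ μ + crossEnergy k ν ν ≤ 2 * crossEnergy k μ ν → μ = ν

theorem crossEnergy_eq_lintegral_prod {k : X → X → ℝ≥0∞} (hk : Measurable (Function.uncurry k))
    (μ ν : Measure X) [SFinite ν] :
    crossEnergy k μ ν = ∫⁻ p, k p.1 p.2 ∂(μ.prod ν) :=
  (lintegral_prod _ hk.aemeasurable).symm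

theorem crossEnergy_const_mul {k : X → X → ℝ≥0∞} (hk : Measurable (Function.uncurry k)) (c : ℝ≥0∞)
    (μ ν : Measure X) [SFinite ν] :
    crossEnergy (fun x y => c * k x y) μ ν = c * crossEnergy k μ ν := by
  rw [crossEnergy_eq_lintegral_prod (by exact measurable_const.mul hk),
    crossEnergy_eq_lintegral_prod hk]
  exact lintegral_const_mul _ hk

theorem PosDefKernel.const_mul {k : X → X → ℝ≥0∞} (hk : Measurable (Function.uncurry k))
    (h : PosDefKernel k) (c : ℝ≥0∞) : PosDefKernel fun x y => c * k x y := by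
  intro μ ν hμ hν
  simp only [crossEnergy_const_mul hk]
  calc 2 * (c * crossEnergy k μ ν) = c * (2 * crossEnergy k μ ν) := by ring
    _ ≤ c * (crossEnergy k μ μ + crossEnergy k ν ν) := by gcongr; exact h μ ν hμ hν
    _ = _ := by ring

theorem StrictKernel.const_mul {k : X → X → ℝ≥0∞} (hk : Measurable (Function.uncurry k))
    (h : StrictKernel k) {c : ℝ≥0∞} (hc : c ≠ 0) (hc' : c ≠ ⊤) :
    StrictKernel fun x y => c * k x y := by
  intro μ ν hμ hν h1 h2 h3
  simp only [crossEnergy_const_mul hk] at h1 h2 h3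
  refine h μ ν hμ hν (fun h => h1 (by simp [h, hc])) (fun h => h2 (by simp [h, hc])) ?_
  rw [← ENNReal.mul_le_mul_iff_right hc hc']
  calc _ = c * crossEnergy k μ μ + c * crossEnergy k ν ν := by ring
    _ ≤ _ := h3
    _ = _ := by ring

variable {A : Type*} [MeasurableSpace A]

theorem crossEnergy_mixture {κ : A → X → X → ℝ≥0∞}
    (hκ : Measurable fun p : A × X × X => κ p.1 p.2.1 p.2.2) (w : Measure A) [SFinite w]
    (μ ν : Measure X) [SFinite μ] [SFinite ν] :
    crossEnergy (fun x y => ∫⁻ a, κ a x y ∂w) μ ν = ∫⁻ a, crossEnergy (κ a) μ ν ∂w := by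
  have h1 : ∀ a, Measurable (Function.uncurry (κ a)) := fun a =>
    hκ.comp (measurable_const.prodMk measurable_id)
  have h2 : Measurable fun p : (X × X) × A => κ p.2 p.1.1 p.1.2 :=
    hκ.comp (measurable_snd.prodMk measurable_fst)
  rw [crossEnergy_eq_lintegral_prod (by exact h2.lintegral_prod_right')]
  simp_rw [fun a => crossEnergy_eq_lintegral_prod (h1 a) μ ν]
  exact lintegral_lintegral_swap h2.aemeasurable

theorem measurable_crossEnergy {κ : A → X → X → ℝ≥0∞}
    (hκ : Measurable fun p : A × X × X => κ p.1 p.2.1 p.2.2)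
    (μ ν : Measure X) [SFinite μ] [SFinite ν] : Measurable fun a => crossEnergy (κ a) μ ν := by
  have h1 : ∀ a, Measurable (Function.uncurry (κ a)) := fun a =>
    hκ.comp (measurable_const.prodMk measurable_id)
  simp_rw [fun a => crossEnergy_eq_lintegral_prod (h1 a) μ ν]
  exact hκ.lintegral_prod_right'

theorem PosDefKernel.mixture {κ : A → X → X → ℝ≥0∞}
    (hκ : Measurable fun p : A × X × X => κ p.1 p.2.1 p.2.2) (w : Measure A) [SFinite w]
    (h : ∀ᵐ a ∂w, PosDefKernel (κ a)) : PosDefKernel fun x y => ∫⁻ a, κ a x y ∂w := by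
  intro μ ν hμ hν
  simp only [crossEnergy_mixture hκ]
  rw [← lintegral_const_mul _ (measurable_crossEnergy hκ μ ν),
    ← lintegral_add_left (measurable_crossEnergy hκ μ μ)]
  exact lintegral_mono_ae (h.mono fun a ha => ha μ ν hμ hν)

/-- The defects of the kernels $\kappa_a$ are nonnegative and integrate to zero, so almost all of
them vanish. As $w\ne0$, some $a$ has vanishing defect, finite energies and a strict $\kappa_a$,
which is enough. -/
theorem StrictKernel.mixture {κ : A → X → X → ℝ≥0∞}
    (hκ : Measurable fun p : A × X × X => κ p.1 p.2.1 p.2.2) {w : Measure A} [SFinite w]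
    (hw : w ≠ 0) (h : ∀ᵐ a ∂w, PosDefKernel (κ a)) (hs : ∀ᵐ a ∂w, StrictKernel (κ a)) :
    StrictKernel fun x y => ∫⁻ a, κ a x y ∂w := by
  intro μ ν hμ hν h1 h2 h3
  simp only [crossEnergy_mixture hκ] at h1 h2 h3
  have m := measurable_crossEnergy hκ
  rw [← lintegral_const_mul _ (m μ ν), ← lintegral_add_left (m μ μ)] at h3
  -- In $[0,\infty]$, equality of the integrals of two ordered functions gives almost everywhere
  -- equality only if the smaller integral is finite.
  have h4 : ∫⁻ a, 2 * crossEnergy (κ a) μ ν ∂w ≠ ⊤ := by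
    refine ne_top_of_le_ne_top (ENNReal.add_ne_top.2 ⟨h1, h2⟩) ?_
    rw [← lintegral_add_left (m μ μ)]
    exact lintegral_mono_ae (h.mono fun a ha => ha μ ν hμ hν)
  have h5 := ae_eq_of_ae_le_of_lintegral_le (h.mono fun a ha => ha μ ν hμ hν) h4
    ((m μ μ).add (m ν ν)).aemeasurable h3
  have : NeZero w := ⟨hw⟩
  obtain ⟨a, ha, ha', ha1, ha2⟩ := (h5.and (hs.and ((ae_lt_top (m μ μ) h1).and
    (ae_lt_top (m ν ν) h2)))).exists
  exact ha' μ ν hμ hν ha1.ne ha2.ne ha.ge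

end CrossEnergy

/-! ### Strict positive definiteness of the Gaussian kernel. -/

section Gaussian

variable {E : Type*} [NormedAddCommGroup E] [InnerProductSpace ℝ E] [FiniteDimensional ℝ E]
  [MeasurableSpace E] [BorelSpace E]

/-- The Gaussian kernel `exp(-s|x-y|²)`. -/
def gaussianKernel (s : ℝ) (x y : E) : ℝ≥0∞ := ENNReal.ofReal (Real.exp (-(s * ‖x - y‖ ^ 2)))

@[fun_prop]
theorem measurable_gaussianKernel_comp {Ω : Type*} [MeasurableSpace Ω] {a : Ω → ℝ} {f g : Ω → E}
    (ha : Measurable a) (hf : Measurable f) (hg : Measurable g) :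
    Measurable fun ω => gaussianKernel (a ω) (f ω) (g ω) := by
  unfold gaussianKernel
  fun_prop

theorem measurable_gaussianKernel_uncurry (s : ℝ) :
    Measurable (Function.uncurry (gaussianKernel s : E → E → ℝ≥0∞)) := by
  unfold Function.uncurry
  fun_prop

/-- Parallelogram law: $2|x-u|^2+2|y-u|^2=|x-y|^2+4\,|u-\tfrac12(x+y)|^2$. Integrating over $u$
exhibits the Gaussian as a convolution square. -/
theorem gaussianKernel_mul (s : ℝ) (x y u : E) :
    gaussianKernel (2 * s) x u * gaussianKernel (2 * s) y u
      = gaussianKernel s x y * gaussianKernel (4 * s) 0 (u - (2⁻¹ : ℝ) • (x + y)) := by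
  unfold gaussianKernel
  rw [← ENNReal.ofReal_mul (Real.exp_pos _).le, ← ENNReal.ofReal_mul (Real.exp_pos _).le,
    ← Real.exp_add, ← Real.exp_add]
  congr 2
  have h := parallelogram_law_with_norm ℝ (x - u) (y - u)
  have h1 : x - u - (y - u) = x - y := by abel
  have h2 : (0 : E) - (u - (2⁻¹ : ℝ) • (x + y)) = (2⁻¹ : ℝ) • (x - u + (y - u)) := by
    module
  rw [h1] at h
  rw [h2, norm_smul]
  norm_num
  linear_combination s * h

/-- The total mass of the Gaussian `exp(-4s|u|²)`. -/
def gaussianMass (E : Type*) [NormedAddCommGroup E] [InnerProductSpace ℝ E]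
    [FiniteDimensional ℝ E] [MeasurableSpace E] [BorelSpace E] (s : ℝ) : ℝ≥0∞ :=
  ∫⁻ u : E, gaussianKernel (4 * s) 0 u

theorem integrable_exp_neg_mul_sq {b : ℝ} (hb : 0 < b) :
    Integrable fun v : E => Real.exp (-b * ‖v‖ ^ 2) := by
  have h := (GaussianFourier.integrable_cexp_neg_mul_sq_norm_add (V := E)
    (show 0 < (b : ℂ).re from hb) 0 0).norm
  refine h.congr (ae_of_all _ fun v => ?_)
  simp only [Complex.norm_exp]
  congr 1
  simp [← Complex.ofReal_pow, ← Complex.ofReal_mul, ← Complex.ofReal_neg]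

theorem gaussianMass_ne_top {s : ℝ} (hs : 0 < s) : gaussianMass E s ≠ ⊤ := by
  have h := (integrable_exp_neg_mul_sq (E := E) (show 0 < 4 * s by positivity)).lintegral_lt_top
  simpa [gaussianMass, gaussianKernel] using h.ne

theorem gaussianMass_ne_zero (s : ℝ) : gaussianMass E s ≠ 0 := by
  intro h
  have hm : Measurable fun u : E => gaussianKernel (4 * s) 0 u := by fun_prop
  rw [gaussianMass, lintegral_eq_zero_iff hm] at h
  obtain ⟨u, hu⟩ := h.exists
  simp [gaussianKernel] at hu
  exact absurd hu (not_le.2 (Real.exp_pos _))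

theorem lintegral_gaussianKernel_mul (s : ℝ) (x y : E) :
    ∫⁻ u, gaussianKernel (2 * s) x u * gaussianKernel (2 * s) y u
      = gaussianMass E s * gaussianKernel s x y := by
  have hm : Measurable fun u : E => gaussianKernel (4 * s) 0 u := by fun_prop
  simp_rw [gaussianKernel_mul s x y]
  rw [lintegral_const_mul _ (by fun_prop),
    lintegral_sub_right_eq_self (fun u : E => gaussianKernel (4 * s) 0 u), mul_comm, gaussianMass]

/-- The Gaussian potential of a measure. -/
def gaussianPotential (s : ℝ) (μ : Measure E) (u : E) : ℝ≥0∞ := ∫⁻ x, gaussianKernel (2 * s) x u ∂μ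

theorem measurable_gaussianPotential (s : ℝ) (μ : Measure E) [SFinite μ] :
    Measurable (gaussianPotential s μ) :=
  Measurable.lintegral_prod_right' (f := fun p : E × E => gaussianKernel (2 * s) p.2 p.1)
    (by fun_prop)

/-- The mutual energy becomes an $L^2$ pairing of potentials, so positive definiteness reduces to
$2ab\le a^2+b^2$ pointwise. -/
theorem crossEnergy_gaussianKernel (s : ℝ) (μ ν : Measure E) [SFinite μ] [SFinite ν] :
    gaussianMass E s * crossEnergy (gaussianKernel s) μ ν
      = ∫⁻ u, gaussianPotential s μ u * gaussianPotential s ν u := by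
  have h1 : ∀ u, Measurable fun x : E => gaussianKernel (2 * s) x u := fun u => by fun_prop
  rw [← crossEnergy_const_mul (measurable_gaussianKernel_uncurry _)]
  simp_rw [← lintegral_gaussianKernel_mul]
  rw [crossEnergy_mixture (κ := fun u x y => gaussianKernel (2 * s) x u * gaussianKernel (2 * s) y u)]
  · refine lintegral_congr fun u => ?_
    unfold crossEnergy gaussianPotential
    simp_rw [lintegral_const_mul _ (h1 u)]
    rw [lintegral_mul_const _ (h1 u)]
  · fun_prop

theorem two_mul_le_add_mul_self (a b : ℝ≥0∞) : 2 * (a * b) ≤ a * a + b * b := by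
  induction a with
  | top => simp
  | coe a =>
    induction b with
    | top => simp
    | coe b =>
      have h : 2 * (a * b) ≤ a * a + b * b := by
        have := two_mul_le_add_sq a b
        simpa [sq, mul_assoc] using this
      exact_mod_cast h

theorem eq_of_two_mul_eq_add_mul_self {a b : ℝ≥0∞} (ha : a ≠ ⊤) (hb : b ≠ ⊤)
    (h : 2 * (a * b) = a * a + b * b) : a = b := by
  lift a to NNReal using ha
  lift b to NNReal using hb
  have h1 : 2 * ((a : ℝ) * b) = a * a + b * b := by exact_mod_cast h
  have h2 : ((a : ℝ) - b) ^ 2 = 0 := by linarith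
  have h3 : (a : ℝ) = b := by
    have := pow_eq_zero_iff (two_ne_zero) |>.1 h2
    linarith
  exact_mod_cast h3

theorem posDefKernel_gaussianKernel {s : ℝ} (hs : 0 < s) :
    PosDefKernel (gaussianKernel s : E → E → ℝ≥0∞) := by
  intro μ ν hμ hν
  rw [← ENNReal.mul_le_mul_iff_right (gaussianMass_ne_zero (E := E) s) (gaussianMass_ne_top hs),
    mul_add, mul_left_comm, crossEnergy_gaussianKernel, crossEnergy_gaussianKernel,
    crossEnergy_gaussianKernel]
  have m := measurable_gaussianPotential (E := E) s
  rw [← lintegral_const_mul 2 (f := fun u => gaussianPotential s μ u * gaussianPotential s ν u)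
    ((m μ).mul (m ν)), ← lintegral_add_left
    (f := fun u => gaussianPotential s μ u * gaussianPotential s μ u) ((m μ).mul (m μ))]
  exact lintegral_mono fun u => two_mul_le_add_mul_self _ _

theorem gaussianKernel_le_one {s : ℝ} (hs : 0 ≤ s) (x y : E) : gaussianKernel s x y ≤ 1 := by
  rw [gaussianKernel, ENNReal.ofReal_le_one, Real.exp_le_one_iff]
  have : 0 ≤ s * ‖x - y‖ ^ 2 := by positivity
  linarith

/-- The potential is the density of a convolution, which makes it accessible to characteristic
functions. -/
theorem withDensity_gaussianPotential (s : ℝ) (μ : Measure E) [IsProbabilityMeasure μ] :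
    ((volume : Measure E).withDensity fun u => gaussianKernel (2 * s) 0 u) ∗ μ
      = (volume : Measure E).withDensity (gaussianPotential s μ) := by
  have hm : Measurable fun u : E => gaussianKernel (2 * s) 0 u := by fun_prop
  ext S hS
  have h1 : Measurable (S.indicator (1 : E → ℝ≥0∞)) := measurable_one.indicator hS
  have h2 : Measurable fun x => ∫⁻ y, S.indicator (1 : E → ℝ≥0∞) (x + y) ∂μ :=
    Measurable.lintegral_prod_right' (f := fun p : E × E => S.indicator (1 : E → ℝ≥0∞) (p.1 + p.2))
      (by fun_prop)
  have h3 : ∀ x : E, ∀ y : E, gaussianKernel (2 * s) 0 (x - y) = gaussianKernel (2 * s) y x := by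
    intro x y
    simp [gaussianKernel, norm_sub_rev]
  rw [← lintegral_indicator_one hS, Measure.lintegral_conv h1,
    lintegral_withDensity_eq_lintegral_mul _ hm h2, withDensity_apply _ hS,
    ← lintegral_indicator hS]
  simp only [Pi.mul_apply]
  calc ∫⁻ x, gaussianKernel (2 * s) 0 x * ∫⁻ y, S.indicator (1 : E → ℝ≥0∞) (x + y) ∂μ
      = ∫⁻ x, ∫⁻ y, gaussianKernel (2 * s) 0 x * S.indicator (1 : E → ℝ≥0∞) (x + y) ∂μ := by
        refine lintegral_congr fun x => ?_
        rw [lintegral_const_mul _ (by fun_prop)]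
    _ = ∫⁻ y, (∫⁻ x, gaussianKernel (2 * s) 0 x * S.indicator (1 : E → ℝ≥0∞) (x + y)) ∂μ :=
        lintegral_lintegral_swap (by unfold Function.uncurry; fun_prop)
    _ = ∫⁻ y, (∫⁻ x, gaussianKernel (2 * s) y x * S.indicator (1 : E → ℝ≥0∞) x) ∂μ := by
        refine lintegral_congr fun y => ?_
        rw [← lintegral_sub_right_eq_self (μ := (volume : Measure E)) _ y]
        simp only [h3, sub_add_cancel]
    _ = ∫⁻ x, ∫⁻ y, gaussianKernel (2 * s) y x * S.indicator (1 : E → ℝ≥0∞) x ∂μ :=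
        (lintegral_lintegral_swap (by unfold Function.uncurry; fun_prop)).symm
    _ = ∫⁻ x, S.indicator (gaussianPotential s μ) x := by
        refine lintegral_congr fun x => ?_
        rw [lintegral_mul_const _ (by fun_prop)]
        by_cases hx : x ∈ S <;> simp [hx, gaussianPotential]

theorem charFun_gaussian_ne_zero {s : ℝ} (hs : 0 < s) (t : E) :
    charFun ((volume : Measure E).withDensity fun u => gaussianKernel s 0 u) t ≠ 0 := by
  rw [charFun_apply, integral_withDensity_eq_integral_toReal_smul (by fun_prop)
    (ae_of_all _ fun u => by simp [gaussianKernel])]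
  have h := GaussianFourier.integral_cexp_neg_mul_sq_norm_add (V := E)
    (show 0 < (s : ℂ).re from hs) Complex.I t
  have h2 : ∀ u : E, (gaussianKernel s 0 u).toReal • Complex.exp ((inner ℝ u t : ℝ) * Complex.I)
      = Complex.exp (-(s : ℂ) * ‖u‖ ^ 2 + Complex.I * (inner ℝ t u : ℝ)) := by
    intro u
    rw [gaussianKernel, ENNReal.toReal_ofReal (Real.exp_pos _).le, Complex.real_smul,
      Complex.ofReal_exp, ← Complex.exp_add, real_inner_comm]
    congr 1
    push_cast
    simp
    ring
  simp_rw [h2]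
  rw [h]
  refine mul_ne_zero ?_ (Complex.exp_ne_zero _)
  rw [Complex.cpow_def_of_ne_zero]
  · exact Complex.exp_ne_zero _
  · exact div_ne_zero (by exact_mod_cast Real.pi_ne_zero) (by exact_mod_cast hs.ne')

/-- Equality in $2ab\le a^2+b^2$ makes the two potentials agree almost everywhere. Thus $\mu$ and
$\nu$ have the same convolution with a Gaussian, whose characteristic function has no zeros and can
be cancelled. -/
theorem strictKernel_gaussianKernel {s : ℝ} (hs : 0 < s) :
    StrictKernel (gaussianKernel s : E → E → ℝ≥0∞) := by
  intro μ ν hμ hν h1 h2 h3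
  have m := measurable_gaussianPotential (E := E) s
  have hle : ∀ (ρ : Measure E) [IsProbabilityMeasure ρ] u, gaussianPotential s ρ u ≠ ⊤ := by
    intro ρ _ u
    refine ne_top_of_le_ne_top ENNReal.one_ne_top
      ((lintegral_mono fun x => gaussianKernel_le_one (by positivity) x u).trans ?_)
    simp
  rw [← ENNReal.mul_le_mul_iff_right (gaussianMass_ne_zero (E := E) s) (gaussianMass_ne_top hs),
    mul_add, mul_left_comm, crossEnergy_gaussianKernel, crossEnergy_gaussianKernel,
    crossEnergy_gaussianKernel,
    ← lintegral_const_mul 2 (f := fun u => gaussianPotential s μ u * gaussianPotential s ν u)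
    ((m μ).mul (m ν)), ← lintegral_add_left
    (f := fun u => gaussianPotential s μ u * gaussianPotential s μ u) ((m μ).mul (m μ))] at h3
  have h4 := ae_eq_of_ae_le_of_lintegral_le (ae_of_all _ fun u => two_mul_le_add_mul_self
    (gaussianPotential s μ u) (gaussianPotential s ν u)) (ne_top_of_le_ne_top ?_
      (lintegral_mono fun u => two_mul_le_add_mul_self _ _))
    (((m μ).mul (m μ)).add ((m ν).mul (m ν))).aemeasurable h3
  · have h5 : gaussianPotential s μ =ᵐ[volume] gaussianPotential s ν :=
      h4.mono fun u hu => eq_of_two_mul_eq_add_mul_self (hle μ u) (hle ν u) hu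
    have h6 := withDensity_congr_ae h5
    rw [← withDensity_gaussianPotential, ← withDensity_gaussianPotential] at h6
    have : IsFiniteMeasure ((volume : Measure E).withDensity fun u => gaussianKernel (2 * s) 0 u) :=
      isFiniteMeasure_withDensity (by
        have := gaussianMass_ne_top (E := E) (half_pos hs)
        rwa [gaussianMass, show 4 * (s / 2) = 2 * s by ring] at this)
    refine Measure.ext_of_charFun (funext fun t => ?_)
    have h7 := congrArg (fun ρ => charFun ρ t) h6
    simp only [charFun_conv] at h7
    exact mul_left_cancel₀ (charFun_gaussian_ne_zero (by positivity) t) h7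
  · rw [lintegral_add_left (f := fun u => gaussianPotential s μ u * gaussianPotential s μ u)
      ((m μ).mul (m μ)), ← crossEnergy_gaussianKernel,
      ← crossEnergy_gaussianKernel]
    exact ENNReal.add_ne_top.2 ⟨ENNReal.mul_ne_top (gaussianMass_ne_top hs) h1,
      ENNReal.mul_ne_top (gaussianMass_ne_top hs) h2⟩

end Gaussian

/-! ### Riesz and truncated logarithmic kernels as mixtures of Gaussians. -/

section ShiftedRiesz

/-- Laplace transform representation of the negative powers, including the value `⊤` at `0`. -/
theorem lintegral_rpow_mul_exp {p : ℝ} (hp : 0 < p) {v : ℝ} (hv : 0 ≤ v) :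
    ∫⁻ s in Ioi (0 : ℝ), ENNReal.ofReal (s ^ (p - 1) * Real.exp (-(s * v)))
      = ENNReal.ofReal (Real.Gamma p) * ENNReal.ofReal v ^ (-p) := by
  rcases hv.eq_or_lt with rfl | hv
  · rw [ENNReal.ofReal_zero, ENNReal.zero_rpow_of_neg (by linarith),
      ENNReal.mul_top (by simpa using Real.Gamma_pos_of_pos hp)]
    -- At $v=0$ a finite value would make $s^{p-1}$ integrable on $(0,\infty)$, which no power is.
    by_contra hne
    refine not_integrableOn_Ioi_rpow (p - 1) ⟨by fun_prop, ?_⟩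
    rw [hasFiniteIntegral_iff_ofReal]
    · simpa using lt_top_iff_ne_top.2 hne
    · exact (ae_restrict_mem measurableSet_Ioi).mono fun s hs => Real.rpow_nonneg (le_of_lt hs) _
  · have h1 := Real.integral_rpow_mul_exp_neg_mul_Ioi hp hv
    have h2 : IntegrableOn (fun s : ℝ => s ^ (p - 1) * Real.exp (-(v * s))) (Ioi 0) := by
      by_contra hne
      rw [integral_undef hne] at h1
      have : 0 < (1 / v) ^ p * Real.Gamma p :=
        mul_pos (Real.rpow_pos_of_pos (by positivity) _) (Real.Gamma_pos_of_pos hp)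
      linarith
    have h3 := ofReal_integral_eq_lintegral_ofReal h2 ((ae_restrict_mem measurableSet_Ioi).mono
      fun s hs => mul_nonneg (Real.rpow_nonneg (le_of_lt hs) _) (Real.exp_pos _).le)
    simp_rw [mul_comm _ v]
    rw [← h3, h1, mul_comm, ENNReal.ofReal_mul (Real.Gamma_pos_of_pos hp).le,
      ENNReal.ofReal_rpow_of_pos hv, one_div, Real.inv_rpow hv.le, Real.rpow_neg hv.le]

variable {E : Type*} [NormedAddCommGroup E] [InnerProductSpace ℝ E] [FiniteDimensional ℝ E]
  [MeasurableSpace E] [BorelSpace E]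

/-- The kernel `(|x-y|² + a)^{-p}`. -/
def shiftedRiesz (p a : ℝ) (x y : E) : ℝ≥0∞ := ENNReal.ofReal (‖x - y‖ ^ 2 + a) ^ (-p)

@[fun_prop]
theorem measurable_shiftedRiesz_comp {Ω : Type*} [MeasurableSpace Ω] {p : ℝ} {a : Ω → ℝ}
    {f g : Ω → E} (ha : Measurable a) (hf : Measurable f) (hg : Measurable g) :
    Measurable fun ω => shiftedRiesz p (a ω) (f ω) (g ω) := by
  unfold shiftedRiesz
  fun_prop

/-- Laplace representation of $v^{-p}$ at $v=|x-y|^2+a$, with $e^{-sa}$ put into the weight. It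
includes $a=0$ on the diagonal, where both sides are infinite. -/
theorem shiftedRiesz_eq_mixture {p : ℝ} (hp : 0 < p) {a : ℝ} (ha : 0 ≤ a) :
    (shiftedRiesz p a : E → E → ℝ≥0∞) = fun x y => (ENNReal.ofReal (Real.Gamma p))⁻¹ *
      ∫⁻ s in Ioi (0 : ℝ), ENNReal.ofReal (s ^ (p - 1) * Real.exp (-(s * a)))
        * gaussianKernel s x y := by
  have hG : ENNReal.ofReal (Real.Gamma p) ≠ 0 := by simpa using Real.Gamma_pos_of_pos hp
  funext x y
  have h : ∫⁻ s in Ioi (0 : ℝ), ENNReal.ofReal (s ^ (p - 1) * Real.exp (-(s * a)))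
        * gaussianKernel s x y = ENNReal.ofReal (Real.Gamma p) * shiftedRiesz p a x y := by
    rw [shiftedRiesz, ← lintegral_rpow_mul_exp hp (by positivity)]
    refine setLIntegral_congr_fun measurableSet_Ioi fun s hs => ?_
    have hs : 0 < s := hs
    simp only [gaussianKernel]
    rw [← ENNReal.ofReal_mul (by positivity), mul_assoc, ← Real.exp_add]
    congr 4
    ring
  rw [h, ← mul_assoc, ENNReal.inv_mul_cancel hG ENNReal.ofReal_ne_top, one_mul]

theorem posDefKernel_shiftedRiesz {p : ℝ} (hp : 0 < p) {a : ℝ} (ha : 0 ≤ a) :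
    PosDefKernel (shiftedRiesz p a : E → E → ℝ≥0∞) := by
  rw [shiftedRiesz_eq_mixture hp ha]
  refine PosDefKernel.const_mul ?_ (PosDefKernel.mixture (κ := fun (s : ℝ) (x y : E) =>
    ENNReal.ofReal (s ^ (p - 1) * Real.exp (-(s * a))) * gaussianKernel s x y) ?_ _ ?_) _
  · exact Measurable.lintegral_prod_right' (f := fun q : (E × E) × ℝ =>
      ENNReal.ofReal (q.2 ^ (p - 1) * Real.exp (-(q.2 * a))) * gaussianKernel q.2 q.1.1 q.1.2)
      (by fun_prop)
  · fun_prop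
  · exact (ae_restrict_mem measurableSet_Ioi).mono fun s hs =>
      (posDefKernel_gaussianKernel hs).const_mul (measurable_gaussianKernel_uncurry s) _

theorem strictKernel_shiftedRiesz {p : ℝ} (hp : 0 < p) {a : ℝ} (ha : 0 ≤ a) :
    StrictKernel (shiftedRiesz p a : E → E → ℝ≥0∞) := by
  have hG : ENNReal.ofReal (Real.Gamma p) ≠ 0 := by simpa using Real.Gamma_pos_of_pos hp
  rw [shiftedRiesz_eq_mixture hp ha]
  refine StrictKernel.const_mul ?_ (StrictKernel.mixture (κ := fun (s : ℝ) (x y : E) =>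
    ENNReal.ofReal (s ^ (p - 1) * Real.exp (-(s * a))) * gaussianKernel s x y) ?_ ?_ ?_ ?_)
    (ENNReal.inv_ne_zero.2 ENNReal.ofReal_ne_top) (ENNReal.inv_ne_top.2 hG)
  · exact Measurable.lintegral_prod_right' (f := fun q : (E × E) × ℝ =>
      ENNReal.ofReal (q.2 ^ (p - 1) * Real.exp (-(q.2 * a))) * gaussianKernel q.2 q.1.1 q.1.2)
      (by fun_prop)
  · fun_prop
  · rw [Ne, Measure.restrict_eq_zero]
    simp
  · exact (ae_restrict_mem measurableSet_Ioi).mono fun s hs =>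
      (posDefKernel_gaussianKernel hs).const_mul (measurable_gaussianKernel_uncurry s) _
  · refine (ae_restrict_mem measurableSet_Ioi).mono fun s hs =>
      (strictKernel_gaussianKernel hs).const_mul (measurable_gaussianKernel_uncurry s) ?_
        ENNReal.ofReal_ne_top
    have hs : 0 < s := hs
    have : 0 < s ^ (p - 1) * Real.exp (-(s * a)) := by positivity
    simpa using this

theorem rieszKernel_eq_shiftedRiesz (p : ℝ) (x y : E) :
    rieszKernel p x y = shiftedRiesz (p / 2) 0 x y := by
  rw [rieszKernel, shiftedRiesz, edist_dist, dist_eq_norm, add_zero,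
    ENNReal.ofReal_pow (norm_nonneg _), ← ENNReal.rpow_natCast, ← ENNReal.rpow_mul]
  congr 1
  push_cast
  ring

theorem posDefKernel_rieszKernel {p : ℝ} (hp : 0 < p) :
    PosDefKernel (rieszKernel p : E → E → ℝ≥0∞) := by
  have h : (rieszKernel p : E → E → ℝ≥0∞) = shiftedRiesz (p / 2) 0 :=
    funext fun x => funext fun y => rieszKernel_eq_shiftedRiesz p x y
  rw [h]
  exact posDefKernel_shiftedRiesz (by positivity) le_rfl

theorem strictKernel_rieszKernel {p : ℝ} (hp : 0 < p) :
    StrictKernel (rieszKernel p : E → E → ℝ≥0∞) := by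
  have h : (rieszKernel p : E → E → ℝ≥0∞) = shiftedRiesz (p / 2) 0 :=
    funext fun x => funext fun y => rieszKernel_eq_shiftedRiesz p x y
  rw [h]
  exact strictKernel_shiftedRiesz (by positivity) le_rfl

/-- The truncated logarithmic kernel `log((|x-y|² + M)/|x-y|²)`, as a mixture of inverse
quadratic kernels. -/
def truncatedLog (M : ℝ) (x y : E) : ℝ≥0∞ := ∫⁻ a in Ioc 0 M, shiftedRiesz 1 a x y

theorem posDefKernel_truncatedLog (M : ℝ) : PosDefKernel (truncatedLog M : E → E → ℝ≥0∞) := by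
  refine PosDefKernel.mixture (κ := fun (a : ℝ) (x y : E) => shiftedRiesz 1 a x y)
    (by fun_prop) (volume.restrict (Ioc 0 M)) ?_
  exact (ae_restrict_mem measurableSet_Ioc).mono fun a ha =>
    posDefKernel_shiftedRiesz one_pos ha.1.le

theorem measurable_truncatedLog (M : ℝ) :
    Measurable (Function.uncurry (truncatedLog M : E → E → ℝ≥0∞)) :=
  Measurable.lintegral_prod_right' (f := fun q : (E × E) × ℝ => shiftedRiesz 1 q.2 q.1.1 q.1.2)
      (by fun_prop)

theorem lintegral_inv_add {v M : ℝ} (hv : 0 < v) (hM : 0 ≤ M) :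
    ∫⁻ a in Ioc 0 M, ENNReal.ofReal (v + a) ^ (-1 : ℝ)
      = ENNReal.ofReal (Real.log ((v + M) / v)) := by
  have hint : IntervalIntegrable (fun a : ℝ => (v + a)⁻¹) volume 0 M := by
    refine ContinuousOn.intervalIntegrable fun a ha => ?_
    rw [uIcc_of_le hM] at ha
    exact ((continuousAt_const.add continuousAt_id).inv₀
      (by simpa using (show v + a ≠ 0 by linarith [ha.1]))).continuousWithinAt
  have h1 : ∫ a in (0 : ℝ)..M, (v + a)⁻¹ = Real.log ((v + M) / v) := by
    rw [intervalIntegral.integral_comp_add_left (fun a => a⁻¹),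
      integral_inv_of_pos (by linarith) (by linarith), add_zero]
  rw [← h1, intervalIntegral.integral_of_le hM, ofReal_integral_eq_lintegral_ofReal hint.1]
  · refine setLIntegral_congr_fun measurableSet_Ioc fun a ha => ?_
    have : 0 < v + a := by linarith [ha.1]
    simp only [ENNReal.rpow_neg_one]
    rw [ENNReal.ofReal_inv_of_pos this]
  · exact (ae_restrict_mem measurableSet_Ioc).mono fun a ha =>
      inv_nonneg.2 (by linarith [ha.1] : (0 : ℝ) ≤ v + a)

theorem truncatedLog_of_ne {M : ℝ} (hM : 0 ≤ M) {x y : E} (h : x ≠ y) :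
    truncatedLog M x y = ENNReal.ofReal (Real.log ((‖x - y‖ ^ 2 + M) / ‖x - y‖ ^ 2)) :=
  lintegral_inv_add (by have := norm_pos_iff.2 (sub_ne_zero.2 h); positivity) hM

/-- By monotonicity the diagonal value dominates $\log((v+M)/v)$ for every $v>0$; then $v\to0^+$. -/
theorem truncatedLog_self {M : ℝ} (hM : 0 < M) (x : E) : truncatedLog M x x = ⊤ := by
  have hmono : ∀ v : ℝ, 0 < v → ENNReal.ofReal (Real.log ((v + M) / v)) ≤ truncatedLog M x x := by
    intro v hv
    rw [← lintegral_inv_add hv hM.le]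
    refine lintegral_mono fun a => ?_
    simp only [shiftedRiesz]
    rw [ENNReal.rpow_neg_one, ENNReal.rpow_neg_one]
    gcongr
    simpa using hv.le
  have hlim : Tendsto (fun v : ℝ => ENNReal.ofReal (Real.log ((v + M) / v))) (𝓝[>] 0) (𝓝 ⊤) := by
    refine ENNReal.tendsto_ofReal_atTop.comp (Real.tendsto_log_atTop.comp ?_)
    simp_rw [div_eq_mul_inv]
    refine Tendsto.pos_mul_atTop hM ?_ tendsto_inv_nhdsGT_zero
    have : Tendsto (fun v : ℝ => v + M) (𝓝 0) (𝓝 (0 + M)) := (continuous_add_const M).tendsto 0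
    rw [zero_add] at this
    exact this.mono_left nhdsWithin_le_nhds
  exact top_le_iff.1 (le_of_tendsto hlim (eventually_mem_nhdsWithin.mono fun v hv => hmono v hv))

end ShiftedRiesz

/-! ### The series over the reflected images at half-height one. -/

section LatticeSum

/-- The contribution of the images `±(j+1)` to the strip kernel of half-height one, at squared
distance `v`. -/
def latticeTerm (q v : ℝ) (j : ℕ) : ℝ := (v + 4 * ((j : ℝ) + 1) ^ 2) ^ (-(q / 2))

/-- The constant subtracted from `latticeTerm` to make the series converge. -/
def latticeShift (q : ℝ) (j : ℕ) : ℝ := if 1 < q then 0 else 1 / (2 * ((j : ℝ) + 1))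

/-- The regular part of the strip kernel of half-height one, as a function of the squared
distance. -/
def latticeSum (q v : ℝ) : ℝ := 2 * ∑' j, (latticeTerm q v j - latticeShift q j)

/-- The squared distance $v$ ranges over the open half-line $v>-1$ instead of $v\ge0$, so that
two-sided derivatives exist at $v=0$, the diagonal. -/
theorem latticeBase_pos {v : ℝ} (hv : -1 < v) (j : ℕ) : ((j : ℝ) + 1) ^ 2 ≤ v + 4 * ((j : ℝ) + 1) ^ 2 := by
  have : (0 : ℝ) ≤ j := j.cast_nonneg
  nlinarith

theorem sq_rpow_neg_half {a : ℝ} (ha : 0 ≤ a) (q : ℝ) : (a ^ 2) ^ (-(q / 2)) = a ^ (-q) := by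
  rw [← Real.rpow_natCast, ← Real.rpow_mul ha]
  congr 1
  push_cast
  ring

theorem latticeTerm_zero (q : ℝ) (j : ℕ) : latticeTerm q 0 j = (2 * ((j : ℝ) + 1)) ^ (-q) := by
  rw [latticeTerm, ← sq_rpow_neg_half (a := 2 * ((j : ℝ) + 1)) (by positivity)]
  congr 1
  ring

theorem summable_add_one_rpow {q : ℝ} (hq : 1 < q) :
    Summable fun j : ℕ => ((j : ℝ) + 1) ^ (-q) := by
  have := (summable_nat_add_iff 1).2 (Real.summable_nat_rpow.2 (show -q < -1 by linarith))
  exact_mod_cast this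

theorem summable_latticeTerm_zero {q : ℝ} (hq : 1 ≤ q) :
    Summable fun j => latticeTerm q 0 j - latticeShift q j := by
  rcases hq.eq_or_lt with rfl | hq
  · simp only [latticeTerm_zero, latticeShift, lt_irrefl, if_false, Real.rpow_neg_one, one_div,
      sub_self]
    exact summable_zero
  · simp only [latticeTerm_zero, latticeShift, hq, if_true, sub_zero]
    refine ((summable_add_one_rpow hq).mul_left (2 ^ (-q))).congr fun j => ?_
    rw [Real.mul_rpow (by norm_num) (by positivity)]

theorem hasDerivAt_latticeTerm {q v : ℝ} (hv : -1 < v) (j : ℕ) :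
    HasDerivAt (fun v => latticeTerm q v j - latticeShift q j)
      (-(q / 2) * latticeTerm (q + 2) v j) v := by
  have hpos : 0 < v + 4 * ((j : ℝ) + 1) ^ 2 := lt_of_lt_of_le (by positivity) (latticeBase_pos hv j)
  have h := (((hasDerivAt_id v).add_const (4 * ((j : ℝ) + 1) ^ 2)).rpow_const
    (p := -(q / 2)) (Or.inl hpos.ne')).sub_const (latticeShift q j)
  convert! h using 1
  simp only [latticeTerm, id]
  rw [show -((q + 2) / 2) = -(q / 2) - 1 by ring]
  ring

theorem latticeTerm_le {q v : ℝ} (hq : 0 ≤ q) (hv : -1 < v) (j : ℕ) :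
    latticeTerm q v j ≤ ((j : ℝ) + 1) ^ (-q) := by
  rw [latticeTerm, ← sq_rpow_neg_half (a := (j : ℝ) + 1) (by positivity)]
  exact Real.rpow_le_rpow_of_nonpos (by positivity) (latticeBase_pos hv j) (by linarith)

theorem latticeTerm_pos {q v : ℝ} (hv : -1 < v) (j : ℕ) : 0 < latticeTerm q v j :=
  Real.rpow_pos_of_pos (lt_of_lt_of_le (by positivity) (latticeBase_pos hv j)) _

theorem norm_deriv_latticeTerm_le {q v : ℝ} (hq : 1 ≤ q) (hv : -1 < v) (j : ℕ) :
    ‖-(q / 2) * latticeTerm (q + 2) v j‖ ≤ q / 2 * ((j : ℝ) + 1) ^ (-(q + 2)) := by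
  rw [norm_mul, Real.norm_of_nonneg (latticeTerm_pos hv j).le, norm_neg,
    Real.norm_of_nonneg (by linarith)]
  exact mul_le_mul_of_nonneg_left (latticeTerm_le (by linarith) hv j) (by linarith)

/-- Convergence at $v=0$, where for $q=1$ all terms vanish, propagates along the half-line because
the differentiated series is uniformly dominated: differentiation replaces $q$ by $q+2$ and removes
the shift. -/
theorem summable_latticeTerm {q v : ℝ} (hq : 1 ≤ q) (hv : -1 < v) :
    Summable fun j => latticeTerm q v j - latticeShift q j :=
  summable_of_summable_hasDerivAt_of_isPreconnected
    (g := fun j v => latticeTerm q v j - latticeShift q j)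
    ((summable_add_one_rpow (show 1 < q + 2 by linarith)).mul_left (q / 2)) isOpen_Ioi
    isPreconnected_Ioi (fun j v hv => hasDerivAt_latticeTerm hv j)
    (fun j v hv => norm_deriv_latticeTerm_le hq hv j) (show (0 : ℝ) ∈ Ioi (-1) by simp)
    (summable_latticeTerm_zero hq) hv

theorem latticeSum_of_one_lt {q : ℝ} (hq : 1 < q) (v : ℝ) :
    latticeSum q v = 2 * ∑' j, latticeTerm q v j := by
  simp [latticeSum, latticeShift, hq]

theorem summable_latticeTerm_of_one_lt {q v : ℝ} (hq : 1 < q) (hv : -1 < v) :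
    Summable (latticeTerm q v) := by
  simpa [latticeShift, hq] using summable_latticeTerm hq.le hv

theorem hasDerivAt_latticeSum {q v : ℝ} (hq : 1 ≤ q) (hv : -1 < v) :
    HasDerivAt (latticeSum q) (-(q / 2) * latticeSum (q + 2) v) v := by
  have h := (hasDerivAt_tsum_of_isPreconnected
    (g := fun j v => latticeTerm q v j - latticeShift q j)
    ((summable_add_one_rpow (show 1 < q + 2 by linarith)).mul_left (q / 2)) isOpen_Ioi
    isPreconnected_Ioi (fun j v hv => hasDerivAt_latticeTerm hv j)
    (fun j v hv => norm_deriv_latticeTerm_le hq hv j) (show (0 : ℝ) ∈ Ioi (-1) by simp)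
    (summable_latticeTerm_zero hq) (show v ∈ Ioi (-1) from hv)).const_mul 2
  convert! h using 1
  rw [latticeSum_of_one_lt (by linarith), tsum_mul_left]
  ring

theorem continuousOn_latticeSum {q : ℝ} (hq : 1 ≤ q) : ContinuousOn (latticeSum q) (Ioi (-1)) :=
  fun _ hv => (hasDerivAt_latticeSum hq hv).continuousAt.continuousWithinAt

theorem latticeSum_nonneg {q v : ℝ} (hq : 1 < q) (hv : -1 < v) : 0 ≤ latticeSum q v := by
  rw [latticeSum_of_one_lt hq]
  exact mul_nonneg zero_le_two (tsum_nonneg fun j => (latticeTerm_pos hv j).le)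

theorem antitoneOn_latticeSum {q : ℝ} (hq : 1 ≤ q) : AntitoneOn (latticeSum q) (Ici 0) := by
  have hsub : Ici (0 : ℝ) ⊆ Ioi (-1) := fun x (hx : 0 ≤ x) => show -1 < x by linarith
  refine antitoneOn_of_deriv_nonpos (convex_Ici 0) ((continuousOn_latticeSum hq).mono hsub)
    (fun v hv => (hasDerivAt_latticeSum hq
      (hsub (interior_subset hv))).differentiableAt.differentiableWithinAt) fun v hv => ?_
  have hv := hsub (interior_subset hv)
  rw [(hasDerivAt_latticeSum hq hv).deriv]
  have := latticeSum_nonneg (show 1 < q + 2 by linarith) hv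
  nlinarith

theorem hasSum_latticeTerm_int {q v : ℝ} (hq : 1 < q) (hv : 0 < v) :
    HasSum (fun j : ℤ => (v + 4 * (j : ℝ) ^ 2) ^ (-(q / 2))) (v ^ (-(q / 2)) + latticeSum q v) := by
  have h := (summable_latticeTerm_of_one_lt hq (show -1 < v by linarith)).hasSum
  have h2 := HasSum.of_add_one_of_neg_add_one (f := fun j : ℤ => (v + 4 * (j : ℝ) ^ 2) ^ (-(q / 2)))
    (m := ∑' j, latticeTerm q v j) (m' := ∑' j, latticeTerm q v j)
    (by convert! h using 2; simp [latticeTerm])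
    (by convert! h using 2; push_cast; simp only [latticeTerm]; congr 3; ring)
  convert! h2 using 1
  rw [latticeSum_of_one_lt hq]
  simp
  ring

end LatticeSum

/-! ### Sharp comparison of the lattice sum with its integral. -/

section SumIntegral

theorem integrable_inv_one_add_sq_rpow {p : ℝ} (hp : 1 < p) :
    Integrable fun s : ℝ => (1 + s ^ 2) ^ (-(p / 2)) := by
  have := integrable_rpow_neg_one_add_norm_sq (E := ℝ) (μ := volume) (r := p) (by simpa using hp)
  simpa [neg_div] using this

theorem thinConst_sub_one (q : ℝ) :
    thinConst (q - 1) = 1 / 2 * ∫ s : ℝ, (1 + s ^ 2) ^ (-(q / 2)) := by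
  rw [thinConst]
  congr 2
  funext s
  rw [sub_add_cancel, Real.rpow_neg (by positivity), one_div]

theorem thinConst_pos {q : ℝ} (hq : 1 < q) : 0 < thinConst (q - 1) := by
  rw [thinConst_sub_one]
  refine mul_pos (by norm_num) ((integral_pos_iff_support_of_nonneg (fun s => by positivity)
    (integrable_inv_one_add_sq_rpow hq)).2 ?_)
  have : (Function.support fun s : ℝ => (1 + s ^ 2) ^ (-(q / 2))) = univ := by
    ext s
    have : 0 < (1 + s ^ 2) ^ (-(q / 2)) := by positivity
    simpa using this.ne'
  rw [this]
  simp

theorem scaled_profile {q ρ : ℝ} (hρ : 0 < ρ) (u : ℝ) :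
    (ρ ^ 2 + 4 * u ^ 2) ^ (-(q / 2)) = ρ ^ (-q) * (1 + (2 / ρ * u) ^ 2) ^ (-(q / 2)) := by
  rw [← sq_rpow_neg_half hρ.le, ← Real.mul_rpow (by positivity) (by positivity)]
  congr 1
  field_simp
  ring

theorem integrable_profile {q ρ : ℝ} (hq : 1 < q) (hρ : 0 < ρ) :
    Integrable fun u : ℝ => (ρ ^ 2 + 4 * u ^ 2) ^ (-(q / 2)) := by
  simp_rw [scaled_profile hρ]
  exact ((integrable_inv_one_add_sq_rpow hq).comp_mul_left' (by positivity)).const_mul _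

theorem integral_profile {q ρ : ℝ} (hρ : 0 < ρ) :
    ∫ u : ℝ, (ρ ^ 2 + 4 * u ^ 2) ^ (-(q / 2)) = thinConst (q - 1) * ρ ^ (1 - q) := by
  simp_rw [scaled_profile hρ]
  rw [integral_const_mul, Measure.integral_comp_mul_left (fun s : ℝ => (1 + s ^ 2) ^ (-(q / 2))),
    thinConst_sub_one, abs_of_pos (by positivity), sub_eq_add_neg, Real.rpow_add hρ,
    Real.rpow_one, smul_eq_mul]
  field_simp

theorem antitoneOn_profile {q ρ : ℝ} (hq : 0 ≤ q) (hρ : 0 < ρ) (s : Set ℝ) (hs : s ⊆ Ici 0) :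
    AntitoneOn (fun u : ℝ => (ρ ^ 2 + 4 * u ^ 2) ^ (-(q / 2))) s := by
  intro u hu w hw huw
  have h0 : 0 ≤ u := hs hu
  exact Real.rpow_le_rpow_of_nonpos (by positivity) (by gcongr) (by linarith)

/-- Integral test: on each half-line the profile decreases, so its values at $1,2,\dots$ sum to at
most its integral. -/
theorem latticeSum_le {q ρ : ℝ} (hq : 1 < q) (hρ : 0 < ρ) :
    latticeSum q (ρ ^ 2) ≤ thinConst (q - 1) * ρ ^ (1 - q) := by
  have h1 : ∫ u : ℝ, (ρ ^ 2 + 4 * u ^ 2) ^ (-(q / 2))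
      = 2 * ∫ u in Ioi (0 : ℝ), (ρ ^ 2 + 4 * u ^ 2) ^ (-(q / 2)) := by
    rw [← integral_comp_abs (f := fun u : ℝ => (ρ ^ 2 + 4 * u ^ 2) ^ (-(q / 2)))]
    simp
  rw [← integral_profile hρ, h1, latticeSum_of_one_lt hq]
  refine mul_le_mul_of_nonneg_left ?_ zero_le_two
  have hs := summable_latticeTerm_of_one_lt hq (show -1 < ρ ^ 2 by nlinarith)
  refine hs.tsum_le_of_sum_range_le fun N => ?_
  have h2 := AntitoneOn.sum_le_integral (x₀ := 0) (a := N)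
    (antitoneOn_profile (q := q) (by linarith) hρ _ Icc_subset_Ici_self)
  rw [zero_add, intervalIntegral.integral_of_le N.cast_nonneg] at h2
  have h3 : ∫ u in Ioc (0 : ℝ) N, (ρ ^ 2 + 4 * u ^ 2) ^ (-(q / 2))
      ≤ ∫ u in Ioi (0 : ℝ), (ρ ^ 2 + 4 * u ^ 2) ^ (-(q / 2)) :=
    setIntegral_mono_set (integrable_profile hq hρ).integrableOn
      (ae_of_all _ fun u => by simp only [Pi.zero_apply]; positivity)
      (LE.le.eventuallyLE Ioc_subset_Ioi_self)
  refine le_trans (le_of_eq ?_) (h2.trans h3)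
  refine Finset.sum_congr rfl fun j _ => ?_
  simp [latticeTerm]

theorem summable_exp_neg_mul_int_sq {c : ℝ} (hc : 0 < c) :
    Summable fun j : ℤ => Real.exp (-c * (j : ℝ) ^ 2) := by
  have h : Summable fun j : ℕ => Real.exp (-c * (j : ℝ) ^ 2) := by
    refine Summable.of_nonneg_of_le (fun j => (Real.exp_pos _).le) (fun j => ?_)
      (summable_geometric_of_lt_one (Real.exp_pos (-c)).le (by rw [Real.exp_lt_one_iff]; linarith))
    rw [← Real.exp_nat_mul, Real.exp_le_exp]
    have : (j : ℝ) ≤ (j : ℝ) ^ 2 := by exact_mod_cast Nat.le_self_pow two_ne_zero j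
    nlinarith
  refine Summable.of_nat_of_neg (by simpa using h) (by simpa using h)

/-- Poisson summation: the sum equals its integral times a dual theta series, whose terms are
positive and whose term at $0$ is $1$. -/
theorem sqrt_pi_div_le_tsum {s : ℝ} (hs : 0 < s) :
    √(Real.pi / (4 * s)) ≤ ∑' j : ℤ, Real.exp (-(4 * s) * (j : ℝ) ^ 2) := by
  have ha : 0 < 4 * s / Real.pi := by positivity
  have h := Real.tsum_exp_neg_mul_int_sq ha
  rw [show -Real.pi * (4 * s / Real.pi) = -(4 * s) by field_simp,
    show -Real.pi / (4 * s / Real.pi) = -(Real.pi / (4 * s / Real.pi)) by ring] at h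
  have h2 : 1 ≤ ∑' j : ℤ, Real.exp (-(Real.pi / (4 * s / Real.pi)) * (j : ℝ) ^ 2) := by
    refine le_trans (by simp) ((summable_exp_neg_mul_int_sq (c := Real.pi / (4 * s / Real.pi))
      (by positivity)).le_tsum 0 fun j _ => (Real.exp_pos _).le)
  rw [h, ← Real.sqrt_eq_rpow, one_div, ← Real.sqrt_inv, inv_div]
  exact le_mul_of_one_le_right (Real.sqrt_nonneg _) h2

theorem lintegral_exp_le_tsum {s : ℝ} (hs : 0 < s) :
    ∫⁻ u : ℝ, ENNReal.ofReal (Real.exp (-(4 * s) * u ^ 2))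
      ≤ ∑' j : ℤ, ENNReal.ofReal (Real.exp (-(4 * s) * (j : ℝ) ^ 2)) := by
  rw [← ofReal_integral_eq_lintegral_ofReal (_root_.integrable_exp_neg_mul_sq (by positivity))
    (ae_of_all _ fun u => (Real.exp_pos _).le), integral_gaussian,
    ← ENNReal.ofReal_tsum_of_nonneg (fun j => (Real.exp_pos _).le)
      (summable_exp_neg_mul_int_sq (by positivity))]
  exact ENNReal.ofReal_le_ofReal (sqrt_pi_div_le_tsum hs)

theorem laplace_profile {q v : ℝ} (hq : 0 < q) (hv : 0 < v) (u : ℝ) :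
    ∫⁻ s in Ioi (0 : ℝ), ENNReal.ofReal (s ^ (q / 2 - 1) * Real.exp (-(s * v)))
        * ENNReal.ofReal (Real.exp (-(4 * s) * u ^ 2))
      = ENNReal.ofReal (Real.Gamma (q / 2)) * ENNReal.ofReal ((v + 4 * u ^ 2) ^ (-(q / 2))) := by
  rw [← ENNReal.ofReal_rpow_of_pos (by positivity),
    ← lintegral_rpow_mul_exp (by positivity) (by positivity)]
  refine setLIntegral_congr_fun measurableSet_Ioi fun s hs => ?_
  have hs : 0 < s := hs
  rw [← ENNReal.ofReal_mul (by positivity), mul_assoc, ← Real.exp_add]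
  congr 4
  ring

/-- The integral test would cost a second copy of the central term. As a superposition of Gaussians
with positive weights, the profile inherits the loss-free Gaussian inequality. -/
theorem lintegral_profile_le_tsum {q v : ℝ} (hq : 0 < q) (hv : 0 < v) :
    ∫⁻ u : ℝ, ENNReal.ofReal ((v + 4 * u ^ 2) ^ (-(q / 2)))
      ≤ ∑' j : ℤ, ENNReal.ofReal ((v + 4 * (j : ℝ) ^ 2) ^ (-(q / 2))) := by
  have hG : ENNReal.ofReal (Real.Gamma (q / 2)) ≠ 0 := by
    simpa using Real.Gamma_pos_of_pos (by positivity)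
  rw [← ENNReal.mul_le_mul_iff_right hG ENNReal.ofReal_ne_top, ← ENNReal.tsum_mul_left,
    ← lintegral_const_mul _ (by fun_prop)]
  simp_rw [← laplace_profile hq hv]
  rw [lintegral_lintegral_swap (by unfold Function.uncurry; fun_prop),
    ← lintegral_tsum fun j => by fun_prop]
  refine setLIntegral_mono' measurableSet_Ioi fun s hs => ?_
  rw [lintegral_const_mul _ (by fun_prop), ENNReal.tsum_mul_left]
  gcongr
  exact lintegral_exp_le_tsum hs

theorem le_rpow_add_latticeSum {q ρ : ℝ} (hq : 1 < q) (hρ : 0 < ρ) :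
    thinConst (q - 1) * ρ ^ (1 - q) ≤ ρ ^ (-q) + latticeSum q (ρ ^ 2) := by
  have h := lintegral_profile_le_tsum (q := q) (by linarith) (show 0 < ρ ^ 2 by positivity)
  have h1 := hasSum_latticeTerm_int hq (show 0 < ρ ^ 2 by positivity)
  rw [← ofReal_integral_eq_lintegral_ofReal (integrable_profile hq hρ)
    (ae_of_all _ fun u => by positivity), integral_profile hρ,
    ← ENNReal.ofReal_tsum_of_nonneg (fun j => by positivity) h1.summable, h1.tsum_eq,
    sq_rpow_neg_half hρ.le] at h
  have h2 := latticeSum_nonneg hq (show -1 < ρ ^ 2 by nlinarith)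
  exact (ENNReal.ofReal_le_ofReal_iff (by positivity)).1 h

/-- An antiderivative of $(1+s^2)^{-3/2}$ is $s/\sqrt{1+s^2}$. The value normalizes the case $q=3$
used in `neg_log_le`. -/
theorem thinConst_two : thinConst 2 = 1 := by
  have hd : ∀ s : ℝ, HasDerivAt (fun s : ℝ => s / √(1 + s ^ 2)) ((1 + s ^ 2) ^ (-((3 : ℝ) / 2))) s := by
    intro s
    have hp : 0 < 1 + s ^ 2 := by positivity
    have hs : 0 < √(1 + s ^ 2) := Real.sqrt_pos.2 hp
    have h1 : HasDerivAt (fun s : ℝ => 1 + s ^ 2) (2 * s) s := by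
      simpa using (hasDerivAt_pow 2 s).const_add 1
    have h2 := (hasDerivAt_id s).div (h1.sqrt hp.ne') hs.ne'
    convert! h2 using 1
    have h3 : (1 + s ^ 2) ^ (-((3 : ℝ) / 2)) = (√(1 + s ^ 2) ^ 3)⁻¹ := by
      rw [Real.rpow_neg hp.le, show (3 : ℝ) / 2 = 1 / 2 * (3 : ℕ) by norm_num,
        Real.rpow_mul hp.le, Real.rpow_natCast, Real.sqrt_eq_rpow]
    have h4 : √(1 + s ^ 2) ^ 2 = 1 + s ^ 2 := Real.sq_sqrt hp.le
    rw [h3]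
    simp only [id]
    field_simp
    linear_combination (-1 : ℝ) * h4
  have ht : Tendsto (fun s : ℝ => s / √(1 + s ^ 2)) atTop (𝓝 1) := by
    have h1 : Tendsto (fun s : ℝ => √(1 / (1 + (s ^ 2)⁻¹))) atTop (𝓝 √(1 / (1 + 0))) := by
      refine (Real.continuous_sqrt.tendsto _).comp (Tendsto.div tendsto_const_nhds
        (tendsto_const_nhds.add (tendsto_inv_atTop_zero.comp (tendsto_pow_atTop two_ne_zero))) ?_)
      norm_num
    rw [add_zero, div_one, Real.sqrt_one] at h1
    refine h1.congr' ((eventually_gt_atTop 0).mono fun s hs => ?_)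
    have h2 : 1 / (1 + (s ^ 2)⁻¹) = s ^ 2 / (1 + s ^ 2) := by field_simp; ring
    rw [h2, Real.sqrt_div (by positivity), Real.sqrt_sq hs.le]
  have hb : Tendsto (fun s : ℝ => s / √(1 + s ^ 2)) atBot (𝓝 (-1)) := by
    refine (ht.neg.comp tendsto_neg_atBot_atTop).congr fun s => ?_
    simp [neg_div]
  have h := integral_of_hasDerivAt_of_tendsto hd
    (integrable_inv_one_add_sq_rpow (p := 3) (by norm_num)) hb ht
  have h2 := thinConst_sub_one 3
  rw [h] at h2
  norm_num at h2
  exact h2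

theorem rpow_neg_half_eq_inv_sqrt {a : ℝ} (ha : 0 ≤ a) : a ^ (-((1 : ℝ) / 2)) = (√a)⁻¹ := by
  rw [Real.rpow_neg ha, Real.sqrt_eq_rpow]

theorem integral_inv_sqrt {ρ : ℝ} (hρ : 0 < ρ) (N : ℝ) :
    ∫ u in (0 : ℝ)..N, (ρ ^ 2 + 4 * u ^ 2) ^ (-((1 : ℝ) / 2)) = Real.arsinh (2 / ρ * N) / 2 := by
  have hd : ∀ u : ℝ, HasDerivAt (fun u => Real.arsinh (2 / ρ * u) / 2)
      ((ρ ^ 2 + 4 * u ^ 2) ^ (-((1 : ℝ) / 2))) u := by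
    intro u
    have h1 : HasDerivAt (fun u => 2 / ρ * u) (2 / ρ) u := by
      simpa using (hasDerivAt_id u).const_mul (2 / ρ)
    have h2 := ((Real.hasDerivAt_arsinh (2 / ρ * u)).comp u h1).div_const 2
    convert! h2 using 1
    have h3 : ρ ^ 2 + 4 * u ^ 2 = ρ ^ 2 * (1 + (2 / ρ * u) ^ 2) := by field_simp; ring
    rw [rpow_neg_half_eq_inv_sqrt (by positivity), h3, Real.sqrt_mul (by positivity),
      Real.sqrt_sq hρ.le]
    field_simp
  have hc : Continuous fun u : ℝ => (ρ ^ 2 + 4 * u ^ 2) ^ (-((1 : ℝ) / 2)) :=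
    Continuous.rpow_const (by fun_prop) fun u => Or.inl (by positivity)
  rw [intervalIntegral.integral_eq_sub_of_hasDerivAt (fun u _ => hd u) (hc.intervalIntegrable _ _)]
  simp

theorem tendsto_arsinh_sub_log : Tendsto (fun x => Real.arsinh x - Real.log x) atTop
    (𝓝 (Real.log 2)) := by
  have h1 : Tendsto (fun x : ℝ => Real.log (1 + √(1 + (x ^ 2)⁻¹))) atTop
      (𝓝 (Real.log (1 + √(1 + 0)))) := by
    refine Tendsto.log (tendsto_const_nhds.add ((Real.continuous_sqrt.tendsto _).comp
      (tendsto_const_nhds.add (tendsto_inv_atTop_zero.comp (tendsto_pow_atTop two_ne_zero))))) ?_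
    positivity
  rw [add_zero, Real.sqrt_one, one_add_one_eq_two] at h1
  refine h1.congr' ((eventually_gt_atTop 0).mono fun x hx => ?_)
  have h2 : x + √(1 + x ^ 2) = x * (1 + √(1 + (x ^ 2)⁻¹)) := by
    have h3 : 1 + x ^ 2 = x ^ 2 * (1 + (x ^ 2)⁻¹) := by field_simp; ring
    rw [h3, Real.sqrt_mul (by positivity), Real.sqrt_sq hx.le]
    ring
  simp only
  rw [← Real.log_exp (Real.arsinh x), Real.exp_arsinh, h2, Real.log_mul hx.ne' (by positivity)]
  ring

/-- For $q=1$ sums and integrals both diverge and are compared before the limit. Here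
$\operatorname{arsinh}x=\log 2x+o(1)$ meets $H_N=\log N+\gamma+o(1)$; this is the source of $\gamma$
and $\log 4$ in the kernel. -/
theorem tendsto_arsinh_sub_harmonic {ρ : ℝ} (hρ : 0 < ρ) :
    Tendsto (fun N : ℕ => Real.arsinh (2 / ρ * N) - (harmonic N : ℝ)) atTop
      (𝓝 (Real.log 4 - Real.log ρ - Real.eulerMascheroniConstant)) := by
  have h1 : Tendsto (fun N : ℕ => 2 / ρ * (N : ℝ)) atTop atTop :=
    Tendsto.const_mul_atTop (by positivity) tendsto_natCast_atTop_atTop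
  have h2 := ((tendsto_arsinh_sub_log.comp h1).sub Real.tendsto_harmonic_sub_log).add_const
    (Real.log (2 / ρ))
  have h3 : Real.log 4 = 2 * Real.log 2 := by
    rw [show (4 : ℝ) = 2 ^ 2 by norm_num, Real.log_pow]
    norm_num
  have h4 : Real.log 2 - Real.eulerMascheroniConstant + Real.log (2 / ρ)
      = Real.log 4 - Real.log ρ - Real.eulerMascheroniConstant := by
    rw [Real.log_div two_ne_zero hρ.ne', h3]
    ring
  rw [h4] at h2
  refine h2.congr' ((eventually_gt_atTop 0).mono fun N hN => ?_)
  have hN' : (0 : ℝ) < N := by exact_mod_cast hN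
  simp only [Function.comp]
  rw [Real.log_mul (by positivity) hN'.ne']
  ring

theorem harmonic_eq_sum_range (N : ℕ) :
    (harmonic N : ℝ) = ∑ j ∈ Finset.range N, 1 / ((j : ℝ) + 1) := by
  simp [harmonic]

theorem tendsto_partial_latticeSum_one {v : ℝ} (hv : -1 < v) :
    Tendsto (fun N : ℕ => 2 * ∑ j ∈ Finset.range N, latticeTerm 1 v j - (harmonic N : ℝ)) atTop
      (𝓝 (latticeSum 1 v)) := by
  have h := ((summable_latticeTerm le_rfl hv).hasSum.tendsto_sum_nat).const_mul 2
  refine h.congr fun N => ?_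
  rw [Finset.sum_sub_distrib, mul_sub, harmonic_eq_sum_range, Finset.mul_sum (s := Finset.range N)
    (f := latticeShift 1)]
  congr 1
  refine Finset.sum_congr rfl fun j _ => ?_
  simp only [latticeShift, lt_irrefl, if_false]
  field_simp

theorem latticeSum_one_le {ρ : ℝ} (hρ : 0 < ρ) :
    latticeSum 1 (ρ ^ 2) ≤ Real.log 4 - Real.log ρ - Real.eulerMascheroniConstant := by
  refine le_of_tendsto_of_tendsto' (tendsto_partial_latticeSum_one (by nlinarith))
    (tendsto_arsinh_sub_harmonic hρ) fun N => ?_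
  have h2 := AntitoneOn.sum_le_integral (x₀ := 0) (a := N)
    (antitoneOn_profile (q := 1) zero_le_one hρ _ Icc_subset_Ici_self)
  rw [zero_add, integral_inv_sqrt hρ N] at h2
  have h3 : ∑ i ∈ Finset.range N, (ρ ^ 2 + 4 * ((0 : ℝ) + ((i + 1 : ℕ) : ℝ)) ^ 2) ^ (-((1 : ℝ) / 2))
      = ∑ j ∈ Finset.range N, latticeTerm 1 (ρ ^ 2) j :=
    Finset.sum_congr rfl fun j _ => by simp [latticeTerm]
  rw [h3] at h2
  linarith

/-- The integral test including the central term, hence with the lossy error $2/\rho$. It serves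
only as a boundary condition at $\rho\to\infty$ in `neg_log_le`. -/
theorem le_latticeSum_one {ρ : ℝ} (hρ : 0 < ρ) :
    Real.log 4 - Real.log ρ - Real.eulerMascheroniConstant - 2 / ρ ≤ latticeSum 1 (ρ ^ 2) := by
  rw [sub_le_iff_le_add]
  refine le_of_tendsto_of_tendsto' (tendsto_arsinh_sub_harmonic hρ)
    ((tendsto_partial_latticeSum_one (by nlinarith)).add_const _) fun N => ?_
  have h2 := AntitoneOn.integral_le_sum (x₀ := 0) (a := N)
    (antitoneOn_profile (q := 1) zero_le_one hρ _ Icc_subset_Ici_self)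
  rw [zero_add, integral_inv_sqrt hρ N] at h2
  have h3 : ∑ i ∈ Finset.range N, (ρ ^ 2 + 4 * ((0 : ℝ) + (i : ℝ)) ^ 2) ^ (-((1 : ℝ) / 2))
      ≤ 1 / ρ + ∑ j ∈ Finset.range N, latticeTerm 1 (ρ ^ 2) j := by
    have h4 := Finset.sum_range_succ' (fun i : ℕ =>
      (ρ ^ 2 + 4 * ((0 : ℝ) + (i : ℝ)) ^ 2) ^ (-((1 : ℝ) / 2))) N
    rw [Finset.sum_range_succ] at h4
    have h5 : (ρ ^ 2 + 4 * ((0 : ℝ) + ((0 : ℕ) : ℝ)) ^ 2) ^ (-((1 : ℝ) / 2)) = 1 / ρ := by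
      rw [rpow_neg_half_eq_inv_sqrt (by positivity)]
      simp [Real.sqrt_sq hρ.le]
    have h6 : ∑ i ∈ Finset.range N,
        (ρ ^ 2 + 4 * ((0 : ℝ) + ((i + 1 : ℕ) : ℝ)) ^ 2) ^ (-((1 : ℝ) / 2))
        = ∑ j ∈ Finset.range N, latticeTerm 1 (ρ ^ 2) j :=
      Finset.sum_congr rfl fun j _ => by simp [latticeTerm]
    rw [h5, h6] at h4
    have h7 : 0 ≤ (ρ ^ 2 + 4 * ((0 : ℝ) + (N : ℝ)) ^ 2) ^ (-((1 : ℝ) / 2)) := by positivity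
    linarith
  have h8 : 2 / ρ = 2 * (1 / ρ) := by ring
  linarith

/-- The difference $D$ of the two sides decreases in $\rho$, by the inequality for $q=3$, and has a
nonnegative lower limit at infinity. -/
theorem neg_log_le {ρ : ℝ} (hρ : 0 < ρ) :
    -Real.log ρ ≤ ρ⁻¹ + latticeSum 1 (ρ ^ 2) + (Real.eulerMascheroniConstant - Real.log 4) := by
  set D : ℝ → ℝ := fun ρ => ρ⁻¹ + latticeSum 1 (ρ ^ 2) + (Real.eulerMascheroniConstant - Real.log 4)
    + Real.log ρ with hD
  have hd : ∀ r ∈ Ioi (0 : ℝ), HasDerivAt D (-(r ^ 2)⁻¹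
      + -(1 / 2) * latticeSum 3 (r ^ 2) * (2 * r) + r⁻¹) r := by
    intro r hr
    have hr : 0 < r := hr
    have h1 := hasDerivAt_latticeSum (q := 1) (v := r ^ 2) le_rfl (by nlinarith)
    rw [show (1 : ℝ) + 2 = 3 by norm_num] at h1
    have h2 : HasDerivAt (fun r : ℝ => r ^ 2) (2 * r) r := by simpa using hasDerivAt_pow 2 r
    have h3 := HasDerivAt.comp (h₂ := latticeSum 1) (h := fun r : ℝ => r ^ 2) r h1 h2
    exact (((hasDerivAt_inv hr.ne').add h3).add_const _).add (Real.hasDerivAt_log hr.ne')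
  -- $D'(r)=r\,\bigl(r^{-2}-r^{-3}-S_3(r^2)\bigr)$ with $S_3$ the lattice sum for $q=3$. Since
  -- $c_2=1$, this is nonpositive by `le_rpow_add_latticeSum`.
  have hanti : AntitoneOn D (Ioi 0) := by
    refine antitoneOn_of_deriv_nonpos (convex_Ioi 0)
      (fun r hr => (hd r hr).continuousAt.continuousWithinAt)
      (fun r hr => (hd r (interior_subset hr)).differentiableAt.differentiableWithinAt)
      fun r hr => ?_
    have hr : r ∈ Ioi (0 : ℝ) := interior_subset hr
    rw [(hd r hr).deriv]
    have hr : 0 < r := hr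
    have h1 := le_rpow_add_latticeSum (q := 3) (by norm_num) hr
    rw [show (3 : ℝ) - 1 = 2 by norm_num, thinConst_two, show (1 : ℝ) - 3 = -(2 : ℕ) by norm_num,
      Real.rpow_neg hr.le, Real.rpow_natCast, show (-3 : ℝ) = -(3 : ℕ) by norm_num,
      Real.rpow_neg hr.le, Real.rpow_natCast, one_mul] at h1
    have h2 := mul_le_mul_of_nonneg_left h1 hr.le
    have h3 : r * (r ^ 2)⁻¹ = r⁻¹ := by field_simp
    have h4 : r * (r ^ 3)⁻¹ = (r ^ 2)⁻¹ := by field_simp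
    rw [mul_add, h3, h4] at h2
    linarith
  -- The error $-2/r$ of `le_latticeSum_one` is half compensated by the term $r^{-1}$ in $D$.
  have hlim : ∀ r, ρ ≤ r → -r⁻¹ ≤ D ρ := by
    intro r hr
    have hr0 : 0 < r := hρ.trans_le hr
    refine le_trans ?_ (hanti hρ hr0 hr)
    have h1 := le_latticeSum_one hr0
    have h2 : 2 / r = r⁻¹ + r⁻¹ := by ring
    simp only [hD]
    linarith
  have h0 : 0 ≤ D ρ := by
    have h1 : Tendsto (fun r : ℝ => -r⁻¹) atTop (𝓝 (-0)) := tendsto_inv_atTop_zero.neg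
    rw [neg_zero] at h1
    exact le_of_tendsto h1 ((eventually_ge_atTop ρ).mono fun r hr => hlim r hr)
  simp only [hD] at h0
  linarith

/-- The limit kernel of the thin strip as a function of the distance. -/
def thinProfile (q ρ : ℝ) : ℝ := if 1 < q then thinConst (q - 1) * ρ ^ (1 - q) else -Real.log ρ

/-- The constant in the strip kernel of half-height `t`. -/
def stripConst (q t : ℝ) : ℝ :=
  if 1 < q then 0 else 1 / t * (Real.eulerMascheroniConstant - Real.log (4 * t))

/-- The regular part of the strip kernel of half-height `t`, as a function of the distance. -/
def stripRegular (q t r : ℝ) : ℝ := t ^ (-q) * latticeSum q ((r / t) ^ 2) + stripConst q t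

theorem thinProfile_le_unit {q ρ : ℝ} (hq : 1 ≤ q) (hρ : 0 < ρ) :
    thinProfile q ρ ≤ ρ ^ (-q) + latticeSum q (ρ ^ 2) + stripConst q 1 := by
  rcases hq.eq_or_lt with rfl | hq
  · simpa [thinProfile, stripConst, Real.rpow_neg_one] using neg_log_le hρ
  · simpa [thinProfile, stripConst, hq] using le_rpow_add_latticeSum hq hρ

theorem unit_le_thinProfile {q ρ : ℝ} (hq : 1 ≤ q) (hρ : 0 < ρ) :
    latticeSum q (ρ ^ 2) + stripConst q 1 ≤ thinProfile q ρ := by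
  rcases hq.eq_or_lt with rfl | hq
  · have := latticeSum_one_le hρ
    simp [thinProfile, stripConst]
    linarith
  · simpa [thinProfile, stripConst, hq] using latticeSum_le hq hρ

theorem mul_rpow_div {q t r : ℝ} (ht : 0 < t) (hr : 0 < r) :
    t * r ^ (-q) = t ^ (1 - q) * (r / t) ^ (-q) := by
  rw [Real.div_rpow hr.le ht.le, sub_eq_add_neg, Real.rpow_add ht, Real.rpow_one]
  field_simp

/-- For $q=1$ scaling leaves an additive $-\log t$. The same term appears in `mul_stripConst`, so
the two cancel and all comparisons reduce to half-height one. -/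
theorem thinProfile_scale {q t r : ℝ} (hq : 1 ≤ q) (ht : 0 < t) (hr : 0 < r) :
    thinProfile q r = t ^ (1 - q) * thinProfile q (r / t) + if 1 < q then 0 else -Real.log t := by
  rcases hq.eq_or_lt with rfl | hq
  · simp [thinProfile, Real.log_div hr.ne' ht.ne']
    ring
  · simp only [thinProfile, hq, if_true]
    rw [Real.div_rpow hr.le ht.le]
    field_simp
    ring

theorem mul_stripConst {q t : ℝ} (hq : 1 ≤ q) (ht : 0 < t) :
    t * stripConst q t = t ^ (1 - q) * stripConst q 1 + if 1 < q then 0 else -Real.log t := by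
  rcases hq.eq_or_lt with rfl | hq
  · simp [stripConst, Real.log_mul four_ne_zero ht.ne']
    field_simp
    ring
  · simp [stripConst, hq]

theorem mul_stripRegular {q t r : ℝ} (hq : 1 ≤ q) (ht : 0 < t) :
    t * stripRegular q t r = t ^ (1 - q) * (latticeSum q ((r / t) ^ 2) + stripConst q 1)
      + if 1 < q then 0 else -Real.log t := by
  rw [stripRegular, mul_add, mul_stripConst hq ht, sub_eq_add_neg, Real.rpow_add ht, Real.rpow_one]
  ring

theorem thinProfile_le {q t r : ℝ} (hq : 1 ≤ q) (ht : 0 < t) (hr : 0 < r) :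
    thinProfile q r ≤ t * (r ^ (-q) + stripRegular q t r) := by
  have h := mul_le_mul_of_nonneg_left (thinProfile_le_unit hq (div_pos hr ht))
    (Real.rpow_nonneg ht.le (1 - q))
  rw [thinProfile_scale hq ht hr, mul_add, mul_stripRegular hq ht, mul_rpow_div ht hr]
  linarith

theorem mul_stripRegular_le {q t r : ℝ} (hq : 1 ≤ q) (ht : 0 < t) (hr : 0 < r) :
    t * stripRegular q t r ≤ thinProfile q r := by
  have h := mul_le_mul_of_nonneg_left (unit_le_thinProfile hq (div_pos hr ht))
    (Real.rpow_nonneg ht.le (1 - q))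
  rw [thinProfile_scale hq ht hr, mul_stripRegular hq ht]
  linarith

theorem abs_latticeSum_le {q : ℝ} (hq : 1 ≤ q) {v : ℝ} (hv : 0 ≤ v) (hv1 : v ≤ 1) :
    |latticeSum q v| ≤ |latticeSum q 0| + |latticeSum q 1| := by
  have h1 := antitoneOn_latticeSum hq self_mem_Ici hv hv
  have h2 := antitoneOn_latticeSum hq hv (show (0 : ℝ) ≤ 1 from zero_le_one) hv1
  rw [abs_le]
  constructor
  · linarith [neg_abs_le (latticeSum q 1), abs_nonneg (latticeSum q 0)]
  · linarith [le_abs_self (latticeSum q 0), abs_nonneg (latticeSum q 1)]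

theorem tendsto_stripConst {q : ℝ} : Tendsto (stripConst q) atTop (𝓝 0) := by
  unfold stripConst
  split_ifs
  · exact tendsto_const_nhds
  · have h1 : Tendsto (fun t : ℝ => 1 / t * Real.eulerMascheroniConstant) atTop
        (𝓝 (0 * Real.eulerMascheroniConstant)) := by
      simpa only [one_div] using tendsto_inv_atTop_zero.mul_const _
    have h2 : Tendsto (fun t : ℝ => 4 * (Real.log (4 * t) / (4 * t))) atTop (𝓝 (4 * 0)) := by
      refine Tendsto.const_mul 4 (Tendsto.comp (g := fun x : ℝ => Real.log x / x) ?_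
        (Tendsto.const_mul_atTop four_pos tendsto_id))
      simpa using (Real.tendsto_pow_log_div_mul_add_atTop 1 0 1 one_ne_zero)
    have h3 := h1.sub h2
    rw [zero_mul, mul_zero, sub_zero] at h3
    refine h3.congr' ((eventually_gt_atTop 0).mono fun t ht => ?_)
    field_simp

/-- A bound for `stripRegular` on `[0, t]`, which vanishes as `t → ∞`. -/
theorem exists_bound_stripRegular {q : ℝ} (hq : 1 ≤ q) : ∃ b : ℝ → ℝ, Tendsto b atTop (𝓝 0) ∧
    ∀ t r : ℝ, 0 < t → 0 ≤ r → r ≤ t → |stripRegular q t r| ≤ b t := by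
  refine ⟨fun t => t ^ (-q) * (|latticeSum q 0| + |latticeSum q 1|) + |stripConst q t|, ?_, ?_⟩
  · have h := ((tendsto_rpow_neg_atTop (show 0 < q by linarith)).mul_const
      (|latticeSum q 0| + |latticeSum q 1|)).add (tendsto_stripConst (q := q)).abs
    simpa using h
  · intro t r ht hr hrt
    refine (abs_add_le _ _).trans (add_le_add_left ?_ _)
    rw [abs_mul, abs_of_nonneg (Real.rpow_nonneg ht.le _)]
    refine mul_le_mul_of_nonneg_left (abs_latticeSum_le hq (by positivity) ?_)
      (Real.rpow_nonneg ht.le _)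
    have : r / t ≤ 1 := (div_le_one ht).2 hrt
    have : 0 ≤ r / t := by positivity
    nlinarith

end SumIntegral

/-! ### Splitting of the strip kernel on the middle hyperplane. -/

section KernelIdentity

variable {n : ℕ}

theorem reflect_pt (t : ℝ) (j : ℤ) (y : EuclideanSpace ℝ (Fin n)) :
    reflect t j (pt y 0) = pt y (2 * t * j) := by
  simp [reflect, pt]

theorem dist_reflect (t : ℝ) (j : ℤ) (x y : EuclideanSpace ℝ (Fin n)) :
    dist (pt x 0) (reflect t j (pt y 0)) = √(dist x y ^ 2 + 4 * t ^ 2 * (j : ℝ) ^ 2) := by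
  rw [reflect_pt, WithLp.prod_dist_eq_of_L2]
  congr 2
  change dist (0 : ℝ) (2 * t * j) ^ 2 = _
  rw [Real.dist_eq, sq_abs]
  ring

theorem scaled_lattice {q t : ℝ} (ht : 0 < t) (r : ℝ) {a : ℝ} (ha : 0 ≤ a) :
    t ^ (-q) * ((r / t) ^ 2 + a) ^ (-(q / 2)) = (r ^ 2 + t ^ 2 * a) ^ (-(q / 2)) := by
  rw [← sq_rpow_neg_half ht.le, ← Real.mul_rpow (by positivity) (by positivity)]
  congr 1
  field_simp

theorem rieszKernel_of_ne {q : ℝ} {X : Type*} [MetricSpace X] {x y : X} (h : x ≠ y) :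
    rieszKernel q x y = ENNReal.ofReal (dist x y ^ (-q)) := by
  rw [rieszKernel, edist_dist, ENNReal.ofReal_rpow_of_pos (dist_pos.2 h)]

theorem rieszKernel_self {q : ℝ} (hq : 0 < q) {X : Type*} [MetricSpace X] (x : X) :
    rieszKernel q x x = ⊤ := by
  rw [rieszKernel, edist_self, ENNReal.zero_rpow_of_neg (by linarith)]

theorem sqrt_rpow_neg {a : ℝ} (ha : 0 ≤ a) (q : ℝ) : √a ^ (-q) = a ^ (-(q / 2)) := by
  rw [Real.sqrt_eq_rpow, ← Real.rpow_mul ha]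
  congr 1
  ring

theorem stripKernel_self {q t : ℝ} (hq : 1 ≤ q) (x : EuclideanSpace ℝ (Fin n)) :
    stripKernel q t (pt x 0) (pt x 0) = ⊤ := by
  have h0 : reflect t 0 (pt x 0) = pt x 0 := by simp [reflect_pt]
  unfold stripKernel
  split_ifs with h1 h2
  · rw [EReal.coe_ennreal_eq_top_iff]
    refine top_le_iff.1 (le_trans ?_ (ENNReal.le_tsum 0))
    rw [h0, rieszKernel_self (zero_lt_one.trans_le hq)]
  · rfl
  · exact absurd ⟨0, h0.symm⟩ h2

/-- The image $j=0$ gives the Riesz kernel, and the images $\pm j$ lie at equal distances and pair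
up into the lattice sum. On the diagonal both sides are $+\infty$. -/
theorem stripKernel_eq {q t : ℝ} (hq : 1 ≤ q) (ht : 0 < t) (x y : EuclideanSpace ℝ (Fin n)) :
    stripKernel q t (pt x 0) (pt y 0)
      = ((rieszKernel q x y : ℝ≥0∞) : EReal) + (stripRegular q t (dist x y) : ℝ) := by
  rcases eq_or_ne x y with rfl | hxy
  · rw [stripKernel_self hq, rieszKernel_self (by linarith), EReal.coe_ennreal_top,
      EReal.top_add_coe]
  set r := dist x y with hr
  have hr0 : 0 < r := dist_pos.2 hxy
  have hbase : ∀ j : ℤ, 0 < r ^ 2 + 4 * t ^ 2 * (j : ℝ) ^ 2 := fun j => by positivity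
  have hdist : ∀ j : ℤ, 0 < dist (pt x 0) (reflect t j (pt y 0)) := fun j => by
    rw [dist_reflect]
    exact Real.sqrt_pos.2 (hbase j)
  have hne : ∀ j : ℤ, pt x 0 ≠ reflect t j (pt y 0) := fun j => dist_pos.1 (hdist j)
  have hrt : -1 < (r / t) ^ 2 := by nlinarith [sq_nonneg (r / t)]
  rw [rieszKernel_of_ne hxy, EReal.coe_ennreal_ofReal, max_eq_left (by positivity), ← hr,
    ← EReal.coe_add]
  rcases hq.eq_or_lt with rfl | hq
  · rw [stripKernel, if_neg (lt_irrefl _), if_neg (by simpa using hne)]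
    congr 1
    have hd0 : dist (pt x 0) (pt y 0) = r := by
      have := dist_reflect t 0 x y
      simpa [reflect_pt, Real.sqrt_sq hr0.le] using this
    rw [hd0, Real.rpow_neg_one, one_div, stripRegular, stripConst, if_neg (lt_irrefl _),
      ← add_assoc]
    congr 2
    set f : ℤ → ℝ := fun j => 1 / dist (pt x 0) (reflect t j (pt y 0)) - 1 / |2 * t * (j : ℝ)|
      with hf
    have hterm : ∀ j : ℕ, t ^ (-1 : ℝ) * (latticeTerm 1 ((r / t) ^ 2) j - latticeShift 1 j)
        = 1 / √(r ^ 2 + 4 * t ^ 2 * ((j : ℝ) + 1) ^ 2) - 1 / |2 * t * ((j : ℝ) + 1)| := by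
      intro j
      rw [mul_sub, latticeTerm, scaled_lattice ht r (by positivity),
        rpow_neg_half_eq_inv_sqrt (by positivity), latticeShift, if_neg (lt_irrefl _),
        abs_of_pos (by positivity), Real.rpow_neg_one, one_div]
      congr 1
      · rw [one_div]
        congr 3
        ring
      · field_simp
    have hs := ((summable_latticeTerm (q := 1) le_rfl hrt).mul_left (t ^ (-1 : ℝ))).hasSum
    simp_rw [hterm] at hs
    -- The sum over nonzero integers is rewritten over all of $\mathbb Z$ with zero at $j=0$, so
    -- that the two half-series can be joined.
    have h1 : HasSum (Set.indicator {j : ℤ | j ≠ 0} f)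
        (t ^ (-1 : ℝ) * latticeSum 1 ((r / t) ^ 2)) := by
      have h2 := HasSum.of_add_one_of_neg_add_one (f := Set.indicator {j : ℤ | j ≠ 0} f)
        (m := t ^ (-1 : ℝ) * ∑' j, (latticeTerm 1 ((r / t) ^ 2) j - latticeShift 1 j))
        (m' := t ^ (-1 : ℝ) * ∑' j, (latticeTerm 1 ((r / t) ^ 2) j - latticeShift 1 j)) ?_ ?_
      · convert! h2 using 1
        simp [latticeSum]
        ring
      · rw [← tsum_mul_left]
        simp_rw [hterm]
        convert! hs using 1
        funext j
        rw [Set.indicator_of_mem (by simp; omega)]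
        simp only [hf, dist_reflect, ← hr]
        push_cast
        rfl
      · rw [← tsum_mul_left]
        simp_rw [hterm]
        convert! hs using 1
        funext j
        rw [Set.indicator_of_mem (by simp; omega)]
        simp only [hf, dist_reflect, ← hr]
        push_cast
        rw [neg_sq, mul_neg, abs_neg]
    rw [← h1.tsum_eq, ← tsum_subtype]
    rfl
  · rw [stripKernel, if_pos hq]
    have hterm : ∀ j : ℤ, rieszKernel q (pt x 0) (reflect t j (pt y 0))
        = ENNReal.ofReal (t ^ (-q) * ((r / t) ^ 2 + 4 * (j : ℝ) ^ 2) ^ (-(q / 2))) := fun j => by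
      rw [rieszKernel_of_ne (hne j), dist_reflect, sqrt_rpow_neg (hbase j).le,
        scaled_lattice ht r (by positivity)]
      congr 3
      ring
    have hs := (hasSum_latticeTerm_int hq (show 0 < (r / t) ^ 2 by positivity)).mul_left (t ^ (-q))
    simp_rw [hterm]
    rw [← ENNReal.ofReal_tsum_of_nonneg (fun j => by positivity) hs.summable, hs.tsum_eq,
      EReal.coe_ennreal_ofReal, max_eq_left]
    · congr 1
      rw [stripRegular, stripConst, if_pos hq, add_zero, mul_add]
      congr 1
      have := scaled_lattice (q := q) ht r (le_refl 0)
      rw [add_zero, mul_zero, add_zero, sq_rpow_neg_half hr0.le] at this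
      exact this
    · exact mul_nonneg (by positivity) (add_nonneg (by positivity) (latticeSum_nonneg hq hrt))

end KernelIdentity

/-! ### Differentiability of a minimum with unique minimizers. -/

section Danskin

variable {X : Type*} [TopologicalSpace X]

theorem lowerSemicontinuous_coe_add {F : X → ℝ≥0∞} (hF : LowerSemicontinuous F) {P : ℝ → X → ℝ}
    (hP : Continuous (Function.uncurry P)) :
    LowerSemicontinuous fun p : ℝ × X => (F p.2 : EReal) + (P p.1 p.2 : EReal) := by
  have h1 : LowerSemicontinuous fun p : ℝ × X => (F p.2 : EReal) :=
    (continuous_coe_ennreal_ereal.comp_lowerSemicontinuous hF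
      (fun a b h => EReal.coe_ennreal_le_coe_ennreal_iff.2 h)).comp continuous_snd
  have h2 : Continuous fun p : ℝ × X => (P p.1 p.2 : EReal) := continuous_coe_real_ereal.comp hP
  refine h1.add' h2.lowerSemicontinuous fun p => ?_
  exact EReal.continuousAt_add (Or.inr (EReal.coe_ne_bot _)) (Or.inr (EReal.coe_ne_top _))

/-- Danskin's theorem: the minimum of `F + P t` over a compact space is `C¹` in `t` when the
minimizer is unique for every `t`. -/
theorem exists_contDiff_iInf [CompactSpace X] {F : X → ℝ≥0∞} (hF : LowerSemicontinuous F)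
    (hfin : ∃ x, F x ≠ ⊤) {P D : ℝ → X → ℝ} (hP : Continuous (Function.uncurry P))
    (hD : Continuous (Function.uncurry D)) (hPD : ∀ t x, HasDerivAt (fun s => P s x) (D t x) t)
    (huniq : ∀ t x y, (∀ z, (F x : EReal) + (P t x : EReal) ≤ F z + (P t z : EReal)) →
      (∀ z, (F y : EReal) + (P t y : EReal) ≤ F z + (P t z : EReal)) → x = y) :
    ∃ e : ℝ → ℝ, ContDiff ℝ 1 e ∧ ∀ t, ⨅ x, ((F x : EReal) + (P t x : EReal)) = (e t : EReal) := by
  obtain ⟨x₀, hx₀⟩ := hfin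
  have hlsc := lowerSemicontinuous_coe_add hF hP
  have hmin : ∀ t, ∃ x, ∀ z, (F x : EReal) + (P t x : EReal) ≤ F z + (P t z : EReal) := by
    intro t
    have h1 : LowerSemicontinuous fun x : X => (F x : EReal) + (P t x : EReal) :=
      LowerSemicontinuous.comp (g := fun x : X => (t, x)) hlsc (by fun_prop)
    obtain ⟨x, -, hx⟩ := (h1.lowerSemicontinuousOn univ).exists_isMinOn ⟨x₀, mem_univ _⟩
      isCompact_univ
    exact ⟨x, fun z => hx (mem_univ z)⟩
  choose m hm using hmin
  have hFm : ∀ t, F (m t) ≠ ⊤ := by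
    intro t h
    have h1 := hm t x₀
    rw [h, EReal.coe_ennreal_top, EReal.top_add_coe, top_le_iff] at h1
    lift F x₀ to NNReal using hx₀ with a
    exact EReal.coe_ne_top (a + P t x₀) (by exact_mod_cast h1)
  have hcoe : ∀ t s, (F (m t) : EReal) + (P s (m t) : EReal)
      = (((F (m t)).toReal + P s (m t) : ℝ) : EReal) := by
    intro t s
    rw [EReal.coe_add, EReal.coe_ennreal_toReal (hFm t)]
  set e : ℝ → ℝ := fun t => (F (m t)).toReal + P t (m t) with he
  have hle : ∀ s t, e s ≤ (F (m t)).toReal + P s (m t) := by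
    intro s t
    have h := hm s (m t)
    rw [hcoe, hcoe] at h
    exact_mod_cast h
  have hPx : ∀ x, Continuous fun s => P s x := fun x =>
    hP.comp (continuous_id.prodMk continuous_const)
  -- By lower semicontinuity every cluster point of $m(s)$ as $s\to t$ is a minimizer at $t$, hence
  -- is $m(t)$ by uniqueness; compactness turns this into convergence.
  have hmc : Continuous m := by
    rw [continuous_iff_continuousAt]
    intro t
    refine isCompact_univ.le_nhds_of_unique_clusterPt (by simp) fun y _ hy => ?_
    refine huniq t y (m t) (fun z => ?_) (hm t)
    refine le_trans ?_ (hm t z)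
    rw [hcoe]
    by_contra! hlt
    obtain ⟨b, hb1, hb2⟩ := EReal.lt_iff_exists_real_btwn.1 hlt
    have h1 := hlsc (t, y) b hb2
    rw [nhds_prod_eq] at h1
    obtain ⟨U, hU, V, hV, hUV⟩ := mem_prod_iff.1 h1
    have h2 : ∀ᶠ s in 𝓝 t, (F (m t)).toReal + P s (m t) < b :=
      (((hPx (m t)).const_add _).tendsto t).eventually_lt_const (by exact_mod_cast hb1)
    have h3 : ∃ᶠ s in 𝓝 t, m s ∈ V := (mapClusterPt_iff_frequently.1 hy) V hV
    obtain ⟨s, hs1, hs2, hs3⟩ := (h3.and_eventually (h2.and hU)).exists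
    have h4 : (b : EReal) < (F (m s) : EReal) + (P s (m s) : EReal) := hUV (mk_mem_prod hs3 hs1)
    rw [hcoe] at h4
    have h5 : b < e s := by exact_mod_cast h4
    exact absurd (hle s t) (not_le.2 (hs2.trans h5))
  have hder : ∀ t, HasDerivAt e (D t (m t)) t := by
    intro t
    -- Mean value theorem at the moving minimizer $m(s)$: its difference quotient becomes a value of
    -- $D$ and converges by joint continuity.
    have hmv : ∀ s, ∃ ξ, |ξ - t| ≤ |s - t| ∧
        P s (m s) - P t (m s) = D ξ (m s) * (s - t) := by
      intro s
      rcases lt_trichotomy s t with h | h | h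
      · obtain ⟨ξ, hξ, h1⟩ := exists_hasDerivAt_eq_slope (fun r => P r (m s)) (fun r => D r (m s)) h
          (hPx _).continuousOn fun r _ => hPD r _
        refine ⟨ξ, ?_, ?_⟩
        · rw [abs_of_neg (by linarith [hξ.2]), abs_of_neg (by linarith)]
          linarith [hξ.1]
        · rw [h1, div_mul_eq_mul_div, eq_div_iff (by linarith)]
          ring
      · exact ⟨t, by simp, by simp [h]⟩
      · obtain ⟨ξ, hξ, h1⟩ := exists_hasDerivAt_eq_slope (fun r => P r (m s)) (fun r => D r (m s)) h
          (hPx _).continuousOn fun r _ => hPD r _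
        refine ⟨ξ, ?_, ?_⟩
        · rw [abs_of_pos (by linarith [hξ.1]), abs_of_pos (by linarith)]
          linarith [hξ.2]
        · rw [h1, div_mul_cancel₀ _ (by linarith)]
    choose ξ hξ1 hξ2 using hmv
    have hξt : Tendsto ξ (𝓝 t) (𝓝 t) := by
      rw [tendsto_iff_norm_sub_tendsto_zero]
      refine squeeze_zero (fun s => norm_nonneg _) hξ1 ?_
      have : Continuous fun s : ℝ => |s - t| := by fun_prop
      simpa using this.tendsto t
    have hlim : Tendsto (fun s => D (ξ s) (m s)) (𝓝 t) (𝓝 (D t (m t))) :=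
      (hD.tendsto (t, m t)).comp (hξt.prodMk_nhds (hmc.tendsto t))
    have h1 := hasDerivAt_iff_tendsto_slope.1 (hPD t (m t))
    have h2 : Tendsto (fun s => D (ξ s) (m s)) (𝓝[≠] t) (𝓝 (D t (m t))) :=
      hlim.mono_left nhdsWithin_le_nhds
    rw [hasDerivAt_iff_tendsto_slope]
    -- Testing each minimizer at the other parameter puts the slope of $e$ between those of $P$ at
    -- $m(t)$ and at $m(s)$. The order flips with the sign of $s-t$, hence the minimum and the
    -- maximum.
    have h3 := h1.min h2
    have h4 := h1.max h2
    rw [min_self] at h3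
    rw [max_self] at h4
    refine tendsto_of_tendsto_of_tendsto_of_le_of_le' h3 h4 ?_ ?_
    all_goals
      refine eventually_mem_nhdsWithin.mono fun s hs => ?_
      have hs : s ≠ t := hs
      have e1 : slope e t s = (e s - e t) / (s - t) := slope_def_field e t s
      have e2 : slope (fun s => P s (m t)) t s = (P s (m t) - P t (m t)) / (s - t) :=
        slope_def_field _ t s
      have e3 : D (ξ s) (m s) = (P s (m s) - P t (m s)) / (s - t) := by
        rw [hξ2, mul_div_cancel_right₀ _ (sub_ne_zero.2 hs)]
      have i1 : e s - e t ≤ P s (m t) - P t (m t) := by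
        have := hle s t
        simp only [he] at this ⊢
        linarith
      have i2 : P s (m s) - P t (m s) ≤ e s - e t := by
        have := hle t s
        simp only [he] at this ⊢
        linarith
      rw [e1, e2, e3]
      rcases hs.lt_or_gt with h | h
      · have h' : s - t ≤ 0 := by linarith
        have j1 := div_le_div_of_nonpos_of_le h' i1
        have j2 := div_le_div_of_nonpos_of_le h' i2
        first
        | exact (min_le_left _ _).trans j1
        | exact j2.trans (le_max_right _ _)
      · have h' : 0 ≤ s - t := by linarith
        have j1 := div_le_div_of_nonneg_right i1 h'
        have j2 := div_le_div_of_nonneg_right i2 h'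
        first
        | exact (min_le_right _ _).trans j2
        | exact j1.trans (le_max_left _ _)
  refine ⟨e, ?_, fun t => ?_⟩
  · rw [contDiff_one_iff_deriv]
    refine ⟨fun t => (hder t).differentiableAt, ?_⟩
    have : deriv e = fun t => D t (m t) := funext fun t => (hder t).deriv
    rw [this]
    exact hD.comp (continuous_id.prodMk hmc)
  · rw [he]
    simp only
    rw [← hcoe]
    exact le_antisymm (iInf_le _ _) (le_iInf fun x => hm t x)

end Danskin

/-! ### Integrals as functions of a weakly varying probability measure. -/

section WeakContinuity

variable {Z : Type*} [TopologicalSpace Z] [CompactSpace Z] [MeasurableSpace Z] [BorelSpace Z]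

/-- Compactness of $Z$ makes $s\mapsto k_s$ continuous in the uniform norm, which controls the
change of integrand for all probability measures at once; weak convergence handles the fixed
integrand. -/
theorem continuous_integral_uncurry [HasOuterApproxClosed Z] {k : ℝ → Z → ℝ} (hk : Continuous (Function.uncurry k)) :
    Continuous fun p : ℝ × ProbabilityMeasure Z => ∫ z, k p.1 z ∂(p.2 : Measure Z) := by
  let K : C(ℝ, C(Z, ℝ)) := ContinuousMap.curry ⟨Function.uncurry k, hk⟩
  rw [continuous_iff_continuousAt]
  rintro ⟨t, μ⟩
  have h1 : Tendsto (fun p : ℝ × ProbabilityMeasure Z => ∫ z, K t z ∂(p.2 : Measure Z)) (𝓝 (t, μ))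
      (𝓝 (∫ z, K t z ∂(μ : Measure Z))) :=
    ((ProbabilityMeasure.continuous_integral_continuousMap (K t)).comp continuous_snd).tendsto (t, μ)
  have hint : ∀ (f : C(Z, ℝ)) (ν : ProbabilityMeasure Z), Integrable f (ν : Measure Z) := fun f ν =>
    Integrable.of_bound f.continuous.aestronglyMeasurable ‖f‖ (ae_of_all _ f.norm_coe_le_norm)
  have h2 : Tendsto (fun p : ℝ × ProbabilityMeasure Z => ∫ z, K p.1 z ∂(p.2 : Measure Z)
      - ∫ z, K t z ∂(p.2 : Measure Z)) (𝓝 (t, μ)) (𝓝 0) := by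
    refine squeeze_zero_norm (a := fun p : ℝ × ProbabilityMeasure Z => ‖K p.1 - K t‖)
      (fun p => ?_) ?_
    · rw [← integral_sub (hint _ _) (hint _ _)]
      refine (norm_integral_le_of_norm_le_const (C := ‖K p.1 - K t‖)
        (ae_of_all _ fun z => (K p.1 - K t).norm_coe_le_norm z)).trans ?_
      simp
    · have : Continuous fun p : ℝ × ProbabilityMeasure Z => ‖K p.1 - K t‖ := by fun_prop
      simpa using this.tendsto (t, μ)
  have h3 := h2.add h1
  simp only [sub_add_cancel, zero_add] at h3
  exact h3

/-- The integral is the supremum over $N$ of the integrals of $\min(f,N)$, each weakly continuous.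
-/
theorem lowerSemicontinuous_lintegral_probabilityMeasure [HasOuterApproxClosed Z] {f : Z → ℝ≥0∞} (hf : Continuous f) :
    LowerSemicontinuous fun μ : ProbabilityMeasure Z => ∫⁻ z, f z ∂(μ : Measure Z) := by
  have h1 : ∀ z, f z = ⨆ N : ℕ, min (f z) N := fun z => by
    rw [← inf_iSup_eq, ENNReal.iSup_natCast, inf_top_eq]
  have h2 : ∀ μ : ProbabilityMeasure Z, ∫⁻ z, f z ∂(μ : Measure Z)
      = ⨆ N : ℕ, ∫⁻ z, min (f z) N ∂(μ : Measure Z) := fun μ => by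
    rw [← lintegral_iSup (fun N => by fun_prop) (fun N M h z => by
      simp only; gcongr)]
    exact lintegral_congr h1
  simp_rw [h2]
  refine lowerSemicontinuous_iSup fun N => Continuous.lowerSemicontinuous ?_
  let g : C(Z, NNReal) := ⟨fun z => (min (f z) N).toNNReal, by
    refine ENNReal.continuousOn_toNNReal.comp_continuous (by fun_prop) fun z => ?_
    exact ne_top_of_le_ne_top (ENNReal.natCast_ne_top N) (min_le_right _ _)⟩
  have hg : ∀ z, min (f z) N = (g z : ℝ≥0∞) := fun z =>
    (ENNReal.coe_toNNReal (ne_top_of_le_ne_top (ENNReal.natCast_ne_top N) (min_le_right _ _))).symm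
  simp_rw [hg]
  exact ProbabilityMeasure.continuous_lintegral_continuousMap g

theorem hasDerivAt_integral_param {k k' : ℝ → Z → ℝ} (hk : Continuous (Function.uncurry k))
    (hk' : Continuous (Function.uncurry k')) (h : ∀ t z, HasDerivAt (fun s => k s z) (k' t z) t)
    (μ : Measure Z) [IsFiniteMeasure μ] (t : ℝ) :
    HasDerivAt (fun s => ∫ z, k s z ∂μ) (∫ z, k' t z ∂μ) t := by
  have hkt : ∀ s, Continuous (k s) := fun s =>
    hk.comp (continuous_const.prodMk continuous_id)
  have hkt' : ∀ s, Continuous (k' s) := fun s =>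
    hk'.comp (continuous_const.prodMk continuous_id)
  obtain ⟨C, hC⟩ := ((isCompact_closedBall t 1).prod (isCompact_univ (X := Z))).exists_bound_of_continuousOn
    hk'.continuousOn
  obtain ⟨C', hC'⟩ := (isCompact_univ (X := Z)).exists_bound_of_continuousOn (hkt t).continuousOn
  refine (hasDerivAt_integral_of_dominated_loc_of_deriv_le (bound := fun _ => C)
    (Metric.closedBall_mem_nhds t one_pos) (Eventually.of_forall fun s =>
      (hkt s).aestronglyMeasurable) ?_ (hkt' t).aestronglyMeasurable ?_ (integrable_const C) ?_).2
  · exact Integrable.of_bound (hkt t).aestronglyMeasurable C' (ae_of_all _ fun z => hC' z (mem_univ z))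
  · exact ae_of_all _ fun z s hs => hC (s, z) (mk_mem_prod hs (mem_univ z))
  · exact ae_of_all _ fun z s hs => h s z

end WeakContinuity

/-! ### Positive semidefiniteness of the regular part. -/

section EnergyDefect

variable {E : Type*} [NormedAddCommGroup E] [InnerProductSpace ℝ E] [FiniteDimensional ℝ E]
  [MeasurableSpace E] [BorelSpace E]

theorem integrable_prod_of_continuous {f : E × E → ℝ} (hf : Continuous f) {K : Set E}
    (hK : IsCompact K) {μ ν : Measure E} [IsFiniteMeasure μ] [IsFiniteMeasure ν]
    (hμ : μ Kᶜ = 0) (hν : ν Kᶜ = 0) : Integrable f (μ.prod ν) := by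
  obtain ⟨C, hC⟩ := (hK.prod hK).exists_bound_of_continuousOn hf.continuousOn
  exact Integrable.of_bound hf.aestronglyMeasurable C
    ((ae_prod_mem hμ hν).mono fun p hp => hC p hp)

/-- The energy of the signed measure `μ - ν` for the kernel `f`. -/
def energyDefect (μ ν : Measure E) (f : E × E → ℝ) : ℝ :=
  ∫ p, f p ∂(μ.prod μ) + ∫ p, f p ∂(ν.prod ν) - 2 * ∫ p, f p ∂(μ.prod ν)

variable {K : Set E} {μ ν : Measure E} [IsProbabilityMeasure μ] [IsProbabilityMeasure ν]

theorem energyDefect_add (hK : IsCompact K) (hμ : μ Kᶜ = 0) (hν : ν Kᶜ = 0) {f g : E × E → ℝ}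
    (hf : Continuous f) (hg : Continuous g) :
    energyDefect μ ν (fun p => f p + g p) = energyDefect μ ν f + energyDefect μ ν g := by
  have h := @integrable_prod_of_continuous E
  unfold energyDefect
  rw [integral_add (integrable_prod_of_continuous hf hK hμ hμ)
      (integrable_prod_of_continuous hg hK hμ hμ),
    integral_add (integrable_prod_of_continuous hf hK hν hν)
      (integrable_prod_of_continuous hg hK hν hν),
    integral_add (integrable_prod_of_continuous hf hK hμ hν)
      (integrable_prod_of_continuous hg hK hμ hν)]
  ring

/-- The signed measure $\mu-\nu$ has total mass zero. This is why the shifts and constants of the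
case $q=1$ are harmless. -/
theorem energyDefect_const (c : ℝ) : energyDefect μ ν (fun _ => c) = 0 := by
  simp [energyDefect]
  ring

theorem energyDefect_const_mul (c : ℝ) (f : E × E → ℝ) :
    energyDefect μ ν (fun p => c * f p) = c * energyDefect μ ν f := by
  simp only [energyDefect, integral_const_mul]
  ring

theorem energyDefect_sum_nonneg (hK : IsCompact K) (hμ : μ Kᶜ = 0) (hν : ν Kᶜ = 0)
    {f : ℕ → E × E → ℝ} (hf : ∀ j, Continuous (f j)) (h : ∀ j, 0 ≤ energyDefect μ ν (f j)) (N : ℕ) :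
    0 ≤ energyDefect μ ν fun p => ∑ j ∈ Finset.range N, f j p := by
  induction N with
  | zero => simp [energyDefect]
  | succ N ih =>
    simp_rw [Finset.sum_range_succ]
    rw [energyDefect_add hK hμ hν (by fun_prop) (hf N)]
    exact add_nonneg ih (h N)

theorem PosDefKernel.energyDefect_nonneg {k : E → E → ℝ≥0∞} (hk : PosDefKernel k)
    (hkm : Measurable (Function.uncurry k)) {f : E × E → ℝ} (hf : Continuous f)
    (hf0 : ∀ p, 0 ≤ f p) (hkf : ∀ x y, k x y = ENNReal.ofReal (f (x, y)))
    (hK : IsCompact K) (hμ : μ Kᶜ = 0) (hν : ν Kᶜ = 0) : 0 ≤ energyDefect μ ν f := by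
  have hc : ∀ (μ ν : Measure E) [IsProbabilityMeasure μ] [IsProbabilityMeasure ν], μ Kᶜ = 0 →
      ν Kᶜ = 0 → crossEnergy k μ ν = ENNReal.ofReal (∫ p, f p ∂(μ.prod ν)) := by
    intro μ ν _ _ hμ hν
    rw [crossEnergy_eq_lintegral_prod hkm, ofReal_integral_eq_lintegral_ofReal
      (integrable_prod_of_continuous hf hK hμ hν) (ae_of_all _ hf0)]
    simp_rw [hkf]
  have h := hk μ ν ‹_› ‹_›
  have h0 : ∀ μ ν : Measure E, 0 ≤ ∫ p, f p ∂(μ.prod ν) := fun μ ν => integral_nonneg hf0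
  rw [hc μ ν hμ hν, hc μ μ hμ hμ, hc ν ν hν hν, ← ENNReal.ofReal_add (h0 _ _) (h0 _ _),
    show (2 : ℝ≥0∞) = ENNReal.ofReal 2 by simp, ← ENNReal.ofReal_mul zero_le_two,
    ENNReal.ofReal_le_ofReal_iff (add_nonneg (h0 _ _) (h0 _ _))] at h
  unfold energyDefect
  linarith

theorem continuous_latticeSum_comp {Z : Type*} [TopologicalSpace Z] {q : ℝ} (hq : 1 ≤ q)
    {f : Z → ℝ} (hf : Continuous f) (hf0 : ∀ z, 0 ≤ f z) :
    Continuous fun z => latticeSum q (f z) :=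
  (continuousOn_latticeSum hq).comp_continuous hf fun z => show -1 < f z by linarith [hf0 z]

theorem continuous_stripRegular_dist {q : ℝ} (hq : 1 ≤ q) (t : ℝ) :
    Continuous fun p : E × E => stripRegular q t (dist p.1 p.2) := by
  have := continuous_latticeSum_comp (Z := E × E) hq (f := fun p => (dist p.1 p.2 / t) ^ 2)
    (by fun_prop) (fun p => by positivity)
  unfold stripRegular
  fun_prop

theorem continuous_latticeTerm_dist (q t : ℝ) (j : ℕ) :
    Continuous fun p : E × E => latticeTerm q ((dist p.1 p.2 / t) ^ 2) j := by
  unfold latticeTerm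
  exact Continuous.rpow_const (by fun_prop) fun p => Or.inl (by positivity)

theorem energyDefect_latticeTerm_nonneg {q t : ℝ} (hq : 0 < q) (ht : 0 < t) (hK : IsCompact K)
    (hμ : μ Kᶜ = 0) (hν : ν Kᶜ = 0) (j : ℕ) :
    0 ≤ energyDefect μ ν fun p => latticeTerm q ((dist p.1 p.2 / t) ^ 2) j := by
  have hc := continuous_latticeTerm_dist (E := E) q t j
  have hpd := (posDefKernel_shiftedRiesz (E := E) (half_pos hq)
    (show 0 ≤ t ^ 2 * (4 * ((j : ℝ) + 1) ^ 2) by positivity))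
  have h := hpd.energyDefect_nonneg (μ := μ) (ν := ν)
    (f := fun p => t ^ (-q) * latticeTerm q ((dist p.1 p.2 / t) ^ 2) j) (by
      unfold Function.uncurry
      fun_prop) (by fun_prop)
    (fun p => mul_nonneg (by positivity) (latticeTerm_pos (by nlinarith [sq_nonneg (dist p.1 p.2 / t)]) j).le)
    (fun x y => by
      rw [latticeTerm, scaled_lattice ht _ (by positivity), shiftedRiesz,
        ENNReal.ofReal_rpow_of_pos (by positivity), dist_eq_norm]) hK hμ hν
  rw [energyDefect_const_mul] at h
  exact nonneg_of_mul_nonneg_right h (by positivity)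

/-- All terms have one sign, nonpositive for $q=1$ and nonnegative for $q>1$, so the full sum
dominates the partial ones. This is the majorant for passing to the limit in the defect. -/
theorem abs_sum_latticeTerm_le {q v : ℝ} (hq : 1 ≤ q) (hv : 0 ≤ v) (N : ℕ) :
    |∑ j ∈ Finset.range N, (latticeTerm q v j - latticeShift q j)| ≤ |latticeSum q v| := by
  have hs := summable_latticeTerm hq (show -1 < v by linarith)
  have h2 : |∑' j, (latticeTerm q v j - latticeShift q j)| ≤ |latticeSum q v| := by
    rw [latticeSum, abs_mul, abs_two]
    linarith [abs_nonneg (∑' j, (latticeTerm q v j - latticeShift q j))]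
  refine le_trans ?_ h2
  rcases hq.eq_or_lt with rfl | hq'
  · have h0 : ∀ j, latticeTerm 1 v j - latticeShift 1 j ≤ 0 := fun j => by
      have h1 : latticeTerm 1 v j ≤ latticeTerm 1 0 j :=
        Real.rpow_le_rpow_of_nonpos (by positivity) (by linarith) (by norm_num)
      rw [latticeTerm_zero, Real.rpow_neg_one] at h1
      simpa [latticeShift] using h1
    rw [← abs_neg, ← abs_neg (tsum _), ← Finset.sum_neg_distrib, ← tsum_neg]
    have h0' : ∀ j, 0 ≤ -(latticeTerm 1 v j - latticeShift 1 j) := fun j => by linarith [h0 j]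
    rw [abs_of_nonneg (Finset.sum_nonneg fun j _ => h0' j), abs_of_nonneg (tsum_nonneg h0')]
    exact hs.neg.sum_le_tsum _ fun j _ => h0' j
  · have h0 : ∀ j, 0 ≤ latticeTerm q v j - latticeShift q j := fun j => by
      simpa [latticeShift, hq'] using (latticeTerm_pos (q := q) (show -1 < v by linarith) j).le
    rw [abs_of_nonneg (Finset.sum_nonneg fun j _ => h0 j), abs_of_nonneg (tsum_nonneg h0)]
    exact hs.sum_le_tsum _ fun j _ => h0 j

theorem energyDefect_latticeSum_nonneg {q t : ℝ} (hq : 1 ≤ q) (ht : 0 < t) (hK : IsCompact K)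
    (hμ : μ Kᶜ = 0) (hν : ν Kᶜ = 0) :
    0 ≤ energyDefect μ ν fun p => latticeSum q ((dist p.1 p.2 / t) ^ 2) := by
  have hLc := continuous_latticeSum_comp (Z := E × E) hq (f := fun p => (dist p.1 p.2 / t) ^ 2)
    (by fun_prop) (fun p => by positivity)
  have hTc := continuous_latticeTerm_dist (E := E) q t
  set f : ℕ → E × E → ℝ := fun N p => ∑ j ∈ Finset.range N,
    (latticeTerm q ((dist p.1 p.2 / t) ^ 2) j - latticeShift q j) with hf
  have hfc : ∀ N, Continuous (f N) := fun N => by fun_prop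
  have hN : ∀ N, 0 ≤ energyDefect μ ν (f N) := by
    refine energyDefect_sum_nonneg hK hμ hν (fun j => by fun_prop) fun j => ?_
    simp_rw [sub_eq_add_neg]
    rw [energyDefect_add hK hμ hν (hTc j) continuous_const, energyDefect_const, add_zero]
    exact energyDefect_latticeTerm_nonneg (by linarith) ht hK hμ hν j
  have hlim : ∀ (μ ν : Measure E) [IsProbabilityMeasure μ] [IsProbabilityMeasure ν], μ Kᶜ = 0 →
      ν Kᶜ = 0 → Tendsto (fun N => ∫ p, f N p ∂(μ.prod ν)) atTop
        (𝓝 (∫ p, 1 / 2 * latticeSum q ((dist p.1 p.2 / t) ^ 2) ∂(μ.prod ν))) := by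
    intro μ ν _ _ hμ hν
    refine tendsto_integral_of_dominated_convergence
      (fun p => |latticeSum q ((dist p.1 p.2 / t) ^ 2)|)
      (fun N => (hfc N).aestronglyMeasurable)
      (integrable_prod_of_continuous hLc.abs hK hμ hν)
      (fun N => ae_of_all _ fun p => abs_sum_latticeTerm_le hq (by positivity) N)
      (ae_of_all _ fun p => ?_)
    have hs := (summable_latticeTerm hq
      (show -1 < (dist p.1 p.2 / t) ^ 2 by nlinarith [sq_nonneg (dist p.1 p.2 / t)])).hasSum
    convert! hs.tendsto_sum_nat using 2
    rw [latticeSum]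
    ring
  have h1 : Tendsto (fun N => energyDefect μ ν (f N)) atTop (𝓝 (energyDefect μ ν
      fun p => 1 / 2 * latticeSum q ((dist p.1 p.2 / t) ^ 2))) :=
    ((hlim μ μ hμ hμ).add (hlim ν ν hν hν)).sub ((hlim μ ν hμ hν).const_mul 2)
  have h2 := ge_of_tendsto' h1 hN
  rw [energyDefect_const_mul] at h2
  linarith

theorem energyDefect_stripRegular_nonneg {q t : ℝ} (hq : 1 ≤ q) (ht : 0 < t) (hK : IsCompact K)
    (hμ : μ Kᶜ = 0) (hν : ν Kᶜ = 0) :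
    0 ≤ energyDefect μ ν fun p => stripRegular q t (dist p.1 p.2) := by
  have hLc := continuous_latticeSum_comp (Z := E × E) hq (f := fun p => (dist p.1 p.2 / t) ^ 2)
    (by fun_prop) (fun p => by positivity)
  unfold stripRegular
  rw [energyDefect_add hK hμ hν (by fun_prop) continuous_const, energyDefect_const, add_zero,
    energyDefect_const_mul]
  exact mul_nonneg (by positivity) (energyDefect_latticeSum_nonneg hq ht hK hμ hν)

end EnergyDefect

/-! ### Uniqueness of the minimizing measure. -/

section Uniqueness

variable {E : Type*} [NormedAddCommGroup E] [InnerProductSpace ℝ E] [FiniteDimensional ℝ E]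
  [MeasurableSpace E] [BorelSpace E]

theorem measurable_rieszKernel (q : ℝ) :
    Measurable (Function.uncurry (rieszKernel q : E → E → ℝ≥0∞)) := by
  unfold Function.uncurry rieszKernel
  fun_prop

/-- The sum of the energies of `μ` for the Riesz kernel and for a finite kernel `f`. -/
def totalEnergy (q : ℝ) (f : E × E → ℝ) (μ : Measure E) : EReal :=
  ((∫⁻ p, rieszKernel q p.1 p.2 ∂(μ.prod μ) : ℝ≥0∞) : EReal) + ((∫ p, f p ∂(μ.prod μ) : ℝ) : EReal)

/-- The average of two measures. -/
def midpointMeasure (μ ν : Measure E) : Measure E := (2⁻¹ : ℝ≥0∞) • (μ + ν)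

instance (μ ν : Measure E) [IsProbabilityMeasure μ] [IsProbabilityMeasure ν] :
    IsProbabilityMeasure (midpointMeasure μ ν) :=
  ⟨by simp [midpointMeasure, ENNReal.inv_two_add_inv_two]⟩

theorem midpointMeasure_prod (μ ν : Measure E) [IsProbabilityMeasure μ] [IsProbabilityMeasure ν] :
    (midpointMeasure μ ν).prod (midpointMeasure μ ν)
      = (4⁻¹ : ℝ≥0∞) • (μ.prod μ + ν.prod ν + (μ.prod ν + ν.prod μ)) := by
  rw [midpointMeasure, Measure.prod_smul_left, Measure.prod_smul_right, smul_smul,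
    Measure.prod_add, Measure.add_prod, Measure.add_prod]
  congr 1
  · rw [← ENNReal.mul_inv (by simp) (by simp)]
    norm_num
  · abel

theorem lintegral_prod_comm_of_symm {k : E → E → ℝ≥0∞} (hsymm : ∀ x y, k x y = k y x) (μ ν : Measure E) [SFinite μ] [SFinite ν] :
    ∫⁻ p, k p.1 p.2 ∂(ν.prod μ) = ∫⁻ p, k p.1 p.2 ∂(μ.prod ν) := by
  rw [← lintegral_prod_swap]
  exact lintegral_congr fun p => hsymm _ _

/-- The energy of the midpoint is the average of the two energies minus a quarter of the total
defect. Minimality makes that defect nonpositive; since the part from $f$ is nonnegative, the Riesz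
defect is nonpositive, and strictness applies. -/
theorem eq_of_isMin_totalEnergy {q : ℝ} (hq : 0 < q) {f : E × E → ℝ} (hf : Continuous f)
    (hsymm : ∀ p, f p.swap = f p) {K : Set E} (hK : IsCompact K) {μ ν : Measure E}
    [IsProbabilityMeasure μ] [IsProbabilityMeasure ν] (hμ : μ Kᶜ = 0) (hν : ν Kᶜ = 0)
    (hdef : 0 ≤ energyDefect μ ν f) (hfin : totalEnergy q f μ ≠ ⊤)
    (hμmin : ∀ m : Measure E, IsProbabilityMeasure m → m Kᶜ = 0 →
      totalEnergy q f μ ≤ totalEnergy q f m)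
    (hνmin : totalEnergy q f ν ≤ totalEnergy q f μ) : μ = ν := by
  have hk := measurable_rieszKernel (E := E) q
  have hcross : ∀ (μ ν : Measure E) [SFinite ν], crossEnergy (rieszKernel q) μ ν
      = ∫⁻ p, rieszKernel q p.1 p.2 ∂(μ.prod ν) := fun μ ν _ => crossEnergy_eq_lintegral_prod hk μ ν
  have hfinite : ∀ m : Measure E, totalEnergy q f m ≠ ⊤ →
      ∫⁻ p, rieszKernel q p.1 p.2 ∂(m.prod m) ≠ ⊤ := by
    intro m hm h
    refine hm ?_
    rw [totalEnergy, h, EReal.coe_ennreal_top, EReal.top_add_coe]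
  have hRμ := hfinite μ hfin
  have hRν := hfinite ν (ne_top_of_le_ne_top hfin hνmin)
  have hpd := posDefKernel_rieszKernel (E := E) hq μ ν ‹_› ‹_›
  rw [hcross, hcross, hcross] at hpd
  -- Positive definiteness bounds the mutual energy by the two self-energies, so it is finite too.
  have hRμν : ∫⁻ p, rieszKernel q p.1 p.2 ∂(μ.prod ν) ≠ ⊤ := by
    intro h
    rw [h, ENNReal.mul_top two_ne_zero, top_le_iff] at hpd
    exact ENNReal.add_ne_top.2 ⟨hRμ, hRν⟩ hpd
  refine strictKernel_rieszKernel hq μ ν ‹_› ‹_› (by rwa [hcross]) (by rwa [hcross]) ?_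
  rw [hcross, hcross, hcross]
  have hm0 : midpointMeasure μ ν Kᶜ = 0 := by simp [midpointMeasure, hμ, hν]
  have hmid := hμmin (midpointMeasure μ ν) inferInstance hm0
  have hint : ∀ (μ ν : Measure E) [IsProbabilityMeasure μ] [IsProbabilityMeasure ν], μ Kᶜ = 0 →
      ν Kᶜ = 0 → Integrable f (μ.prod ν) := fun μ ν _ _ hμ hν =>
    integrable_prod_of_continuous hf hK hμ hν
  have hRm : ∫⁻ p, rieszKernel q p.1 p.2 ∂((midpointMeasure μ ν).prod (midpointMeasure μ ν))
      = 4⁻¹ * (∫⁻ p, rieszKernel q p.1 p.2 ∂(μ.prod μ) + ∫⁻ p, rieszKernel q p.1 p.2 ∂(ν.prod ν)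
        + 2 * ∫⁻ p, rieszKernel q p.1 p.2 ∂(μ.prod ν)) := by
    rw [midpointMeasure_prod, lintegral_smul_measure, lintegral_add_measure, lintegral_add_measure,
      lintegral_add_measure, lintegral_prod_comm_of_symm
        (fun x y => by rw [rieszKernel, rieszKernel, edist_comm]) μ ν, two_mul, smul_eq_mul]
  have hfm : ∫ p, f p ∂((midpointMeasure μ ν).prod (midpointMeasure μ ν))
      = 4⁻¹ * (∫ p, f p ∂(μ.prod μ) + ∫ p, f p ∂(ν.prod ν) + 2 * ∫ p, f p ∂(μ.prod ν)) := by
    have hs : ∫ p, f p ∂(ν.prod μ) = ∫ p, f p ∂(μ.prod ν) := by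
      rw [← integral_prod_swap]
      exact integral_congr_ae (ae_of_all _ hsymm)
    rw [midpointMeasure_prod, integral_smul_measure,
      integral_add_measure ((hint μ μ hμ hμ).add_measure (hint ν ν hν hν))
        ((hint μ ν hμ hν).add_measure (hint ν μ hν hμ)),
      integral_add_measure (hint μ μ hμ hμ) (hint ν ν hν hν),
      integral_add_measure (hint μ ν hμ hν) (hint ν μ hν hμ), hs]
    simp
    ring
  unfold totalEnergy at hmid hνmin
  rw [hRm, hfm] at hmid
  unfold energyDefect at hdef
  generalize (∫⁻ p, rieszKernel q p.1 p.2 ∂(μ.prod μ)) = a at *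
  generalize (∫⁻ p, rieszKernel q p.1 p.2 ∂(ν.prod ν)) = b at *
  generalize (∫⁻ p, rieszKernel q p.1 p.2 ∂(μ.prod ν)) = c at *
  lift a to NNReal using hRμ
  lift b to NNReal using hRν
  lift c to NNReal using hRμν
  have h4 : (4⁻¹ : ℝ≥0∞) * (a + b + 2 * c) = ((4⁻¹ * (a + b + 2 * c) : NNReal) : ℝ≥0∞) := by
    push_cast
    simp
  rw [h4] at hmid
  simp only [EReal.coe_nnreal_eq_coe_real] at hmid hνmin
  have h5 : (a : ℝ) + ∫ p, f p ∂(μ.prod μ) ≤ ((4⁻¹ * (a + b + 2 * c) : NNReal) : ℝ)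
      + 4⁻¹ * (∫ p, f p ∂(μ.prod μ) + ∫ p, f p ∂(ν.prod ν) + 2 * ∫ p, f p ∂(μ.prod ν)) := by
    exact_mod_cast hmid
  have h6 : (b : ℝ) + ∫ p, f p ∂(ν.prod ν) ≤ (a : ℝ) + ∫ p, f p ∂(μ.prod μ) := by
    exact_mod_cast hνmin
  push_cast at h5
  have h7 : (a : ℝ) + b ≤ 2 * c := by linarith
  exact_mod_cast h7

end Uniqueness

/-! ### The regular part in the parameter $\tau=\log t$. -/

section ExponentialParameter

/-- `stripRegular` at half-height `exp τ`. -/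
def expRegular (q τ r : ℝ) : ℝ :=
  Real.exp (-(q * τ)) * latticeSum q ((r * Real.exp (-τ)) ^ 2)
    + if 1 < q then 0 else Real.exp (-τ) * (Real.eulerMascheroniConstant - Real.log 4 - τ)

/-- The derivative of `expRegular` in `τ`. -/
def expRegularDeriv (q τ r : ℝ) : ℝ :=
  -q * Real.exp (-(q * τ)) * latticeSum q ((r * Real.exp (-τ)) ^ 2)
    + Real.exp (-(q * τ)) * (-(q / 2) * latticeSum (q + 2) ((r * Real.exp (-τ)) ^ 2)
      * (-2 * (r * Real.exp (-τ)) ^ 2))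
    + if 1 < q then 0 else
      -Real.exp (-τ) * (Real.eulerMascheroniConstant - Real.log 4 - τ) - Real.exp (-τ)

/-- The substitution $t=e^\tau$ gives a parameter running over all of $\mathbb R$, as the form of
Danskin's theorem above requires. -/
theorem stripRegular_exp (q τ r : ℝ) :
    stripRegular q (Real.exp τ) r = expRegular q τ r := by
  rw [stripRegular, expRegular, stripConst]
  congr 1
  · rw [← Real.exp_mul, Real.exp_neg τ, ← div_eq_mul_inv, mul_neg, mul_comm τ]
  · split_ifs
    · rfl
    · rw [Real.log_mul four_ne_zero (Real.exp_ne_zero _), Real.log_exp, one_div, ← Real.exp_neg]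
      ring

theorem hasDerivAt_expRegular {q : ℝ} (hq : 1 ≤ q) (τ r : ℝ) :
    HasDerivAt (fun s => expRegular q s r) (expRegularDeriv q τ r) τ := by
  have h1 : HasDerivAt (fun s => Real.exp (-(q * s))) (-q * Real.exp (-(q * τ))) τ := by
    have := (((hasDerivAt_id τ).const_mul q).neg).exp
    convert! this using 1
    simp
    ring
  have h2 : HasDerivAt (fun s => Real.exp (-s)) (-Real.exp (-τ)) τ := by
    have := (hasDerivAt_id τ).neg.exp
    convert! this using 1
    simp
  have h3 : HasDerivAt (fun s => (r * Real.exp (-s)) ^ 2) (-2 * (r * Real.exp (-τ)) ^ 2) τ := by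
    have := (h2.const_mul r).pow 2
    convert! this using 1
    ring
  have h4 := hasDerivAt_latticeSum (q := q) (v := (r * Real.exp (-τ)) ^ 2) hq
    (by nlinarith [sq_nonneg (r * Real.exp (-τ))])
  have h5 := HasDerivAt.comp (h₂ := latticeSum q) (h := fun s => (r * Real.exp (-s)) ^ 2) τ h4 h3
  unfold expRegular expRegularDeriv
  refine HasDerivAt.add (h1.mul h5) ?_
  split_ifs
  · exact hasDerivAt_const _ _
  · have h6 := h2.mul ((hasDerivAt_id τ).const_sub (Real.eulerMascheroniConstant - Real.log 4))
    convert! h6 using 1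
    simp
    ring

variable {Z : Type*} [PseudoMetricSpace Z]

theorem continuous_expRegular {q : ℝ} (hq : 1 ≤ q) :
    Continuous (Function.uncurry fun (τ : ℝ) (z : Z × Z) => expRegular q τ (dist z.1 z.2)) := by
  have h := continuous_latticeSum_comp (Z := ℝ × Z × Z) hq
    (f := fun p => (dist p.2.1 p.2.2 * Real.exp (-p.1)) ^ 2) (by fun_prop) (fun p => by positivity)
  unfold Function.uncurry expRegular
  split_ifs <;> fun_prop

theorem continuous_expRegularDeriv {q : ℝ} (hq : 1 ≤ q) :
    Continuous (Function.uncurry fun (τ : ℝ) (z : Z × Z) =>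
      expRegularDeriv q τ (dist z.1 z.2)) := by
  have h := continuous_latticeSum_comp (Z := ℝ × Z × Z) hq
    (f := fun p => (dist p.2.1 p.2.2 * Real.exp (-p.1)) ^ 2) (by fun_prop) (fun p => by positivity)
  have h' := continuous_latticeSum_comp (Z := ℝ × Z × Z) (show 1 ≤ q + 2 by linarith)
    (f := fun p => (dist p.2.1 p.2.2 * Real.exp (-p.1)) ^ 2) (by fun_prop) (fun p => by positivity)
  unfold Function.uncurry expRegularDeriv
  split_ifs <;> fun_prop

end ExponentialParameter

/-! ### Finiteness and $C^1$ dependence of the strip energy. -/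

section Smoothness

variable {n : ℕ}

local notation "𝔼" => EuclideanSpace ℝ (Fin n)

theorem continuous_rieszKernel {X : Type*} [PseudoEMetricSpace X] (q : ℝ) :
    Continuous fun z : X × X => rieszKernel q z.1 z.2 :=
  ENNReal.continuous_rpow_const.comp (continuous_fst.edist continuous_snd)

theorem eintegral_stripKernel {q t : ℝ} (hq : 1 ≤ q) (ht : 0 < t) {K : Set 𝔼} (hK : IsCompact K)
    (μ : Measure 𝔼) [IsProbabilityMeasure μ] (hμ : μ Kᶜ = 0) :
    eintegral (μ.prod μ) (fun p => stripKernel q t (pt p.1 0) (pt p.2 0))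
      = totalEnergy q (fun p => stripRegular q t (dist p.1 p.2)) μ := by
  have hc := continuous_stripRegular_dist (E := 𝔼) hq t
  simp_rw [stripKernel_eq hq ht]
  exact eintegral_coe_add (measurable_rieszKernel q) hc.measurable
    (integrable_prod_of_continuous hc hK hμ hμ)

theorem rieszEnergy_eq_iInf (q : ℝ) (K : Set 𝔼) :
    rieszEnergy q K = ⨅ (μ : Measure 𝔼) (_ : IsProbabilityMeasure μ) (_ : μ Kᶜ = 0),
      ((∫⁻ p, rieszKernel q p.1 p.2 ∂(μ.prod μ) : ℝ≥0∞) : EReal) := by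
  simp only [rieszEnergy, energy, eintegral_coe]

/-- A probability measure on the subtype `K` as a measure on the ambient space. -/
def extend {K : Set 𝔼} (μ : ProbabilityMeasure K) : Measure 𝔼 :=
  (μ : Measure K).map Subtype.val

instance {K : Set 𝔼} (μ : ProbabilityMeasure K) : IsProbabilityMeasure (extend μ) :=
  Measure.isProbabilityMeasure_map measurable_subtype_coe.aemeasurable

theorem extend_compl {K : Set 𝔼} (hK : IsCompact K) (μ : ProbabilityMeasure K) :
    extend μ Kᶜ = 0 := by
  rw [extend, Measure.map_apply measurable_subtype_coe hK.measurableSet.compl]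
  simp

theorem exists_extend_eq {K : Set 𝔼} (hK : IsCompact K) (ν : Measure 𝔼) [IsProbabilityMeasure ν]
    (hν : ν Kᶜ = 0) : ∃ μ : ProbabilityMeasure K, extend μ = ν := by
  have h : (ν.comap (Subtype.val : K → 𝔼)).map Subtype.val = ν := by
    rw [map_comap_subtype_coe hK.measurableSet, Measure.restrict_eq_self_of_ae_mem]
    exact hν
  have hp : IsProbabilityMeasure (ν.comap (Subtype.val : K → 𝔼)) := by
    refine ⟨?_⟩
    have h1 : ((ν.comap (Subtype.val : K → 𝔼)).map Subtype.val) univ = 1 := by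
      rw [h]; exact measure_univ
    rwa [Measure.map_apply measurable_subtype_coe MeasurableSet.univ, preimage_univ] at h1
  exact ⟨⟨_, hp⟩, h⟩

theorem extend_injective {K : Set 𝔼} (hK : IsCompact K) :
    Function.Injective (extend : ProbabilityMeasure K → Measure 𝔼) := by
  intro μ ν h
  have he := MeasurableEmbedding.subtype_coe hK.measurableSet
  have h1 := congrArg (Measure.comap (Subtype.val : K → 𝔼)) h
  simp only [extend, he.comap_map] at h1
  exact Subtype.ext h1

theorem extend_prod {K : Set 𝔼} (μ : ProbabilityMeasure K) :
    (extend μ).prod (extend μ)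
      = ((μ.prod μ : ProbabilityMeasure (K × K)) : Measure (K × K)).map
        (Prod.map Subtype.val Subtype.val) := by
  rw [extend, Measure.map_prod_map _ _ measurable_subtype_coe measurable_subtype_coe]
  rfl

theorem totalEnergy_extend {q : ℝ} {f : 𝔼 × 𝔼 → ℝ} (hf : Continuous f) {K : Set 𝔼}
    (μ : ProbabilityMeasure K) :
    totalEnergy q f (extend μ)
      = ((∫⁻ z : K × K, rieszKernel q (z.1 : 𝔼) (z.2 : 𝔼)
          ∂((μ.prod μ : ProbabilityMeasure (K × K)) : Measure (K × K)) : ℝ≥0∞) : EReal)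
        + ((∫ z : K × K, f (z.1, z.2)
          ∂((μ.prod μ : ProbabilityMeasure (K × K)) : Measure (K × K)) : ℝ) : EReal) := by
  have hm : Measurable (Prod.map (Subtype.val : K → 𝔼) (Subtype.val : K → 𝔼)) :=
    measurable_subtype_coe.prodMap measurable_subtype_coe
  rw [totalEnergy, extend_prod, lintegral_map (continuous_rieszKernel q).measurable hm,
    integral_map hm.aemeasurable hf.aestronglyMeasurable]
  rfl

/-- Measures carried by $K$ are exchanged for probability measures on the compact space $K$, which
form a weakly compact space. -/
theorem stripEnergy_eq_iInf {q t : ℝ} (hq : 1 ≤ q) (ht : 0 < t) {K : Set 𝔼} (hK : IsCompact K) :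
    stripEnergy q K t = ⨅ μ : ProbabilityMeasure K,
      totalEnergy q (fun p => stripRegular q t (dist p.1 p.2)) (extend μ) := by
  refine le_antisymm (le_iInf fun μ => ?_) (le_energy fun ν _ hν => ?_)
  · rw [← eintegral_stripKernel hq ht hK (extend μ) (extend_compl hK μ)]
    exact energy_le (extend μ) (extend_compl hK μ)
  · obtain ⟨μ, rfl⟩ := exists_extend_eq hK ν hν
    rw [eintegral_stripKernel hq ht hK _ hν]
    exact iInf_le _ μ

/-- The strip energy is a real-valued `C¹` function of the half-height. -/
theorem exists_contDiffOn_stripEnergy {q : ℝ} (hq : 1 ≤ q) {K : Set 𝔼} (hK : IsCompact K)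
    (hfin : rieszEnergy q K < ⊤) :
    ∃ e : ℝ → ℝ, ContDiffOn ℝ 1 e (Ioi 0) ∧ ∀ t : ℝ, 0 < t → stripEnergy q K t = (e t : EReal) := by
  have : CompactSpace K := isCompact_iff_compactSpace.1 hK
  set F : ProbabilityMeasure K → ℝ≥0∞ := fun μ => ∫⁻ z : K × K, rieszKernel q (z.1 : 𝔼) (z.2 : 𝔼)
    ∂((μ.prod μ : ProbabilityMeasure (K × K)) : Measure (K × K)) with hF
  set P : ℝ → ProbabilityMeasure K → ℝ := fun τ μ => ∫ z : K × K, expRegular q τ (dist z.1 z.2)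
    ∂((μ.prod μ : ProbabilityMeasure (K × K)) : Measure (K × K)) with hP
  set D : ℝ → ProbabilityMeasure K → ℝ := fun τ μ =>
    ∫ z : K × K, expRegularDeriv q τ (dist z.1 z.2)
    ∂((μ.prod μ : ProbabilityMeasure (K × K)) : Measure (K × K)) with hD
  have hprod : Continuous fun μ : ProbabilityMeasure K => μ.prod μ :=
    ProbabilityMeasure.continuous_prod.comp (continuous_id.prodMk continuous_id)
  have hFP : ∀ τ μ, totalEnergy q (fun p => stripRegular q (Real.exp τ) (dist p.1 p.2)) (extend μ)
      = (F μ : EReal) + (P τ μ : EReal) := fun τ μ => by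
    rw [totalEnergy_extend (continuous_stripRegular_dist hq _)]
    simp only [stripRegular_exp]
    rfl
  have hFlsc : LowerSemicontinuous F :=
    LowerSemicontinuous.comp (g := fun μ : ProbabilityMeasure K => μ.prod μ)
      (lowerSemicontinuous_lintegral_probabilityMeasure (continuous_rieszKernel (X := K) q)) hprod
  have hFfin : ∃ μ, F μ ≠ ⊤ := by
    rw [rieszEnergy_eq_iInf] at hfin
    simp only [iInf_lt_iff] at hfin
    obtain ⟨ν, hν1, hν2, hν3⟩ := hfin
    obtain ⟨μ, rfl⟩ := exists_extend_eq hK ν hν2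
    refine ⟨μ, fun h => hν3.ne ?_⟩
    rw [extend_prod, lintegral_map (continuous_rieszKernel q).measurable
      (measurable_subtype_coe.prodMap measurable_subtype_coe), EReal.coe_ennreal_eq_top_iff]
    exact h
  have hPc : Continuous (Function.uncurry P) :=
    (continuous_integral_uncurry (continuous_expRegular (Z := K) hq)).comp
      (continuous_fst.prodMk (hprod.comp continuous_snd))
  have hDc : Continuous (Function.uncurry D) :=
    (continuous_integral_uncurry (continuous_expRegularDeriv (Z := K) hq)).comp
      (continuous_fst.prodMk (hprod.comp continuous_snd))
  have hPD : ∀ τ μ, HasDerivAt (fun s => P s μ) (D τ μ) τ := fun τ μ =>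
    hasDerivAt_integral_param (continuous_expRegular (Z := K) hq)
      (continuous_expRegularDeriv (Z := K) hq) (fun τ z => hasDerivAt_expRegular hq τ _) _ τ
  have huniq : ∀ τ μ ν, (∀ σ, (F μ : EReal) + (P τ μ : EReal) ≤ F σ + (P τ σ : EReal)) →
      (∀ σ, (F ν : EReal) + (P τ ν : EReal) ≤ F σ + (P τ σ : EReal)) → μ = ν := by
    intro τ μ ν hμ hν
    simp only [← hFP] at hμ hν
    refine extend_injective hK (eq_of_isMin_totalEnergy (q := q) (by linarith)
      (continuous_stripRegular_dist hq _) (fun p => by simp [dist_comm]) hK (extend_compl hK μ)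
      (extend_compl hK ν) (energyDefect_stripRegular_nonneg hq (Real.exp_pos τ) hK
        (extend_compl hK μ) (extend_compl hK ν)) ?_ ?_ (hν μ))
    · obtain ⟨σ, hσ⟩ := hFfin
      refine ne_top_of_le_ne_top ?_ (hμ σ)
      rw [hFP]
      lift F σ to NNReal using hσ with a
      exact EReal.coe_ne_top (a + P τ σ)
    · intro m _ hm
      obtain ⟨σ, rfl⟩ := exists_extend_eq hK m hm
      exact hμ σ
  obtain ⟨e, he, heq⟩ := exists_contDiff_iInf hFlsc hFfin hPc hDc hPD huniq
  refine ⟨fun t => e (Real.log t), ?_, fun t ht => ?_⟩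
  · exact he.comp_contDiffOn (Real.contDiffOn_log.mono fun t ht => ne_of_gt ht)
  · rw [← heq, stripEnergy_eq_iInf hq ht hK]
    refine iInf_congr fun μ => ?_
    rw [← hFP, Real.exp_log ht]

end Smoothness

/-! ### Convolution with a probability measure and with small balls. -/

section Mollification

variable {E : Type*} [NormedAddCommGroup E] [InnerProductSpace ℝ E] [FiniteDimensional ℝ E]
  [MeasurableSpace E] [BorelSpace E]

/-- $\nu*\mu$ is a $\nu$-average of translates of $\mu$. These share one self-energy by invariance,
and positive definiteness bounds each mutual energy of two translates by it. -/
theorem PosDefKernel.crossEnergy_conv_le {k : E → E → ℝ≥0∞} (hk : PosDefKernel k)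
    (hkm : Measurable (Function.uncurry k)) (hinv : ∀ a x y, k (a + x) (a + y) = k x y)
    (μ ν : Measure E) [IsProbabilityMeasure μ] [IsProbabilityMeasure ν] :
    crossEnergy k (ν ∗ μ) (ν ∗ μ) ≤ crossEnergy k μ μ := by
  have hkm' : ∀ {Ω : Type _} [MeasurableSpace Ω] {f g : Ω → E}, Measurable f → Measurable g →
      Measurable fun ω => k (f ω) (g ω) := fun hf hg => hkm.comp (hf.prodMk hg)
  have htrans : ∀ a b : E, crossEnergy k (μ.map (a + ·)) (μ.map (b + ·))
      = ∫⁻ x, ∫⁻ y, k (a + x) (b + y) ∂μ ∂μ := by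
    intro a b
    rw [crossEnergy, lintegral_map (Measurable.lintegral_prod_right' (f := fun p : E × E => k p.1 p.2)
      hkm) (by fun_prop)]
    refine lintegral_congr fun x => ?_
    have hm : Measurable fun y => k (a + x) y := hkm' measurable_const measurable_id
    exact lintegral_map hm (by fun_prop)
  have hself : ∀ a : E, crossEnergy k (μ.map (a + ·)) (μ.map (a + ·)) = crossEnergy k μ μ := by
    intro a
    rw [htrans]
    simp only [hinv]
    rfl
  have hle : ∀ a b : E, ∫⁻ x, ∫⁻ y, k (a + x) (b + y) ∂μ ∂μ ≤ crossEnergy k μ μ := by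
    intro a b
    have := hk (μ.map (a + ·)) (μ.map (b + ·))
      (Measure.isProbabilityMeasure_map (by fun_prop))
      (Measure.isProbabilityMeasure_map (by fun_prop))
    rw [hself, hself, htrans, ← two_mul] at this
    exact (ENNReal.mul_le_mul_iff_right two_ne_zero ENNReal.ofNat_ne_top).1 this
  have hin : ∀ x, ∫⁻ y, k x y ∂(ν ∗ μ) = ∫⁻ b, ∫⁻ y, k x (b + y) ∂μ ∂ν := fun x =>
    Measure.lintegral_conv (hkm' measurable_const measurable_id)
  have h3 : Measurable fun p : (E × E) × E => ∫⁻ y, k (p.1.1 + p.1.2) (p.2 + y) ∂μ :=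
    Measurable.lintegral_prod_right' (f := fun q : ((E × E) × E) × E =>
      k (q.1.1.1 + q.1.1.2) (q.1.2 + q.2)) (hkm' (by fun_prop) (by fun_prop))
  have hin_meas : Measurable fun x => ∫⁻ b, ∫⁻ y, k x (b + y) ∂μ ∂ν :=
    Measurable.lintegral_prod_right' (f := fun q : E × E => ∫⁻ y, k q.1 (q.2 + y) ∂μ)
      (Measurable.lintegral_prod_right' (f := fun q : (E × E) × E => k q.1.1 (q.1.2 + q.2))
        (hkm' (by fun_prop) (by fun_prop)))
  calc crossEnergy k (ν ∗ μ) (ν ∗ μ)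
      = ∫⁻ a, ∫⁻ x, ∫⁻ b, ∫⁻ y, k (a + x) (b + y) ∂μ ∂ν ∂μ ∂ν := by
        simp only [crossEnergy, hin]
        exact Measure.lintegral_conv hin_meas
    _ = ∫⁻ a, ∫⁻ b, ∫⁻ x, ∫⁻ y, k (a + x) (b + y) ∂μ ∂μ ∂ν ∂ν := by
        refine lintegral_congr fun a => ?_
        refine lintegral_lintegral_swap (f := fun x b => ∫⁻ y, k (a + x) (b + y) ∂μ) ?_
        exact (h3.comp (f := fun p : E × E => ((a, p.1), p.2)) (by fun_prop)).aemeasurable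
    _ ≤ ∫⁻ _, ∫⁻ _, crossEnergy k μ μ ∂ν ∂ν :=
        lintegral_mono fun a => lintegral_mono fun b => hle a b
    _ = crossEnergy k μ μ := by simp

theorem crossEnergy_conv_le_of_bound {k : E → E → ℝ≥0∞} (hkm : Measurable (Function.uncurry k))
    {C : ℝ≥0∞} (μ ν : Measure E) [IsProbabilityMeasure μ] [IsProbabilityMeasure ν]
    (hC : ∀ x y, ∫⁻ b, k x (b + y) ∂ν ≤ C) : crossEnergy k (ν ∗ μ) (ν ∗ μ) ≤ C := by
  have hin : ∀ x, ∫⁻ y, k x y ∂(ν ∗ μ) ≤ C := by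
    intro x
    have hx : Measurable fun y => k x y := hkm.comp (measurable_const.prodMk measurable_id)
    rw [Measure.lintegral_conv hx]
    have hm : Measurable fun p : E × E => k x (p.1 + p.2) :=
      hkm.comp (measurable_const.prodMk (measurable_fst.add measurable_snd))
    rw [lintegral_lintegral_swap (f := fun b y => k x (b + y)) hm.aemeasurable]
    refine (lintegral_mono fun y => hC x y).trans ?_
    simp
  refine (lintegral_mono hin).trans ?_
  simp

/-- In polar coordinates the integrand is $r^{n-1-q}$, integrable near $0$ because $q<n$. -/
theorem lintegral_ball_rieszKernel_lt_top {q : ℝ}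
    (hqn : q < Module.finrank ℝ E) [Nontrivial E] :
    ∫⁻ b in Metric.ball (0 : E) 1, rieszKernel q b 0 < ⊤ := by
  have h1 : IntegrableOn (fun b : E => ‖b‖ ^ (-q)) (Metric.ball 0 1) := by
    rw [integrableOn_fun_norm_addHaar volume (f := fun r : ℝ => r ^ (-q))]
    have h2 : IntegrableOn (fun y : ℝ => y ^ ((Module.finrank ℝ E : ℝ) - 1 - q)) (Ioo 0 1) := by
      have := intervalIntegral.intervalIntegrable_rpow' (a := 0) (b := 1)
        (r := (Module.finrank ℝ E : ℝ) - 1 - q) (by linarith)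
      rw [intervalIntegrable_iff_integrableOn_Ioo_of_le zero_le_one] at this
      exact this
    refine h2.congr_fun (fun y hy => ?_) measurableSet_Ioo
    have hy0 : 0 < y := hy.1
    have hn : 1 ≤ Module.finrank ℝ E := Module.finrank_pos
    simp only [smul_eq_mul]
    rw [sub_eq_add_neg _ q, Real.rpow_add hy0, ← Nat.cast_one, ← Nat.cast_sub hn,
      Real.rpow_natCast]
  have h2 := h1.lintegral_lt_top
  refine lt_of_le_of_lt (le_of_eq ?_) h2
  have hz : ∀ᵐ b : E ∂(volume.restrict (Metric.ball 0 1)), b ≠ 0 :=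
    ae_restrict_of_ae (by simp [ae_iff])
  refine lintegral_congr_ae (hz.mono fun b hb => ?_)
  simp only
  rw [rieszKernel_of_ne hb, dist_zero_right]

theorem rieszKernel_le {q : ℝ} (hq : 0 < q) (b w : E) :
    rieszKernel q w b ≤ (Metric.ball (0 : E) 1).indicator (fun u => rieszKernel q u 0) (b - w) + 1 := by
  by_cases h : b - w ∈ Metric.ball (0 : E) 1
  · rw [indicator_of_mem h]
    refine le_add_right (le_of_eq ?_)
    rw [rieszKernel, rieszKernel, edist_comm, edist_eq_enorm_sub, edist_eq_enorm_sub, sub_zero]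
  · refine le_add_left ?_
    rw [rieszKernel, ENNReal.rpow_neg, ENNReal.inv_le_one]
    refine ENNReal.one_le_rpow ?_ hq
    rw [mem_ball_zero_iff, not_lt] at h
    rw [edist_comm, edist_dist, dist_eq_norm]
    exact ENNReal.one_le_ofReal.2 h

/-- The uniform probability measure on the ball of radius `δ`. -/
def uniformBall (E : Type*) [NormedAddCommGroup E] [InnerProductSpace ℝ E] [FiniteDimensional ℝ E]
    [MeasurableSpace E] [BorelSpace E] (δ : ℝ) : Measure E :=
  (volume (Metric.ball (0 : E) δ))⁻¹ • volume.restrict (Metric.ball 0 δ)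

theorem isProbabilityMeasure_uniformBall {δ : ℝ} (hδ : 0 < δ) :
    IsProbabilityMeasure (uniformBall E δ) := by
  refine ⟨?_⟩
  rw [uniformBall, Measure.smul_apply, Measure.restrict_apply_univ, smul_eq_mul,
    ENNReal.inv_mul_cancel (Metric.measure_ball_pos _ _ hδ).ne' measure_ball_lt_top.ne]

/-- The kernel is at most $1$ beyond distance one, and its singular part has finite integral.
Translation invariance of volume makes the bound uniform in $x,y$. -/
theorem exists_bound_uniformBall {q : ℝ} (hq : 0 < q) (hqn : q < Module.finrank ℝ E) [Nontrivial E]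
    {δ : ℝ} (hδ : 0 < δ) : ∃ C : ℝ≥0∞, C ≠ ⊤ ∧
      ∀ x y : E, ∫⁻ b, rieszKernel q x (b + y) ∂(uniformBall E δ) ≤ C := by
  set V := volume (Metric.ball (0 : E) δ) with hV
  have hV0 : V ≠ 0 := (Metric.measure_ball_pos _ _ hδ).ne'
  have hVt : V ≠ ⊤ := measure_ball_lt_top.ne
  refine ⟨V⁻¹ * ((∫⁻ b in Metric.ball (0 : E) 1, rieszKernel q b 0) + V), ?_, fun x y => ?_⟩
  · exact ENNReal.mul_ne_top (ENNReal.inv_ne_top.2 hV0)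
      (ENNReal.add_ne_top.2 ⟨(lintegral_ball_rieszKernel_lt_top hqn).ne, hVt⟩)
  · rw [uniformBall, lintegral_smul_measure, smul_eq_mul]
    gcongr
    have hr : Measurable fun u : E => rieszKernel q u 0 :=
      (measurable_rieszKernel q).comp (measurable_id.prodMk measurable_const)
    have hi : Measurable ((Metric.ball (0 : E) 1).indicator fun u => rieszKernel q u 0) :=
      hr.indicator Metric.isOpen_ball.measurableSet
    calc ∫⁻ b in Metric.ball (0 : E) δ, rieszKernel q x (b + y)
        ≤ ∫⁻ b in Metric.ball (0 : E) δ,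
          ((Metric.ball (0 : E) 1).indicator (fun u => rieszKernel q u 0) (b + (y - x)) + 1) := by
          refine lintegral_mono fun b => ?_
          have := rieszKernel_le hq (b + y) x
          rwa [add_sub_assoc] at this
      _ = (∫⁻ b in Metric.ball (0 : E) δ,
          (Metric.ball (0 : E) 1).indicator (fun u => rieszKernel q u 0) (b + (y - x))) + V := by
          rw [lintegral_add_right _ measurable_const, lintegral_one, Measure.restrict_apply_univ]
      _ ≤ (∫⁻ b, (Metric.ball (0 : E) 1).indicator (fun u => rieszKernel q u 0) (b + (y - x)))
          + V := by
          gcongr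
          exact Measure.restrict_le_self
      _ = _ := by
          rw [lintegral_add_right_eq_self, lintegral_indicator Metric.isOpen_ball.measurableSet]

theorem conv_uniformBall_compl {δ : ℝ} {Q K : Set E} {μ : Measure E} [IsProbabilityMeasure μ]
    (hμ : μ Qᶜ = 0) (hK : MeasurableSet K) (hQK : Metric.thickening δ Q ⊆ K) (hδ : 0 < δ) :
    (uniformBall E δ ∗ μ) Kᶜ = 0 := by
  have := isProbabilityMeasure_uniformBall (E := E) hδ
  have hu : uniformBall E δ (Metric.ball 0 δ)ᶜ = 0 := by
    rw [uniformBall, Measure.smul_apply, Measure.restrict_apply Metric.isOpen_ball.measurableSet.compl]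
    simp
  rw [Measure.conv, Measure.map_apply (by fun_prop) hK.compl]
  refine measure_mono_null ?_ (show ((uniformBall E δ).prod μ) {p | ¬ (p.1 ∈ Metric.ball 0 δ ∧ p.2 ∈ Q)} = 0
    from ae_prod_mem hu hμ)
  rintro ⟨a, x⟩ hp ⟨ha, hx⟩
  refine hp (hQK ?_)
  rw [Metric.mem_thickening_iff]
  exact ⟨x, hx, by simpa using ha⟩

end Mollification

/-- The logarithmic kernel `log (1 / |x - y|)`, equal to `+∞` on the diagonal. -/
def logKernel {X : Type*} [PseudoEMetricSpace X] (x y : X) : EReal := -ENNReal.log (edist x y)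

theorem logKernel_self {X : Type*} [PseudoEMetricSpace X] (x : X) : logKernel x x = ⊤ := by
  simp [logKernel]

theorem logKernel_of_ne {X : Type*} [MetricSpace X] {x y : X} (h : x ≠ y) :
    logKernel x y = ((-Real.log (dist x y) : ℝ) : EReal) := by
  rw [logKernel, edist_dist, ENNReal.log_ofReal_of_pos (dist_pos.2 h)]
  rfl

/-- The kernel whose minimal energy is the thin strip endpoint. -/
def endpointKernel {X : Type*} [PseudoEMetricSpace X] (q : ℝ) (x y : X) : EReal :=
  if 1 < q then (thinConst (q - 1) : EReal) * (rieszKernel (q - 1) x y : EReal) else logKernel x y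

theorem endpointKernel_self {q : ℝ} {X : Type*} [MetricSpace X] (x : X) :
    endpointKernel q x x = ⊤ := by
  rw [endpointKernel]
  split_ifs with h
  · rw [rieszKernel_self (by linarith), EReal.coe_ennreal_top]
    exact EReal.coe_mul_top_of_pos (thinConst_pos h)
  · exact logKernel_self x

theorem endpointKernel_of_ne {q : ℝ} {X : Type*} [MetricSpace X] {x y : X} (h : x ≠ y) :
    endpointKernel q x y = (thinProfile q (dist x y) : EReal) := by
  rw [endpointKernel, thinProfile]
  split_ifs with hq
  · rw [rieszKernel_of_ne h, EReal.coe_ennreal_ofReal, max_eq_left (by positivity), neg_sub]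
    norm_cast
  · exact logKernel_of_ne h

/-- One inequality, valid for every positive factor, is applied with $t$ and with $t^{-1}$. -/
theorem energy_const_mul {X : Type*} [MeasurableSpace X] {t : ℝ} (ht : 0 < t)
    (k : X → X → EReal) (K : Set X) :
    energy (fun x y => (t : EReal) * k x y) K = t * energy k K := by
  have key : ∀ {s : ℝ} (_ : 0 < s) (k : X → X → EReal),
      (s : EReal) * energy k K ≤ energy (fun x y => (s : EReal) * k x y) K := by
    intro s hs k
    refine le_energy fun μ _ hμ => ?_
    rw [eintegral_const_mul hs (fun p : X × X => k p.1 p.2)]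
    exact mul_le_mul_of_nonneg_left (energy_le μ hμ) (by exact_mod_cast hs.le)
  refine le_antisymm ?_ (key ht k)
  have h := key (inv_pos.2 ht) fun x y => (t : EReal) * k x y
  have h1 : ∀ a : EReal, ((t⁻¹ : ℝ) : EReal) * ((t : EReal) * a) = a := fun a => by
    rw [← mul_assoc, ← EReal.coe_mul, inv_mul_cancel₀ ht.ne', EReal.coe_one, one_mul]
  have h2 : ∀ a : EReal, (t : EReal) * (((t⁻¹ : ℝ) : EReal) * a) = a := fun a => by
    rw [← mul_assoc, ← EReal.coe_mul, mul_inv_cancel₀ ht.ne', EReal.coe_one, one_mul]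
  simp only [h1] at h
  have h3 := mul_le_mul_of_nonneg_left h (show (0 : EReal) ≤ t by exact_mod_cast ht.le)
  rwa [h2] at h3

theorem thinEndpoint_eq_energy {n : ℕ} (q : ℝ) (K : Set (EuclideanSpace ℝ (Fin n))) :
    thinEndpoint q K = energy (endpointKernel q) K := by
  rw [thinEndpoint]
  split_ifs with h
  · rw [rieszEnergy, ← energy_const_mul (thinConst_pos h)]
    congr 1
    ext x y
    rw [endpointKernel, if_pos h]
  · rw [logEnergy]
    congr 1
    ext x y
    rw [endpointKernel, if_neg h, logKernel]

/-! ### Convolution and the logarithmic energy. -/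

section Log

variable {E : Type*} [NormedAddCommGroup E] [InnerProductSpace ℝ E] [FiniteDimensional ℝ E]
  [MeasurableSpace E] [BorelSpace E]

theorem half_truncatedLog_of_ne {M : ℝ} (hM : 0 < M) {x y : E} (h : x ≠ y) :
    ((2⁻¹ * truncatedLog M x y : ℝ≥0∞) : EReal)
      = ((2⁻¹ * Real.log (dist x y ^ 2 + M) - Real.log (dist x y) : ℝ) : EReal) := by
  have hr := dist_pos.2 h
  have h2 : (2⁻¹ : ℝ≥0∞) = ENNReal.ofReal 2⁻¹ := by
    rw [ENNReal.ofReal_inv_of_pos two_pos, ENNReal.ofReal_ofNat]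
  have h1 : 0 ≤ Real.log ((dist x y ^ 2 + M) / dist x y ^ 2) :=
    Real.log_nonneg (by rw [le_div_iff₀ (by positivity)]; linarith)
  rw [truncatedLog_of_ne hM.le h, ← dist_eq_norm, h2, ← ENNReal.ofReal_mul (by norm_num),
    EReal.coe_ennreal_ofReal, max_eq_left (by positivity)]
  rw [Real.log_div (by positivity) (by positivity), Real.log_pow]
  congr 1
  push_cast
  ring

/-- The right side minus the left is $\tfrac12\log(1+r^2/M)$, between $0$ and $r^2/(2M)$. So up to a
constant and a small error, the sign-changing logarithm is a nonnegative positive definite kernel on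
bounded sets. -/
theorem logKernel_le {M : ℝ} (hM : 0 < M) (x y : E) :
    logKernel x y ≤ ((2⁻¹ * truncatedLog M x y : ℝ≥0∞) : EReal)
      + ((-(2⁻¹ * Real.log M) : ℝ) : EReal) := by
  by_cases h : x = y
  · subst h
    rw [truncatedLog_self hM, ENNReal.mul_top (by simp), EReal.coe_ennreal_top,
      EReal.top_add_coe]
    exact le_top
  · rw [half_truncatedLog_of_ne hM h, logKernel_of_ne h, ← EReal.coe_add, EReal.coe_le_coe_iff]
    have := Real.log_le_log hM (show M ≤ dist x y ^ 2 + M by nlinarith [sq_nonneg (dist x y)])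
    linarith

theorem le_logKernel {M R : ℝ} (hM : 0 < M) {x y : E} (hxy : dist x y ≤ R) :
    ((2⁻¹ * truncatedLog M x y : ℝ≥0∞) : EReal)
      + ((-(2⁻¹ * Real.log M) - R ^ 2 / (2 * M) : ℝ) : EReal) ≤ logKernel x y := by
  by_cases h : x = y
  · subst h
    rw [logKernel_self]
    exact le_top
  · rw [half_truncatedLog_of_ne hM h, logKernel_of_ne h, ← EReal.coe_add, EReal.coe_le_coe_iff]
    have hr := dist_pos.2 h
    have h1 := Real.log_le_sub_one_of_pos (show 0 < (dist x y ^ 2 + M) / M by positivity)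
    rw [Real.log_div (by positivity) hM.ne'] at h1
    have h2 : (dist x y ^ 2 + M) / M - 1 = 2 * (dist x y ^ 2 / (2 * M)) := by field_simp; ring
    have h3 : dist x y ^ 2 / (2 * M) ≤ R ^ 2 / (2 * M) := by gcongr
    linarith

theorem measurable_half_truncatedLog (M : ℝ) :
    Measurable (Function.uncurry fun x y : E => 2⁻¹ * truncatedLog M x y) :=
  measurable_const.mul (measurable_truncatedLog M)

theorem eintegral_truncatedLog_add (M c : ℝ) (μ : Measure E) [IsProbabilityMeasure μ] :
    eintegral (μ.prod μ) (fun p => ((2⁻¹ * truncatedLog M p.1 p.2 : ℝ≥0∞) : EReal) + (c : EReal))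
      = ((crossEnergy (fun x y => 2⁻¹ * truncatedLog M x y) μ μ : ℝ≥0∞) : EReal) + (c : EReal) := by
  rw [eintegral_coe_add (f := fun p : E × E => 2⁻¹ * truncatedLog M p.1 p.2)
    (measurable_half_truncatedLog M) measurable_const (integrable_const c),
    crossEnergy_eq_lintegral_prod (measurable_half_truncatedLog M)]
  simp

/-- The comparison from above is global and is used for $\sigma*\mu$, whose support is not
controlled; the one from below needs bounded distances and is used for $\mu$ alone. -/
theorem eintegral_logKernel_conv_le {K : Set E} {R M : ℝ} (hM : 0 < M)
    (hR : ∀ x ∈ K, ∀ y ∈ K, dist x y ≤ R) (μ σ : Measure E) [IsProbabilityMeasure μ]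
    [IsProbabilityMeasure σ] (hμ : μ Kᶜ = 0) :
    eintegral ((σ ∗ μ).prod (σ ∗ μ)) (fun p => logKernel p.1 p.2)
      ≤ eintegral (μ.prod μ) (fun p => logKernel p.1 p.2) + ((R ^ 2 / (2 * M) : ℝ) : EReal) := by
  have hinv : ∀ a x y : E, 2⁻¹ * truncatedLog M (a + x) (a + y) = 2⁻¹ * truncatedLog M x y := by
    intro a x y
    simp [truncatedLog, shiftedRiesz]
  have hconv := ((posDefKernel_truncatedLog (E := E) M).const_mul (measurable_truncatedLog M)
    2⁻¹).crossEnergy_conv_le (measurable_half_truncatedLog M) hinv μ σ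
  calc eintegral ((σ ∗ μ).prod (σ ∗ μ)) (fun p => logKernel p.1 p.2)
      ≤ ((crossEnergy (fun x y => 2⁻¹ * truncatedLog M x y) (σ ∗ μ) (σ ∗ μ) : ℝ≥0∞) : EReal)
        + ((-(2⁻¹ * Real.log M) : ℝ) : EReal) := by
        rw [← eintegral_truncatedLog_add]
        exact eintegral_mono_ae (ae_of_all _ fun p => logKernel_le hM p.1 p.2)
    _ ≤ ((crossEnergy (fun x y => 2⁻¹ * truncatedLog M x y) μ μ : ℝ≥0∞) : EReal)
        + ((-(2⁻¹ * Real.log M) : ℝ) : EReal) := by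
        gcongr
        exact_mod_cast hconv
    _ = (((crossEnergy (fun x y => 2⁻¹ * truncatedLog M x y) μ μ : ℝ≥0∞) : EReal)
        + ((-(2⁻¹ * Real.log M) - R ^ 2 / (2 * M) : ℝ) : EReal))
        + ((R ^ 2 / (2 * M) : ℝ) : EReal) := by
        rw [add_assoc, ← EReal.coe_add, sub_add_cancel]
    _ ≤ _ := by
        gcongr
        rw [← eintegral_truncatedLog_add]
        exact eintegral_mono_ae ((ae_prod_mem hμ hμ).mono fun p hp =>
          le_logKernel hM (hR _ hp.1 _ hp.2))

theorem eintegral_logKernel_conv_lt {K : Set E} (hK : IsCompact K) {μ : Measure E}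
    [IsProbabilityMeasure μ] (hμ : μ Kᶜ = 0) (σ : Measure E) [IsProbabilityMeasure σ] {a : EReal}
    (ha : eintegral (μ.prod μ) (fun p => logKernel p.1 p.2) < a) :
    eintegral ((σ ∗ μ).prod (σ ∗ μ)) (fun p => logKernel p.1 p.2) < a := by
  obtain ⟨d, hd1, hd2⟩ := EReal.lt_iff_exists_real_btwn.1 ha
  obtain ⟨c, hc1, hc2⟩ := EReal.lt_iff_exists_real_btwn.1 hd1
  have hcd : c < d := by exact_mod_cast hc2
  set R : ℝ := Metric.diam K + 1 with hRdef
  have hR0 : 0 < R := by have := Metric.diam_nonneg (s := K); linarith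
  have hR : ∀ x ∈ K, ∀ y ∈ K, dist x y ≤ R := fun x hx y hy =>
    (Metric.dist_le_diam_of_mem hK.isBounded hx hy).trans (by linarith)
  -- This $M$ makes the error $R^2/(2M)$ equal to $d-c$. The summand $1$ in $R$ keeps $M$ positive
  -- even when the diameter is zero.
  have hM : 0 < R ^ 2 / (2 * (d - c)) := by have := sub_pos.2 hcd; positivity
  refine (eintegral_logKernel_conv_le hM hR μ σ hμ).trans_lt (lt_of_le_of_lt ?_ hd2)
  have : R ^ 2 / (2 * (R ^ 2 / (2 * (d - c)))) = d - c := by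
    have := (sub_pos.2 hcd).ne'; field_simp
  rw [this]
  calc _ ≤ (c : EReal) + ((d - c : ℝ) : EReal) := by gcongr
    _ = d := by rw [← EReal.coe_add]; congr 1; ring

end Log

/-! ### Measures of finite Riesz energy near the thin strip optimum. -/

section Interior

variable {E : Type*} [NormedAddCommGroup E] [InnerProductSpace ℝ E] [FiniteDimensional ℝ E]
  [MeasurableSpace E] [BorelSpace E]

/-- Convolution with a small ball moves the measures on a compact subset of the interior to
measures on the set itself, of finite Riesz energy. -/
theorem exists_mollifier [Nontrivial E] {q : ℝ} (hq : 0 < q) (hqn : q < Module.finrank ℝ E)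
    {K Q : Set E} (hK : IsCompact K) (hQ : IsCompact Q) (hQK : Q ⊆ interior K) :
    ∃ σ : Measure E, IsProbabilityMeasure σ ∧ ∀ μ : Measure E, IsProbabilityMeasure μ → μ Qᶜ = 0 →
      (σ ∗ μ) Kᶜ = 0 ∧ crossEnergy (rieszKernel q) (σ ∗ μ) (σ ∗ μ) ≠ ⊤ := by
  obtain ⟨δ, hδ, hδK⟩ := hQ.exists_thickening_subset_open isOpen_interior hQK
  have hσ := isProbabilityMeasure_uniformBall (E := E) hδ
  obtain ⟨C, hC, hCb⟩ := exists_bound_uniformBall (E := E) hq hqn hδ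
  refine ⟨uniformBall E δ, hσ, fun μ _ hμ => ⟨?_, ?_⟩⟩
  · exact conv_uniformBall_compl hμ hK.measurableSet (hδK.trans interior_subset) hδ
  · exact ne_top_of_le_ne_top hC (crossEnergy_conv_le_of_bound (measurable_rieszKernel q) μ _ hCb)

/-- A nearly optimal measure on $Q$ may have infinite $q$-energy. Mollification makes it finite and
keeps the endpoint energy below $a$: directly for $q>1$, through the truncated logarithm for $q=1$.
-/
theorem exists_finite_energy_lt [Nontrivial E] {q : ℝ} (hq : 1 ≤ q)
    (hqn : q < Module.finrank ℝ E) {K Q : Set E} (hK : IsCompact K) (hQ : IsCompact Q)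
    (hQK : Q ⊆ interior K) {a : EReal} (ha : energy (endpointKernel q) Q < a) :
    ∃ ν : Measure E, IsProbabilityMeasure ν ∧ ν Kᶜ = 0 ∧
      ∫⁻ p, rieszKernel q p.1 p.2 ∂(ν.prod ν) ≠ ⊤ ∧
      eintegral (ν.prod ν) (fun p => endpointKernel q p.1 p.2) < a := by
  obtain ⟨σ, hσ, hσQ⟩ := exists_mollifier (by linarith) hqn hK hQ hQK
  obtain ⟨μ, hμ, hμQ, hlt⟩ := exists_lt_of_energy_lt ha
  obtain ⟨h1, h2⟩ := hσQ μ hμ hμQ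
  rw [crossEnergy_eq_lintegral_prod (measurable_rieszKernel q)] at h2
  refine ⟨σ ∗ μ, inferInstance, h1, h2, ?_⟩
  by_cases h : 1 < q
  · simp only [endpointKernel, if_pos h] at hlt ⊢
    rw [eintegral_const_mul (thinConst_pos h), eintegral_coe] at hlt ⊢
    refine lt_of_le_of_lt (mul_le_mul_of_nonneg_left ?_ (by exact_mod_cast (thinConst_pos h).le)) hlt
    have := (posDefKernel_rieszKernel (E := E) (p := q - 1) (by linarith)).crossEnergy_conv_le
      (measurable_rieszKernel _) (fun a x y => by simp [rieszKernel]) μ σ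
    rw [crossEnergy_eq_lintegral_prod (measurable_rieszKernel _),
      crossEnergy_eq_lintegral_prod (measurable_rieszKernel _)] at this
    exact_mod_cast this
  · simp only [endpointKernel, if_neg h] at hlt ⊢
    exact eintegral_logKernel_conv_lt hQ hμQ σ hlt

theorem exists_finite_rieszEnergy [Nontrivial E] {q : ℝ} (hq : 0 < q)
    (hqn : q < Module.finrank ℝ E) {K : Set E} (hK : IsCompact K) (hi : (interior K).Nonempty) :
    ∃ ν : Measure E, IsProbabilityMeasure ν ∧ ν Kᶜ = 0 ∧
      ∫⁻ p, rieszKernel q p.1 p.2 ∂(ν.prod ν) ≠ ⊤ := by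
  obtain ⟨x, hx⟩ := hi
  obtain ⟨σ, hσ, hσQ⟩ := exists_mollifier hq hqn hK isCompact_singleton (singleton_subset_iff.2 hx)
  obtain ⟨h1, h2⟩ := hσQ (Measure.dirac x) inferInstance (by simp)
  rw [crossEnergy_eq_lintegral_prod (measurable_rieszKernel q)] at h2
  exact ⟨σ ∗ Measure.dirac x, inferInstance, h1, h2⟩

end Interior

/-! ### The limits $t\to\infty$ and $t\to0^+$. -/

section Limits

variable {n : ℕ}

local notation "𝔼" => EuclideanSpace ℝ (Fin n)

theorem rieszEnergy_nonneg (q : ℝ) (K : Set 𝔼) : 0 ≤ rieszEnergy q K := by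
  rw [rieszEnergy_eq_iInf]
  exact le_iInf fun μ => le_iInf fun _ => le_iInf fun _ => EReal.coe_ennreal_nonneg _

theorem abs_integral_stripRegular_le {q t R b : ℝ} (hRt : R ≤ t)
    {K : Set 𝔼} (hR : ∀ x ∈ K, ∀ y ∈ K, dist x y ≤ R)
    (hb : ∀ r, 0 ≤ r → r ≤ t → |stripRegular q t r| ≤ b)
    (μ : Measure 𝔼) [IsProbabilityMeasure μ] (hμ : μ Kᶜ = 0) :
    |∫ p, stripRegular q t (dist p.1 p.2) ∂(μ.prod μ)| ≤ b := by
  have := norm_integral_le_of_norm_le_const (μ := μ.prod μ) (C := b)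
    (f := fun p : 𝔼 × 𝔼 => stripRegular q t (dist p.1 p.2))
    ((ae_prod_mem hμ hμ).mono fun p hp => hb _ dist_nonneg ((hR _ hp.1 _ hp.2).trans hRt))
  simpa using this

theorem tendsto_stripEnergy_atTop {q : ℝ} (hq : 1 ≤ q) {K : Set 𝔼} (hK : IsCompact K)
    (hfin : rieszEnergy q K < ⊤) :
    Tendsto (fun t : ℝ => stripEnergy q K t) atTop (𝓝 (rieszEnergy q K)) := by
  obtain ⟨e, -, he⟩ := exists_contDiffOn_stripEnergy hq hK hfin
  obtain ⟨b, hb0, hb⟩ := exists_bound_stripRegular hq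
  have hnn := rieszEnergy_nonneg q K
  have hbot : rieszEnergy q K ≠ ⊥ := fun h => by simp [h] at hnn
  obtain ⟨v, hv⟩ : ∃ v : ℝ, rieszEnergy q K = v := ⟨_, (EReal.coe_toReal hfin.ne hbot).symm⟩
  set R : ℝ := Metric.diam K + 1 with hRdef
  have hR0 : 0 < R := by have := Metric.diam_nonneg (s := K); linarith
  have hR : ∀ x ∈ K, ∀ y ∈ K, dist x y ≤ R := fun x hx y hy =>
    (Metric.dist_le_diam_of_mem hK.isBounded hx hy).trans (by linarith)
  -- For $t\ge R$ every distance in $K$ is at most $t$, so the two energies of each measure differ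
  -- by at most $b(t)$ when finite, and so do their infima.
  have hbound : ∀ t, R ≤ t → |e t - v| ≤ b t := by
    intro t hRt
    have ht : 0 < t := hR0.trans_le hRt
    have hint : ∀ μ : Measure 𝔼, IsProbabilityMeasure μ → μ Kᶜ = 0 →
        |∫ p, stripRegular q t (dist p.1 p.2) ∂(μ.prod μ)| ≤ b t := fun μ _ hμ =>
      abs_integral_stripRegular_le hRt hR (fun r h1 h2 => hb t r ht h1 h2) μ hμ
    rw [abs_le]
    constructor
    · have h : ((v - b t : ℝ) : EReal) ≤ stripEnergy q K t := by
        refine le_energy fun μ hμ1 hμ => ?_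
        rw [eintegral_stripKernel hq ht hK μ hμ, totalEnergy, EReal.coe_sub, sub_eq_add_neg, ← hv,
          rieszEnergy_eq_iInf, ← EReal.coe_neg]
        refine add_le_add (iInf_le_of_le μ (iInf_le_of_le hμ1 (iInf_le_of_le hμ le_rfl))) ?_
        exact EReal.coe_le_coe_iff.2 (abs_le.1 (hint μ hμ1 hμ)).1
      rw [he t ht, EReal.coe_le_coe_iff] at h
      linarith
    · have h : ((e t - b t : ℝ) : EReal) ≤ rieszEnergy q K := by
        rw [rieszEnergy_eq_iInf]
        refine le_iInf fun μ => le_iInf fun hμ1 => le_iInf fun hμ => ?_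
        rw [EReal.coe_sub, ← he t ht]
        refine EReal.sub_le_of_le_add ?_
        refine (energy_le μ hμ).trans ?_
        rw [eintegral_stripKernel hq ht hK μ hμ, totalEnergy]
        gcongr
        exact (abs_le.1 (hint μ hμ1 hμ)).2
      rw [hv, EReal.coe_le_coe_iff] at h
      linarith
  have hlim : Tendsto e atTop (𝓝 v) := by
    rw [tendsto_iff_dist_tendsto_zero]
    refine squeeze_zero' (Eventually.of_forall fun _ => dist_nonneg) ?_ hb0
    filter_upwards [eventually_ge_atTop R] with t ht using hbound t ht
  rw [hv]
  refine ((continuous_coe_real_ereal.tendsto v).comp hlim).congr' ?_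
  filter_upwards [eventually_gt_atTop 0] with t ht using (he t ht).symm

theorem endpointKernel_le_mul_stripKernel {q t : ℝ} (hq : 1 ≤ q) (ht : 0 < t) (x y : 𝔼) :
    endpointKernel q x y ≤ (t : EReal) * stripKernel q t (pt x 0) (pt y 0) := by
  rw [stripKernel_eq hq ht]
  by_cases h : x = y
  · subst h
    rw [rieszKernel_self (by linarith), EReal.coe_ennreal_top, EReal.top_add_coe,
      EReal.coe_mul_top_of_pos ht]
    exact le_top
  · rw [endpointKernel_of_ne h, rieszKernel_of_ne h, EReal.coe_ennreal_ofReal,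
      max_eq_left (by positivity), ← EReal.coe_add, ← EReal.coe_mul, EReal.coe_le_coe_iff]
    exact thinProfile_le hq ht (dist_pos.2 h)

theorem thinEndpoint_le_mul_stripEnergy {q t : ℝ} (hq : 1 ≤ q) (ht : 0 < t) (K : Set 𝔼) :
    thinEndpoint q K ≤ (t : EReal) * stripEnergy q K t := by
  rw [thinEndpoint_eq_energy, stripEnergy, ← energy_const_mul ht]
  refine le_energy fun μ _ hμ => (energy_le μ hμ).trans ?_
  exact eintegral_mono_ae (ae_of_all _ fun p => endpointKernel_le_mul_stripKernel hq ht p.1 p.2)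

theorem thinEndpoint_le_liminf {q : ℝ} (hq : 1 ≤ q) (K : Set 𝔼) :
    thinEndpoint q K ≤ liminf (fun t : ℝ => (t : EReal) * stripEnergy q K t) (𝓝[>] 0) := by
  refine le_liminf_of_le (by isBoundedDefault) ?_
  filter_upwards [self_mem_nhdsWithin] with t ht using thinEndpoint_le_mul_stripEnergy hq ht K

/-- The endpoint kernel dominates $t$ times the regular part. The singular part stays as a separate
term, which vanishes as $t\to0$ when the $q$-energy of $\mu$ is finite. -/
theorem mul_stripEnergy_le {q t : ℝ} (hq : 1 ≤ q) (ht : 0 < t) {K : Set 𝔼} (hK : IsCompact K)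
    (μ : Measure 𝔼) [IsProbabilityMeasure μ] (hμ : μ Kᶜ = 0) :
    (t : EReal) * stripEnergy q K t
      ≤ t * ((∫⁻ p, rieszKernel q p.1 p.2 ∂(μ.prod μ) : ℝ≥0∞) : EReal)
        + eintegral (μ.prod μ) (fun p => endpointKernel q p.1 p.2) := by
  have hc := continuous_stripRegular_dist (E := 𝔼) hq t
  have hct : Continuous fun p : 𝔼 × 𝔼 => t * stripRegular q t (dist p.1 p.2) :=
    continuous_const.mul hc
  have hi := integrable_prod_of_continuous hct hK hμ hμ
  have h1 := mul_le_mul_of_nonneg_left (energy_le (k := fun x y => stripKernel q t (pt x 0) (pt y 0))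
    μ hμ) (show (0 : EReal) ≤ t by exact_mod_cast ht.le)
  refine h1.trans ?_
  rw [eintegral_stripKernel hq ht hK μ hμ, totalEnergy,
    EReal.left_distrib_of_nonneg_of_ne_top (by exact_mod_cast ht.le) (EReal.coe_ne_top t),
    ← EReal.coe_mul, ← integral_const_mul]
  gcongr
  have h2 := eintegral_coe_add (μ := μ.prod μ) (f := fun _ => 0) measurable_const
    hct.measurable hi
  simp only [lintegral_zero, EReal.coe_ennreal_zero, zero_add] at h2
  rw [← h2]
  refine eintegral_mono_ae (ae_of_all _ fun p => ?_)
  by_cases h : p.1 = p.2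
  · rw [h, endpointKernel_self]
    exact le_top
  · rw [endpointKernel_of_ne h, EReal.coe_le_coe_iff]
    exact mul_stripRegular_le hq ht (dist_pos.2 h)

theorem tendsto_mul_stripEnergy [Nontrivial 𝔼] {q : ℝ} (hq : 1 ≤ q) (hqn : q < n) {K : Set 𝔼}
    (hK : IsCompact K) (happrox : ∀ a, thinEndpoint q K < a →
      ∃ Q, IsCompact Q ∧ Q ⊆ interior K ∧ thinEndpoint q Q < a) :
    Tendsto (fun t : ℝ => (t : EReal) * stripEnergy q K t) (𝓝[>] 0) (𝓝 (thinEndpoint q K)) := by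
  refine tendsto_order.2 ⟨fun a ha => ?_, fun a ha => ?_⟩
  · filter_upwards [self_mem_nhdsWithin] with t ht using
      ha.trans_le (thinEndpoint_le_mul_stripEnergy hq ht K)
  · obtain ⟨Q, hQ, hQK, hlt⟩ := happrox a ha
    rw [thinEndpoint_eq_energy] at hlt
    obtain ⟨ν, hν, hνK, hfin, hνa⟩ := exists_finite_energy_lt hq (by simpa using hqn) hK hQ hQK hlt
    obtain ⟨d, hd1, hd2⟩ := EReal.lt_iff_exists_real_btwn.1 hνa
    obtain ⟨c, hc1, hc2⟩ := EReal.lt_iff_exists_real_btwn.1 hd1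
    have hcd : c < d := by exact_mod_cast hc2
    set I : ℝ := (∫⁻ p, rieszKernel q p.1 p.2 ∂(ν.prod ν)).toReal with hI
    have hsmall : ∀ᶠ t : ℝ in 𝓝[>] 0, t * I < d - c := by
      have : Tendsto (fun t : ℝ => t * I) (𝓝[>] 0) (𝓝 (0 * I)) :=
        (continuous_id.mul continuous_const).continuousAt.tendsto.mono_left nhdsWithin_le_nhds
      rw [zero_mul] at this
      exact this.eventually_lt_const (sub_pos.2 hcd)
    filter_upwards [self_mem_nhdsWithin, hsmall] with t ht hts
    refine ((mul_stripEnergy_le hq ht hK ν hνK).trans ?_).trans_lt hd2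
    rw [← EReal.coe_ennreal_toReal hfin, ← EReal.coe_mul]
    calc _ ≤ ((t * I : ℝ) : EReal) + (c : EReal) := by gcongr
      _ = ((t * I + c : ℝ) : EReal) := rfl
      _ ≤ d := EReal.coe_le_coe_iff.2 (by linarith)

end Limits

/-! ### From capacities to energies. -/

section Capacity

variable {n : ℕ}

local notation "𝔼" => EuclideanSpace ℝ (Fin n)

/-- Capacity is a strictly decreasing function of energy, so approximating the capacity from below
approximates the energy from above. -/
theorem thinEndpoint_lt_of_capacity {q : ℝ} {K : Set 𝔼} (hcap : InteriorCapacitable (q - 1) K)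
    {a : EReal} (ha : thinEndpoint q K < a) :
    ∃ Q, IsCompact Q ∧ Q ⊆ interior K ∧ thinEndpoint q Q < a := by
  by_cases h : 1 < q
  · have hp : 0 < q - 1 := by linarith
    have hc := thinConst_pos h
    simp only [thinEndpoint, if_pos h] at ha ⊢
    obtain ⟨d, hd1, hd2⟩ := EReal.lt_iff_exists_real_btwn.1 ha
    have hcne : (0 : EReal) ≤ (thinConst (q - 1) : ℝ) := by exact_mod_cast hc.le
    have hmul : ((thinConst (q - 1) : ℝ) : EReal) * ((d / thinConst (q - 1) : ℝ) : EReal) = d := by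
      rw [← EReal.coe_mul, mul_div_cancel₀ _ hc.ne']
    have hlt : rieszEnergy (q - 1) K < ((d / thinConst (q - 1) : ℝ) : EReal) := by
      by_contra! hle
      have := mul_le_mul_of_nonneg_left hle hcne
      rw [hmul] at this
      exact absurd hd1 this.not_gt
    have hd0 : (0 : EReal) < ((d / thinConst (q - 1) : ℝ) : EReal) :=
      (rieszEnergy_nonneg _ K).trans_lt hlt
    set D : ℝ≥0∞ := ENNReal.ofReal (d / thinConst (q - 1)) with hD
    have hDtop : D ≠ ⊤ := ENNReal.ofReal_ne_top
    have h1 : (rieszEnergy (q - 1) K).toENNReal < D := by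
      rw [hD, ← EReal.real_coe_toENNReal]
      exact EReal.toENNReal_lt_toENNReal (rieszEnergy_nonneg _ K) hlt
    have h2 : D ^ (-(1 / (q - 1))) < capacity (q - 1) K := by
      rw [capacity, if_pos hp, ENNReal.rpow_neg, ENNReal.rpow_neg, ENNReal.inv_lt_inv]
      exact ENNReal.rpow_lt_rpow h1 (by positivity)
    rw [hcap] at h2
    simp only [lt_iSup_iff] at h2
    obtain ⟨Q, hQ, hQK, h3⟩ := h2
    refine ⟨Q, hQ, hQK, ?_⟩
    rw [capacity, if_pos hp, ENNReal.rpow_neg, ENNReal.rpow_neg, ENNReal.inv_lt_inv,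
      ENNReal.rpow_lt_rpow_iff (by positivity)] at h3
    refine lt_of_le_of_lt ?_ hd2
    rw [← hmul]
    refine mul_le_mul_of_nonneg_left ?_ hcne
    by_contra! hle
    have := EReal.toENNReal_lt_toENNReal hd0.le hle
    rw [EReal.real_coe_toENNReal] at this
    exact absurd h3 this.not_gt
  · have hp : ¬ 0 < q - 1 := by linarith
    simp only [thinEndpoint, if_neg h] at ha ⊢
    have h2 : EReal.exp (-a) < capacity (q - 1) K := by
      rw [capacity, if_neg hp, EReal.exp_lt_exp_iff, EReal.neg_lt_neg_iff]
      exact ha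
    rw [hcap] at h2
    simp only [lt_iSup_iff] at h2
    obtain ⟨Q, hQ, hQK, h3⟩ := h2
    rw [capacity, if_neg hp, EReal.exp_lt_exp_iff, EReal.neg_lt_neg_iff] at h3
    exact ⟨Q, hQ, hQK, h3⟩

theorem capacity_mono (p : ℝ) {K L : Set 𝔼} (h : K ⊆ L) : capacity p K ≤ capacity p L := by
  rw [capacity, capacity]
  split_ifs with hp
  · rw [ENNReal.rpow_neg, ENNReal.rpow_neg, ENNReal.inv_le_inv]
    exact ENNReal.rpow_le_rpow (EReal.toENNReal_le_toENNReal (energy_anti h)) (by positivity)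
  · exact EReal.exp_monotone (EReal.neg_le_neg_iff.2 (energy_anti h))

end Capacity

/-! ### Homothety, and convex bodies. -/

section Scaling

variable {n : ℕ}

local notation "𝔼" => EuclideanSpace ℝ (Fin n)

theorem eintegral_map {X Y : Type*} [MeasurableSpace X] [MeasurableSpace Y] {μ : Measure X}
    {g : X → Y} (hg : Measurable g) {f : Y → EReal} (hf : Measurable f) :
    eintegral (μ.map g) f = eintegral μ (fun x => f (g x)) := by
  rw [eintegral, eintegral, lintegral_map hf.ereal_toENNReal hg,
    lintegral_map (f := fun y => (-f y).toENNReal)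
      (continuous_neg.measurable.comp hf).ereal_toENNReal hg]

theorem measurable_logKernel {E : Type*} [NormedAddCommGroup E] [InnerProductSpace ℝ E]
    [FiniteDimensional ℝ E] [MeasurableSpace E] [BorelSpace E] :
    Measurable fun p : E × E => logKernel p.1 p.2 :=
  continuous_neg.measurable.comp
    (ENNReal.measurable_log.comp (measurable_fst.edist measurable_snd))

/-- The lower bound makes $f-m$ nonnegative, so both integrals are instances of `eintegral_coe_add`
with the constants $m+c$ and $m$. -/
theorem eintegral_add_const {X : Type*} [MeasurableSpace X] {μ : Measure X} [IsProbabilityMeasure μ]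
    {f : X → EReal} (hf : Measurable f) {m : ℝ} (hm : ∀ᵐ x ∂μ, (m : EReal) ≤ f x) (c : ℝ) :
    eintegral μ (fun x => f x + c) = eintegral μ f + c := by
  have hg : Measurable fun x => (f x - m).toENNReal :=
    (hf.add measurable_const).ereal_toENNReal
  have h : ∀ c : ℝ, eintegral μ (fun x => f x + c)
      = ((∫⁻ x, (f x - m).toENNReal ∂μ : ℝ≥0∞) : EReal) + ((m + c : ℝ) : EReal) := by
    intro c
    have h1 := eintegral_coe_add (μ := μ) hg (measurable_const (a := m + c)) (integrable_const _)
    simp only [integral_const, probReal_univ, one_smul] at h1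
    rw [← h1]
    refine eintegral_congr_ae (hm.mono fun x hx => ?_)
    rw [EReal.coe_toENNReal ((EReal.sub_nonneg (.inr (EReal.coe_ne_top m)) (.inr (EReal.coe_ne_bot m))).2 hx),
      EReal.coe_add, ← add_assoc, EReal.sub_add_cancel]
  have h0 := h 0
  simp only [EReal.coe_zero, add_zero] at h0
  rw [h, h0, EReal.coe_add, add_assoc]

theorem energy_image_le {X Y : Type*} [MeasurableSpace X] [MeasurableSpace Y] {g : X → Y}
    (hg : Measurable g) {k : Y → Y → EReal} (hk : Measurable fun p : Y × Y => k p.1 p.2) {K : Set X}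
    (hK : MeasurableSet (g '' K)) :
    energy k (g '' K) ≤ energy (fun x y => k (g x) (g y)) K := by
  refine le_energy fun μ _ hμ => ?_
  have := Measure.isProbabilityMeasure_map (μ := μ) hg.aemeasurable
  refine (energy_le (μ.map g) ?_).trans ?_
  · rw [Measure.map_apply hg hK.compl]
    exact measure_mono_null (fun x hx hxK => hx (mem_image_of_mem g hxK)) hμ
  · rw [Measure.map_prod_map μ μ hg hg, eintegral_map (hg.prodMap hg) hk]
    exact le_rfl

theorem edist_contraction {l : ℝ} (hl : 0 < l) (x₀ x y : 𝔼) :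
    edist (x₀ + l • (x - x₀)) (x₀ + l • (y - x₀)) = ENNReal.ofReal l * edist x y := by
  rw [edist_add_left, edist_smul₀, edist_sub_right, ENNReal.smul_def, smul_eq_mul]
  congr 1
  rw [← enorm_eq_nnnorm, Real.enorm_of_nonneg hl.le]

theorem dist_contraction {l : ℝ} (hl : 0 < l) (x₀ x y : 𝔼) :
    dist (x₀ + l • (x - x₀)) (x₀ + l • (y - x₀)) = l * dist x y := by
  rw [dist_add_left, dist_smul₀, dist_sub_right, Real.norm_of_nonneg hl.le]

theorem rieszEnergy_contraction_le {p l : ℝ} (hl : 0 < l) (x₀ : 𝔼) {K : Set 𝔼}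
    (hK : IsCompact K) :
    rieszEnergy p ((fun x => x₀ + l • (x - x₀)) '' K)
      ≤ ((l ^ (-p) : ℝ) : EReal) * rieszEnergy p K := by
  have hg : Continuous fun x : 𝔼 => x₀ + l • (x - x₀) := by fun_prop
  refine (energy_image_le hg.measurable (measurable_rieszKernel p).coe_ereal_ennreal
    (hK.image hg).measurableSet).trans ?_
  rw [rieszEnergy, ← energy_const_mul (Real.rpow_pos_of_pos hl _)]
  refine le_of_eq ?_
  congr 1
  ext x y
  rw [rieszKernel, rieszKernel, edist_contraction hl,
    ENNReal.mul_rpow_of_ne_top ENNReal.ofReal_ne_top (edist_ne_top _ _), EReal.coe_ennreal_mul,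
    ENNReal.ofReal_rpow_of_pos hl, EReal.coe_ennreal_ofReal, max_eq_left (by positivity)]

theorem logEnergy_contraction_le {l : ℝ} (hl : 0 < l) (x₀ : 𝔼) {K : Set 𝔼} (hK : IsCompact K) :
    logEnergy ((fun x => x₀ + l • (x - x₀)) '' K) ≤ logEnergy K + ((-Real.log l : ℝ) : EReal) := by
  have hg : Continuous fun x : 𝔼 => x₀ + l • (x - x₀) := by fun_prop
  have hkernel : ∀ x y : 𝔼, logKernel (x₀ + l • (x - x₀)) (x₀ + l • (y - x₀))
      = logKernel x y + ((-Real.log l : ℝ) : EReal) := by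
    intro x y
    by_cases h : x = y
    · rw [h, logKernel_self, logKernel_self, EReal.top_add_coe]
    · have hd := dist_pos.2 h
      have hne : x₀ + l • (x - x₀) ≠ x₀ + l • (y - x₀) := by
        rw [← dist_pos, dist_contraction hl]
        positivity
      rw [logKernel_of_ne hne, logKernel_of_ne h, dist_contraction hl,
        Real.log_mul hl.ne' hd.ne', ← EReal.coe_add]
      congr 1
      ring
  have h1 : logEnergy ((fun x => x₀ + l • (x - x₀)) '' K)
      ≤ energy (fun x y => logKernel x y + ((-Real.log l : ℝ) : EReal)) K := by
    simp only [← hkernel]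
    exact energy_image_le hg.measurable measurable_logKernel (hK.image hg).measurableSet
  refine h1.trans ?_
  rw [EReal.coe_neg, ← sub_eq_add_neg]
  refine (EReal.le_sub_iff_add_le (.inl (EReal.coe_ne_bot _)) (.inl (EReal.coe_ne_top _))).2 ?_
  refine le_energy fun μ _ hμ => ?_
  set R : ℝ := Metric.diam K + 1 with hRdef
  have hm : ∀ᵐ p ∂μ.prod μ, ((-Real.log R : ℝ) : EReal) ≤ logKernel p.1 p.2 := by
    refine (ae_prod_mem hμ hμ).mono fun p hp => ?_
    by_cases h : p.1 = p.2
    · rw [h, logKernel_self]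
      exact le_top
    · rw [logKernel_of_ne h, EReal.coe_le_coe_iff, neg_le_neg_iff]
      exact Real.log_le_log (dist_pos.2 h)
        ((Metric.dist_le_diam_of_mem hK.isBounded hp.1 hp.2).trans (by linarith))
  have h2 := energy_le (k := fun x y => logKernel x y + ((-Real.log l : ℝ) : EReal)) μ hμ
  rw [eintegral_add_const measurable_logKernel hm] at h2
  calc _ ≤ (eintegral (μ.prod μ) (fun p => logKernel p.1 p.2) + ((-Real.log l : ℝ) : EReal))
        + ((Real.log l : ℝ) : EReal) := add_le_add_left h2 _
    _ = _ := by rw [add_assoc, ← EReal.coe_add, neg_add_cancel, EReal.coe_zero, add_zero]; rfl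

theorem mul_capacity_le_contraction {p l : ℝ} (hl : 0 < l) (x₀ : 𝔼) {K : Set 𝔼}
    (hK : IsCompact K) :
    ENNReal.ofReal l * capacity p K ≤ capacity p ((fun x => x₀ + l • (x - x₀)) '' K) := by
  have hl0 : ENNReal.ofReal l ≠ 0 := by simpa using hl
  rw [capacity, capacity]
  split_ifs with hp
  · have h1 := EReal.toENNReal_le_toENNReal (rieszEnergy_contraction_le (p := p) hl x₀ hK)
    rw [EReal.toENNReal_mul (by exact_mod_cast (Real.rpow_pos_of_pos hl _).le),
      EReal.real_coe_toENNReal] at h1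
    have h2 := ENNReal.rpow_le_rpow h1 (show 0 ≤ 1 / p by positivity)
    rw [ENNReal.mul_rpow_of_nonneg _ _ (by positivity), ← ENNReal.ofReal_rpow_of_pos hl,
      ← ENNReal.rpow_mul, show -p * (1 / p) = -1 by field_simp, ENNReal.rpow_neg_one] at h2
    rw [ENNReal.rpow_neg, ENNReal.rpow_neg]
    refine le_trans (le_of_eq ?_) (ENNReal.inv_le_inv.2 h2)
    rw [ENNReal.mul_inv (.inl (ENNReal.inv_ne_zero.2 ENNReal.ofReal_ne_top))
      (.inl (ENNReal.inv_ne_top.2 hl0)), inv_inv]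
  · have h1 := EReal.exp_monotone (EReal.neg_le_neg_iff.2 (logEnergy_contraction_le hl x₀ hK))
    refine le_trans (le_of_eq ?_) h1
    rw [EReal.neg_add (.inr (EReal.coe_ne_top _)) (.inr (EReal.coe_ne_bot _)), sub_eq_add_neg,
      ← EReal.coe_neg, neg_neg, EReal.exp_add, EReal.exp_coe, Real.exp_log hl, mul_comm]

/-- Contraction by a factor $a<1$ towards an interior point sends $K$ into its interior and
multiplies the capacity by at least $a$; then $a\to1$. -/
theorem interiorCapacitable_of_convex {p : ℝ} {K : Set 𝔼} (hK : IsCompact K)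
    (hconv : Convex ℝ K) (hi : (interior K).Nonempty) : InteriorCapacitable p K := by
  obtain ⟨x₀, hx₀⟩ := hi
  refine le_antisymm ?_ (iSup_le fun Q => iSup_le fun _ => iSup_le fun hQ =>
    capacity_mono p (hQ.trans interior_subset))
  refine ENNReal.le_of_forall_lt_one_mul_le fun a ha => ?_
  rcases eq_or_ne a 0 with rfl | ha0
  · simp
  have hat : a ≠ ⊤ := (ha.trans ENNReal.one_lt_top).ne
  have hl : 0 < a.toReal := ENNReal.toReal_pos ha0 hat
  have hl1 : a.toReal < 1 := by simpa using (ENNReal.toReal_lt_toReal hat ENNReal.one_ne_top).2 ha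
  rw [← ENNReal.ofReal_toReal hat]
  refine (mul_capacity_le_contraction hl x₀ hK).trans ?_
  refine le_iSup_of_le _ (le_iSup_of_le (hK.image (by fun_prop)) (le_iSup_of_le ?_ le_rfl))
  rintro _ ⟨x, hx, rfl⟩
  -- $x_0+a(x-x_0)=x+(1-a)(x_0-x)$ moves $x$ a positive fraction of the way to $x_0$.
  have := hconv.add_smul_sub_mem_interior hx hx₀ (t := 1 - a.toReal)
    ⟨by linarith, by linarith⟩
  convert this using 1
  module

end Scaling

end RieszStrip

end

theorem theorem1p1 (n : ℕ) (q : ℝ) (hq : 1 ≤ q) (hqn : q < n) :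
    (∀ K : Set (EuclideanSpace ℝ (Fin n)), IsCompact K → RieszStrip.rieszEnergy q K < ⊤ →
      -- the energy is a real-valued `C¹` function of `t > 0`
      (∃ e : ℝ → ℝ, ContDiffOn ℝ 1 e (Ioi 0) ∧
        ∀ t : ℝ, 0 < t → RieszStrip.stripEnergy q K t = (e t : EReal)) ∧
      Tendsto (fun t : ℝ => RieszStrip.stripEnergy q K t) atTop
        (𝓝 (RieszStrip.rieszEnergy q K)) ∧
      RieszStrip.thinEndpoint q K ≤
        liminf (fun t : ℝ => (t : EReal) * RieszStrip.stripEnergy q K t) (𝓝[>] 0) ∧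
      (RieszStrip.InteriorCapacitable (q - 1) K →
        Tendsto (fun t : ℝ => (t : EReal) * RieszStrip.stripEnergy q K t) (𝓝[>] 0)
          (𝓝 (RieszStrip.thinEndpoint q K)))) ∧
    -- convex bodies
    (∀ K : Set (EuclideanSpace ℝ (Fin n)), IsCompact K → Convex ℝ K → (interior K).Nonempty →
      RieszStrip.rieszEnergy q K < ⊤ ∧
      RieszStrip.InteriorCapacitable (q - 1) K ∧
      Tendsto (fun t : ℝ => (t : EReal) * RieszStrip.stripEnergy q K t) (𝓝[>] 0)
        (𝓝 (RieszStrip.thinEndpoint q K))) := by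
  have hn : 0 < n := by
    have : (0 : ℝ) < n := by linarith
    exact_mod_cast this
  -- Positive dimension makes the space nontrivial, as the polar coordinates in the mollification
  -- step require.
  have : Nonempty (Fin n) := ⟨⟨0, hn⟩⟩
  have hlim : ∀ K : Set (EuclideanSpace ℝ (Fin n)), IsCompact K →
      RieszStrip.InteriorCapacitable (q - 1) K →
      Tendsto (fun t : ℝ => (t : EReal) * RieszStrip.stripEnergy q K t) (𝓝[>] 0)
        (𝓝 (RieszStrip.thinEndpoint q K)) := fun K hK hcap =>
    RieszStrip.tendsto_mul_stripEnergy hq hqn hK fun _ ha =>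
      RieszStrip.thinEndpoint_lt_of_capacity hcap ha
  refine ⟨fun K hK hfin => ⟨RieszStrip.exists_contDiffOn_stripEnergy hq hK hfin,
    RieszStrip.tendsto_stripEnergy_atTop hq hK hfin, RieszStrip.thinEndpoint_le_liminf hq K,
    hlim K hK⟩, fun K hK hconv hi => ?_⟩
  have hcap := RieszStrip.interiorCapacitable_of_convex (p := q - 1) hK hconv hi
  refine ⟨?_, hcap, hlim K hK hcap⟩
  obtain ⟨ν, hν, hνK, hfin⟩ := RieszStrip.exists_finite_rieszEnergy (q := q) (by linarith)
    (by simpa using hqn) hK hi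
  refine (RieszStrip.energy_le ν hνK).trans_lt ?_
  rw [RieszStrip.eintegral_coe, lt_top_iff_ne_top, Ne, EReal.coe_ennreal_eq_top_iff]
  exact hfin
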